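/- Let $V=\bigoplus_{p\in\mathbb Z}V^{[p]}$ be a differential graded (dg) vertex operator algebra over $\mathbb C$: a cochain complex $(V,d)$ with a chain map $Y(\cdot,x):V\to \mathrm{End}(V)[[x,x^{-1}]]$, $Y(u,x)=\sum_n u_nx^{-n-1}$, where $x$ has degree $-2$ (so $u_nv\in V^{[p+q-2n-2]}$ for $u\in V^{[p]}$, $v\in V^{[q]}$), and a vacuum $\mathbf 1\in V^{[0]}$ with $d\mathbf 1=0$, satisfying the truncation, vacuum and creation properties and the Jacobi identity with Koszul sign $(-1)^{|u||v|}$; together with a conformal vector $\omega\in V^{[4]}\cap V_2$, $d\omega=0$, $Y(\omega,x)=\sum_n L(n)x^{-n-2}$, whose modes satisfy the Virasoro relations, with $L(0)$ semisimple, $V=\bigoplus_{n\in\frac12\mathbb Z}V_n$ its eigenspace decomposition, $\dim V_n<\infty$, $V_n=0$ for $n\ll0$, and $L(-1)v=v_{-2}\mathbf 1$. Put $V^{[p]}_n=V^{[p]}\cap V_n$. Let $C_2(V)=\mathrm{span}\{u_{-2}v\}$ and $R(V)=V/C_2(V)$, with product $\bar u\cdot\bar v=\overline{u_{-1}v}$,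 bracket $\{\bar u,\bar v\}=\overline{u_0v}$, unit $\bar{\mathbf 1}$, differential induced by $d$, and gradings $R^{[p]}$, $R_n$ given by the images of $V^{[p]}$, $V_n$. For $u\in V_n$ and $v\in V$ put $$u\ast v=\sum_{i\ge0}\binom ni u_{i-1}v,\qquad u\circ v=\sum_{i\ge0}\binom ni u_{i-2}v ,$$ let $O(V)$ be the span of all $u\circ v$, and let $A(V)=V/O(V)$ be the Zhu algebra, with the product induced by $\ast$, the unit $[\mathbf 1]$ and the map induced by $d$, where $[u]$ denotes the class of $u$. Let $F^pA(V)$ and $W_nA(V)$ be the images of $\bigoplus_{q\le p}V^{[q]}$ and $\bigoplus_{m\le n}V_m$. Put $\mathrm{gr}^{[*]}A(V)=\bigoplus_{p\in\mathbb Z}F^pA(V)/F^{p-1}A(V)$ and $\mathrm{gr}_*A(V)=\bigoplus_{n\in\frac12\mathbb Z}W_nA(V)/W_{n-\frac12}A(V)$, and let $\mathrm{gr}_*\mathrm{gr}^{[*]}A(V)$ be the associated graded space of $\mathrm{gr}^{[*]}A(V)$ for the filtration by the images of $F^pA(V)\cap W_nA(V)$. Each carries the product, unit and differential induced from $A(V)$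 (the differential has degree $+1$ for $p$ and $0$ for $n$). On $\mathrm{gr}^{[*]}A(V)$ the bracket of the classes of $u\in V^{[p]}$ and $v\in V^{[q]}$ is the class of $[u]\ast[v]-(-1)^{pq}[v]\ast[u]$ in $\mathrm{gr}^{[p+q-2]}$. On $\mathrm{gr}_*\mathrm{gr}^{[*]}A(V)$ the bracket of the classes of $u\in V^{[p]}_n$ and $v\in V^{[q]}_m$ is the class of the same element in bidegree $(p+q-2,\,n+m-1)$. The space $\mathrm{gr}_*A(V)$ is filtered by the images of $F^iA(V)\cap W_nA(V)$, and $R(V)$ by $F^iR(V)=\bigoplus_{q\le i}R^{[q]}$. **Proposition.** All these operations are well defined, and: 1. $R(V)$ and $\mathrm{gr}^{[*]}A(V)$ are graded commutative dg Poisson algebras with bracket of degree $-2$, and there is a well-defined linear map $\eta_F:R(V)\to\mathrm{gr}^{[*]}A(V)$ sending $\bar u$, $u\in V^{[p]}$, to the class of $[u]$ in $F^pA(V)/F^{p-1}A(V)$. It is a surjective morphism of dg Poisson algebras. 2. $R(V)$ and $\mathrm{gr}_*A(V)$ are weight graded, differential filtered, differential filtered commutative algebras. That is, they are unital associative algebras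 with a weight grading and a linear map $d$ preserving weights, and with an increasing, exhaustive, separated, multiplicative filtration $F^\bullet$ by weight graded subspaces such that $dF^i\subseteq F^{i+1}$, $d^2F^i\subseteq F^{i+1}$ and, for $a\in F^p$, $b\in F^q$, $d(ab)-(da\,b+(-1)^pa\,db)\in F^{p+q}$ and $ab-(-1)^{pq}ba\in F^{p+q-1}$. There is a well-defined linear map $\eta_W:R(V)\to\mathrm{gr}_*A(V)$ sending $\bar u$, $u\in V_n$, to the class of $[u]$ in $W_nA(V)/W_{n-\frac12}A(V)$. It is surjective and a morphism of such algebras (it preserves unit, product, $d$, weights and filtrations). 3. $R(V)$ and $\mathrm{gr}_*\mathrm{gr}^{[*]}A(V)$ are weight graded, graded commutative dg Poisson algebras, bigraded by degree and weight, with bracket of degree $-2$ and weight $-1$, and there is a well-defined linear map $\eta_{FW}:R(V)\to\mathrm{gr}_*\mathrm{gr}^{[*]}A(V)$ sending $\bar u$, $u\in V^{[p]}_n$, to the class of $[u]$ in bidegree $(p,n)$. It is a surjective morphism of weight graded dg Poisson algebras. -/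

import Mathlib

open scoped DirectSum

noncomputable section

/-- The coefficient `uₙ` of `x⁻ⁿ⁻¹` in the vertex operator `Y(u, x)`. -/
abbrev mode {X : Type*} [AddCommGroup X] [Module ℂ X] (Y : X →ₗ[ℂ] VertexOperator ℂ X)
    (u : X) (n : ℤ) : Module.End ℂ X :=
  VertexOperator.ncoeff (Y u) n

/-- A differential graded vertex algebra over `ℂ`, with underlying space `X`.  The formal variable
has cohomological degree `-2`; the Jacobi identity is written in components. -/
structure DGVertexAlgebra (X : Type*) [AddCommGroup X] [Module ℂ X] where
  /-- The homogeneous component of cohomological degree `p`. -/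
  deg : ℤ → Submodule ℂ X
  deg_internal : DirectSum.IsInternal deg
  /-- The differential. -/
  d : X →ₗ[ℂ] X
  d_mem : ∀ p : ℤ, ∀ u ∈ deg p, d u ∈ deg (p + 1)
  d_d : ∀ u, d (d u) = 0
  /-- The state-field correspondence `Y(u, x) = ∑ₙ uₙ x⁻ⁿ⁻¹`; the truncation property is part of
  the type `VertexOperator`, and `uₙ v` is `mode Y u n v`. -/
  Y : X →ₗ[ℂ] VertexOperator ℂ X
  /-- The vacuum vector. -/
  vac : X
  vac_mem : vac ∈ deg 0
  d_vac : d vac = 0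
  /-- `Y` has degree `0`. -/
  Y_mem : ∀ p q n : ℤ, ∀ u ∈ deg p, ∀ v ∈ deg q, mode Y u n v ∈ deg (p + q - 2 * n - 2)
  /-- `Y` commutes with the differentials. -/
  d_Y : ∀ p n : ℤ, ∀ u ∈ deg p, ∀ v,
    d (mode Y u n v) = mode Y (d u) n v + (-1 : ℂ) ^ p • mode Y u n (d v)
  vacuum : ∀ (n : ℤ) (v : X), mode Y vac n v = if n = -1 then v else 0
  creation : ∀ v, mode Y v (-1) vac = v
  creation_regular : ∀ n : ℤ, 0 ≤ n → ∀ v, mode Y v n vac = 0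
  jacobi : ∀ p q : ℤ, ∀ u ∈ deg p, ∀ v ∈ deg q, ∀ (l m n : ℤ) (w : X),
    ∑ᶠ i : ℕ, ((-1 : ℂ) ^ i * (Ring.choose l i : ℂ)) •
        (mode Y u (m + l - i) (mode Y v (n + i) w)
          - ((-1 : ℂ) ^ l * (-1 : ℂ) ^ (p * q)) • mode Y v (n + l - i) (mode Y u (m + i) w))
      = ∑ᶠ i : ℕ, (Ring.choose m i : ℂ) • mode Y (mode Y u (l + i) v) (m + n - i) w

/-- The eigenspace of `L(0) = ω₁` for the eigenvalue `k / 2`. -/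
def DGVertexAlgebra.weightSpace {X : Type*} [AddCommGroup X] [Module ℂ X]
    (V : DGVertexAlgebra X) (omega : X) (k : ℤ) : Submodule ℂ X :=
  Module.End.eigenspace (mode V.Y omega 1) ((k : ℂ) / 2)

/-- A differential graded vertex operator algebra: `L(n) = ωₙ₊₁`. -/
structure DGVertexOperatorAlgebra (X : Type*) [AddCommGroup X] [Module ℂ X]
    extends DGVertexAlgebra X where
  /-- The conformal vector. -/
  omega : X
  omega_mem : omega ∈ deg 4
  d_omega : d omega = 0
  /-- The central charge. -/
  charge : ℂ
  virasoro : ∀ (m n : ℤ) (v : X),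
    mode Y omega (m + 1) (mode Y omega (n + 1) v) - mode Y omega (n + 1) (mode Y omega (m + 1) v)
      = ((m : ℂ) - n) • mode Y omega (m + n + 1) v
        + (if m + n = 0 then ((m : ℂ) ^ 3 - m) / 12 * charge else 0) • v
  /-- `L(0)` is semisimple with eigenvalues in `½ℤ`. -/
  weight_internal : DirectSum.IsInternal (toDGVertexAlgebra.weightSpace omega)
  omega_weight : omega ∈ toDGVertexAlgebra.weightSpace omega 4
  weight_finite : ∀ k : ℤ, FiniteDimensional ℂ (toDGVertexAlgebra.weightSpace omega k)
  weight_bounded : ∃ K : ℤ, ∀ k < K, toDGVertexAlgebra.weightSpace omega k = ⊥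
  /-- `L(-1)` is the translation operator. -/
  translation : ∀ v, mode Y omega 0 v = mode Y v (-2) vac

/-! ### Algebras with a differential and a bracket -/

/-- A product, a distinguished element and a differential on a complex vector space. -/
structure AlgData (B : Type*) [AddCommGroup B] [Module ℂ B] where
  one : B
  mul : B →ₗ[ℂ] B →ₗ[ℂ] B
  d : B →ₗ[ℂ] B

/-- `AlgData` together with a bracket. -/
structure PoissonData (B : Type*) [AddCommGroup B] [Module ℂ B] extends AlgData B where
  bracket : B →ₗ[ℂ] B →ₗ[ℂ] B

/-- `P` is a graded commutative dg Poisson algebra with grading `deg` and Poisson bracket of degree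
`-2` (an even degree, so that it does not enter the signs). -/
structure IsDGPoisson {B : Type*} [AddCommGroup B] [Module ℂ B] (P : PoissonData B)
    (deg : ℤ → Submodule ℂ B) : Prop where
  internal : DirectSum.IsInternal deg
  d_mem : ∀ p : ℤ, ∀ a ∈ deg p, P.d a ∈ deg (p + 1)
  d_d : ∀ a, P.d (P.d a) = 0
  one_mem : P.one ∈ deg 0
  mul_mem : ∀ p q : ℤ, ∀ a ∈ deg p, ∀ b ∈ deg q, P.mul a b ∈ deg (p + q)
  one_mul : ∀ a, P.mul P.one a = a
  mul_one : ∀ a, P.mul a P.one = a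
  mul_assoc : ∀ a b c, P.mul (P.mul a b) c = P.mul a (P.mul b c)
  mul_comm : ∀ p q : ℤ, ∀ a ∈ deg p, ∀ b ∈ deg q, P.mul a b = (-1 : ℂ) ^ (p * q) • P.mul b a
  d_mul : ∀ p : ℤ, ∀ a ∈ deg p, ∀ b,
    P.d (P.mul a b) = P.mul (P.d a) b + (-1 : ℂ) ^ p • P.mul a (P.d b)
  bracket_mem : ∀ p q : ℤ, ∀ a ∈ deg p, ∀ b ∈ deg q, P.bracket a b ∈ deg (p + q - 2)
  bracket_skew : ∀ p q : ℤ, ∀ a ∈ deg p, ∀ b ∈ deg q,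
    P.bracket a b = -((-1 : ℂ) ^ (p * q) • P.bracket b a)
  bracket_jacobi : ∀ p q : ℤ, ∀ a ∈ deg p, ∀ b ∈ deg q, ∀ c,
    P.bracket (P.bracket a b) c
      = P.bracket a (P.bracket b c) - (-1 : ℂ) ^ (p * q) • P.bracket b (P.bracket a c)
  bracket_mul : ∀ p q : ℤ, ∀ a ∈ deg p, ∀ b ∈ deg q, ∀ c,
    P.bracket a (P.mul b c)
      = P.mul (P.bracket a b) c + (-1 : ℂ) ^ (p * q) • P.mul b (P.bracket a c)
  d_bracket : ∀ p : ℤ, ∀ a ∈ deg p, ∀ b,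
    P.d (P.bracket a b) = P.bracket (P.d a) b + (-1 : ℂ) ^ p • P.bracket a (P.d b)

/-- A dg Poisson algebra with a compatible weight grading; `wt k` is the component of weight
`k / 2`, and the bracket has weight `-1`. -/
structure IsWeightGradedDGPoisson {B : Type*} [AddCommGroup B] [Module ℂ B] (P : PoissonData B)
    (deg wt : ℤ → Submodule ℂ B) : Prop extends IsDGPoisson P deg where
  wt_internal : DirectSum.IsInternal wt
  bigrading : DirectSum.IsInternal fun i : ℤ × ℤ => deg i.1 ⊓ wt i.2
  d_wt : ∀ k : ℤ, ∀ a ∈ wt k, P.d a ∈ wt k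
  one_wt : P.one ∈ wt 0
  mul_wt : ∀ k l : ℤ, ∀ a ∈ wt k, ∀ b ∈ wt l, P.mul a b ∈ wt (k + l)
  bracket_wt : ∀ k l : ℤ, ∀ a ∈ wt k, ∀ b ∈ wt l, P.bracket a b ∈ wt (k + l - 2)

/-- A weight graded, differential filtered, differential filtered commutative algebra, with
filtration `F` and component `wt k` of weight `k / 2`.  Since `F` is multiplicative and
`d (F i) ⊆ F (i + 1)`, the last two conditions for all `p, q` amount to the conditions for
`p = |a|` and `q = |b|`, the least indices with `a ∈ F p` and `b ∈ F q`. -/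
structure IsWeightGradedDiffFilteredComm {B : Type*} [AddCommGroup B] [Module ℂ B] (P : AlgData B)
    (wt F : ℤ → Submodule ℂ B) : Prop where
  wt_internal : DirectSum.IsInternal wt
  mono : Monotone F
  iInf_eq : ⨅ i, F i = ⊥
  iSup_eq : ⨆ i, F i = ⊤
  /-- Each step of the filtration is a weight graded subspace. -/
  homogeneous : ∀ i, F i = ⨆ k, F i ⊓ wt k
  d_filt : ∀ i : ℤ, ∀ a ∈ F i, P.d a ∈ F (i + 1)
  d_d_filt : ∀ i : ℤ, ∀ a ∈ F i, P.d (P.d a) ∈ F (i + 1)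
  d_wt : ∀ k : ℤ, ∀ a ∈ wt k, P.d a ∈ wt k
  one_filt : P.one ∈ F 0
  one_wt : P.one ∈ wt 0
  mul_filt : ∀ p q : ℤ, ∀ a ∈ F p, ∀ b ∈ F q, P.mul a b ∈ F (p + q)
  mul_wt : ∀ k l : ℤ, ∀ a ∈ wt k, ∀ b ∈ wt l, P.mul a b ∈ wt (k + l)
  one_mul : ∀ a, P.mul P.one a = a
  mul_one : ∀ a, P.mul a P.one = a
  mul_assoc : ∀ a b c, P.mul (P.mul a b) c = P.mul a (P.mul b c)
  d_mul : ∀ p q : ℤ, ∀ a ∈ F p, ∀ b ∈ F q,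
    P.d (P.mul a b) - (P.mul (P.d a) b + (-1 : ℂ) ^ p • P.mul a (P.d b)) ∈ F (p + q)
  mul_comm : ∀ p q : ℤ, ∀ a ∈ F p, ∀ b ∈ F q,
    P.mul a b - (-1 : ℂ) ^ (p * q) • P.mul b a ∈ F (p + q - 1)

section Morphisms

variable {B C : Type*} [AddCommGroup B] [Module ℂ B] [AddCommGroup C] [Module ℂ C]

/-- `f` preserves unit, product and differential. -/
structure IsAlgHom (P : AlgData B) (Q : AlgData C) (f : B →ₗ[ℂ] C) : Prop where
  map_one : f P.one = Q.one
  map_mul : ∀ a b, f (P.mul a b) = Q.mul (f a) (f b)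
  map_d : ∀ a, f (P.d a) = Q.d (f a)

/-- `f` maps `G i` into `H i` for all `i`: a morphism of graded or of filtered spaces. -/
def Preserves (G : ℤ → Submodule ℂ B) (H : ℤ → Submodule ℂ C) (f : B →ₗ[ℂ] C) : Prop :=
  ∀ i, ∀ a ∈ G i, f a ∈ H i

/-- A morphism of dg Poisson algebras. -/
structure IsDGPoissonHom (P : PoissonData B) (degP : ℤ → Submodule ℂ B)
    (Q : PoissonData C) (degQ : ℤ → Submodule ℂ C) (f : B →ₗ[ℂ] C) : Prop
    extends IsAlgHom P.toAlgData Q.toAlgData f where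
  map_bracket : ∀ a b, f (P.bracket a b) = Q.bracket (f a) (f b)
  map_deg : Preserves degP degQ f

end Morphisms

/-! ### Associated graded spaces -/

section AssociatedGraded

variable {M : Type*} [AddCommGroup M] [Module ℂ M]

/-- `F p / F (p - 1)`. -/
def GrPiece (F : ℤ → Submodule ℂ M) (p : ℤ) : Type _ :=
  ↥(F p) ⧸ (F (p - 1)).submoduleOf (F p)

instance (F : ℤ → Submodule ℂ M) (p : ℤ) : AddCommGroup (GrPiece F p) :=
  inferInstanceAs (AddCommGroup (↥(F p) ⧸ (F (p - 1)).submoduleOf (F p)))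

instance (F : ℤ → Submodule ℂ M) (p : ℤ) : Module ℂ (GrPiece F p) :=
  inferInstanceAs (Module ℂ (↥(F p) ⧸ (F (p - 1)).submoduleOf (F p)))

/-- The quotient map `F p → F p / F (p - 1)`. -/
def grMk (F : ℤ → Submodule ℂ M) (p : ℤ) : ↥(F p) →ₗ[ℂ] GrPiece F p :=
  ((F (p - 1)).submoduleOf (F p)).mkQ

/-- The associated graded space of `F`. -/
abbrev Gr (F : ℤ → Submodule ℂ M) : Type _ := ⨁ p : ℤ, GrPiece F p

/-- The class of an element of `F p` in the summand `F p / F (p - 1)`. -/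
def symbol (F : ℤ → Submodule ℂ M) (p : ℤ) : ↥(F p) →ₗ[ℂ] Gr F :=
  DirectSum.lof ℂ ℤ (GrPiece F) p ∘ₗ grMk F p

/-- The summand `F p / F (p - 1)` of the associated graded space. -/
def grDeg (F : ℤ → Submodule ℂ M) (p : ℤ) : Submodule ℂ (Gr F) :=
  LinearMap.range (DirectSum.lof ℂ ℤ (GrPiece F) p)

/-- The filtration induced by `F` on the associated graded space of `W`: the sum over `k` of the
images of `F i ⊓ W k`. -/
def grFilt (F W : ℤ → Submodule ℂ M) (i : ℤ) : Submodule ℂ (Gr W) :=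
  ⨆ k, ((F i).submoduleOf (W k)).map (symbol W k)

/-- The filtration induced by `W` on `F p / F (p - 1)`: the image of `F p ⊓ W k`. -/
def pieceFilt (F W : ℤ → Submodule ℂ M) (p k : ℤ) : Submodule ℂ (GrPiece F p) :=
  ((W k).submoduleOf (F p)).map (grMk F p)

/-- The summand of bidegree `(p, k)` of the iterated associated graded space. -/
abbrev BiGrPiece (F W : ℤ → Submodule ℂ M) (i : ℤ × ℤ) : Type _ :=
  GrPiece (pieceFilt F W i.1) i.2

/-- The iterated associated graded space: first for `F`, then for the filtration induced by
`W`. -/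
abbrev BiGr (F W : ℤ → Submodule ℂ M) : Type _ := ⨁ i : ℤ × ℤ, BiGrPiece F W i

/-- The class of an element of `F p ⊓ W k` in the summand of bidegree `(p, k)`. -/
def biSymbol (F W : ℤ → Submodule ℂ M) (p k : ℤ) : ↥(F p ⊓ W k) →ₗ[ℂ] BiGr F W :=
  DirectSum.lof ℂ (ℤ × ℤ) (BiGrPiece F W) (p, k) ∘ₗ grMk (pieceFilt F W p) k ∘ₗ
    LinearMap.codRestrict (pieceFilt F W p k) (grMk F p ∘ₗ Submodule.inclusion inf_le_left)
      (fun x => ⟨Submodule.inclusion inf_le_left x, x.2.2, rfl⟩)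

/-- The part of first degree `p`. -/
def biGrDeg (F W : ℤ → Submodule ℂ M) (p : ℤ) : Submodule ℂ (BiGr F W) :=
  ⨆ k, LinearMap.range (DirectSum.lof ℂ (ℤ × ℤ) (BiGrPiece F W) (p, k))

/-- The part of second degree `k`. -/
def biGrWt (F W : ℤ → Submodule ℂ M) (k : ℤ) : Submodule ℂ (BiGr F W) :=
  ⨆ p, LinearMap.range (DirectSum.lof ℂ (ℤ × ℤ) (BiGrPiece F W) (p, k))

end AssociatedGraded

namespace DGVertexOperatorAlgebra

variable {X : Type*} [AddCommGroup X] [Module ℂ X] (V : DGVertexOperatorAlgebra X)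

/-- The vectors of weight `k / 2`. -/
def wt (k : ℤ) : Submodule ℂ X := V.weightSpace V.omega k

/-! ### The `C₂`-algebra -/

/-- The span of all `u₋₂ v`. -/
def C2 : Submodule ℂ X := Submodule.span ℂ {x | ∃ u v, x = mode V.Y u (-2) v}

/-- The space `R(V) = V / C₂(V)`. -/
abbrev C2Algebra : Type _ := X ⧸ V.C2

/-- The image in `R(V)` of the component of degree `p`. -/
def c2Deg (p : ℤ) : Submodule ℂ V.C2Algebra := (V.deg p).map V.C2.mkQ

/-- The image in `R(V)` of the component of weight `k / 2`. -/
def c2Wt (k : ℤ) : Submodule ℂ V.C2Algebra := (V.wt k).map V.C2.mkQ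

/-- The filtration of `R(V)` attached to its grading by degree. -/
def c2Filt (i : ℤ) : Submodule ℂ V.C2Algebra := ⨆ q : ℤ, ⨆ _ : q ≤ i, V.c2Deg q

/-- The standard operations on `R(V)`: product `u₋₁ v`, bracket `u₀ v`, the induced differential,
and the class of the vacuum. -/
structure IsC2Structure (R : PoissonData V.C2Algebra) : Prop where
  one : R.one = V.C2.mkQ V.vac
  d : ∀ u, R.d (V.C2.mkQ u) = V.C2.mkQ (V.d u)
  mul : ∀ u v, R.mul (V.C2.mkQ u) (V.C2.mkQ v) = V.C2.mkQ (mode V.Y u (-1) v)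
  bracket : ∀ u v, R.bracket (V.C2.mkQ u) (V.C2.mkQ v) = V.C2.mkQ (mode V.Y u 0 v)

/-! ### The Zhu algebra -/

/-- `u ∗ v` for `u` of weight `k / 2`. -/
def star (k : ℤ) (u v : X) : X :=
  ∑ᶠ n : ℕ, Ring.choose ((k : ℂ) / 2) n • mode V.Y u ((n : ℤ) - 1) v

/-- `u ∘ v` for `u` of weight `k / 2`. -/
def circ (k : ℤ) (u v : X) : X :=
  ∑ᶠ n : ℕ, Ring.choose ((k : ℂ) / 2) n • mode V.Y u ((n : ℤ) - 2) v

/-- The span of all `u ∘ v` with `u` homogeneous for the weight. -/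
def O : Submodule ℂ X := Submodule.span ℂ {x | ∃ k : ℤ, ∃ u ∈ V.wt k, ∃ v, x = V.circ k u v}

/-- The space `A(V) = V / O(V)`. -/
abbrev Zhu : Type _ := X ⧸ V.O

/-- The filtration of `A(V)` by degree. -/
def zhuF (p : ℤ) : Submodule ℂ V.Zhu := (⨆ q : ℤ, ⨆ _ : q ≤ p, V.deg q).map V.O.mkQ

/-- The filtration of `A(V)` by weight; the index `k` stands for the weight `k / 2`. -/
def zhuW (k : ℤ) : Submodule ℂ V.Zhu := (⨆ l : ℤ, ⨆ _ : l ≤ k, V.wt l).map V.O.mkQ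

/-- The operations on `A(V)` induced by `∗` and the differential, and the class of the vacuum. -/
structure IsZhuStructure (A : AlgData V.Zhu) : Prop where
  one : A.one = V.O.mkQ V.vac
  d : ∀ u, A.d (V.O.mkQ u) = V.O.mkQ (V.d u)
  mul : ∀ k : ℤ, ∀ u ∈ V.wt k, ∀ v, A.mul (V.O.mkQ u) (V.O.mkQ v) = V.O.mkQ (V.star k u v)

/-- `[u] ∗ [v] - (-1)^(pq) [v] ∗ [u]`. -/
def superCommutator (A : AlgData V.Zhu) (p q : ℤ) (u v : X) : V.Zhu :=
  A.mul (V.O.mkQ u) (V.O.mkQ v) - (-1 : ℂ) ^ (p * q) • A.mul (V.O.mkQ v) (V.O.mkQ u)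

/-- The operations induced on the associated graded space for the filtration by degree.  The bracket
of the classes of `u` and `v` is the class of the super commutator in degree `p + q - 2`. -/
structure IsGrFStructure (A : AlgData V.Zhu) (G : PoissonData (Gr V.zhuF)) : Prop where
  one : ∃ h : A.one ∈ V.zhuF 0, G.one = symbol V.zhuF 0 ⟨A.one, h⟩
  d : ∀ p : ℤ, ∀ x, ∀ hx : x ∈ V.zhuF p, ∃ h : A.d x ∈ V.zhuF (p + 1),
    G.d (symbol V.zhuF p ⟨x, hx⟩) = symbol V.zhuF (p + 1) ⟨A.d x, h⟩
  mul : ∀ p q : ℤ, ∀ x, ∀ hx : x ∈ V.zhuF p, ∀ y, ∀ hy : y ∈ V.zhuF q,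
    ∃ h : A.mul x y ∈ V.zhuF (p + q),
      G.mul (symbol V.zhuF p ⟨x, hx⟩) (symbol V.zhuF q ⟨y, hy⟩)
        = symbol V.zhuF (p + q) ⟨A.mul x y, h⟩
  bracket : ∀ p q : ℤ, ∀ u ∈ V.deg p, ∀ v ∈ V.deg q,
    ∃ (hu : V.O.mkQ u ∈ V.zhuF p) (hv : V.O.mkQ v ∈ V.zhuF q)
      (h : V.superCommutator A p q u v ∈ V.zhuF (p + q - 2)),
      G.bracket (symbol V.zhuF p ⟨_, hu⟩) (symbol V.zhuF q ⟨_, hv⟩)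
        = symbol V.zhuF (p + q - 2) ⟨_, h⟩

/-- The operations induced on the associated graded space for the filtration by weight. -/
structure IsGrWStructure (A : AlgData V.Zhu) (G : AlgData (Gr V.zhuW)) : Prop where
  one : ∃ h : A.one ∈ V.zhuW 0, G.one = symbol V.zhuW 0 ⟨A.one, h⟩
  d : ∀ k : ℤ, ∀ x, ∀ hx : x ∈ V.zhuW k, ∃ h : A.d x ∈ V.zhuW k,
    G.d (symbol V.zhuW k ⟨x, hx⟩) = symbol V.zhuW k ⟨A.d x, h⟩
  mul : ∀ k l : ℤ, ∀ x, ∀ hx : x ∈ V.zhuW k, ∀ y, ∀ hy : y ∈ V.zhuW l,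
    ∃ h : A.mul x y ∈ V.zhuW (k + l),
      G.mul (symbol V.zhuW k ⟨x, hx⟩) (symbol V.zhuW l ⟨y, hy⟩)
        = symbol V.zhuW (k + l) ⟨A.mul x y, h⟩

/-- The operations induced on the iterated associated graded space.  The bracket of the classes of
`u` and `v` is the class of the super commutator, two degrees and one weight lower. -/
structure IsGrFWStructure (A : AlgData V.Zhu) (G : PoissonData (BiGr V.zhuF V.zhuW)) : Prop where
  one : ∃ h : A.one ∈ V.zhuF 0 ⊓ V.zhuW 0, G.one = biSymbol V.zhuF V.zhuW 0 0 ⟨A.one, h⟩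
  d : ∀ p k : ℤ, ∀ x, ∀ hx : x ∈ V.zhuF p ⊓ V.zhuW k,
    ∃ h : A.d x ∈ V.zhuF (p + 1) ⊓ V.zhuW k,
      G.d (biSymbol V.zhuF V.zhuW p k ⟨x, hx⟩) = biSymbol V.zhuF V.zhuW (p + 1) k ⟨A.d x, h⟩
  mul : ∀ p k q l : ℤ, ∀ x, ∀ hx : x ∈ V.zhuF p ⊓ V.zhuW k,
    ∀ y, ∀ hy : y ∈ V.zhuF q ⊓ V.zhuW l,
    ∃ h : A.mul x y ∈ V.zhuF (p + q) ⊓ V.zhuW (k + l),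
      G.mul (biSymbol V.zhuF V.zhuW p k ⟨x, hx⟩) (biSymbol V.zhuF V.zhuW q l ⟨y, hy⟩)
        = biSymbol V.zhuF V.zhuW (p + q) (k + l) ⟨A.mul x y, h⟩
  bracket : ∀ p k q l : ℤ, ∀ u ∈ V.deg p ⊓ V.wt k, ∀ v ∈ V.deg q ⊓ V.wt l,
    ∃ (hu : V.O.mkQ u ∈ V.zhuF p ⊓ V.zhuW k) (hv : V.O.mkQ v ∈ V.zhuF q ⊓ V.zhuW l)
      (h : V.superCommutator A p q u v ∈ V.zhuF (p + q - 2) ⊓ V.zhuW (k + l - 2)),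
      G.bracket (biSymbol V.zhuF V.zhuW p k ⟨_, hu⟩) (biSymbol V.zhuF V.zhuW q l ⟨_, hv⟩)
        = biSymbol V.zhuF V.zhuW (p + q - 2) (k + l - 2) ⟨_, h⟩

/-! ### The natural maps -/

/-- `f` sends the class of each `u` of degree `p` to the class of `[u]` in degree `p`. -/
def IsEtaF (f : V.C2Algebra →ₗ[ℂ] Gr V.zhuF) : Prop :=
  ∀ p : ℤ, ∀ u ∈ V.deg p, ∃ h : V.O.mkQ u ∈ V.zhuF p,
    f (V.C2.mkQ u) = symbol V.zhuF p ⟨_, h⟩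

/-- `f` sends the class of each `u` of weight `k / 2` to the class of `[u]` in weight `k / 2`. -/
def IsEtaW (f : V.C2Algebra →ₗ[ℂ] Gr V.zhuW) : Prop :=
  ∀ k : ℤ, ∀ u ∈ V.wt k, ∃ h : V.O.mkQ u ∈ V.zhuW k,
    f (V.C2.mkQ u) = symbol V.zhuW k ⟨_, h⟩

/-- `f` sends the class of each bihomogeneous `u` to the class of `[u]` in the same bidegree. -/
def IsEtaFW (f : V.C2Algebra →ₗ[ℂ] BiGr V.zhuF V.zhuW) : Prop :=
  ∀ p k : ℤ, ∀ u ∈ V.deg p ⊓ V.wt k, ∃ h : V.O.mkQ u ∈ V.zhuF p ⊓ V.zhuW k,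
    f (V.C2.mkQ u) = biSymbol V.zhuF V.zhuW p k ⟨_, h⟩

end DGVertexOperatorAlgebra

end

/-! Each power of x carries degree -2 and weight -1, so the terms of u ∗ v and u ∘ v after the
leading one arise by lowering degree and weight together. Weights are indexed by their doubles, so
one such step is the shift of bidegrees by (2, 2). Hence O(V), although not bigraded, is graded by
the orbits of this shift (`proj_mem_O`), and along one orbit degree and weight determine each other.
For the class of a bihomogeneous vector, dropping in degree, dropping in weight, or lying in the sum
of both filtration steps is therefore one and the same condition. So the natural maps `sigmaF`,
`sigmaW`, `sigmaFW` from V onto the three associated graded spaces have the same kernel `grKer`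
(`sigmaF_eq_zero_iff` and its two analogues).

The leading term of u ∘ v is u₋₂ v, that of u ∗ v is u₋₁ v, and modulo O(V) that of the super
commutator is u₀ v (`zhuMode_commutator`). The first fact gives C₂(V) ⊆ `grKer`; the other two make
`grKer` stable under the product and bracket of R(V). Thus all three associated graded spaces are
quotients of R(V) by one dg Poisson ideal and inherit its identities (`exists_image_of_c2`);
associativity of A(V) is never needed. What remains is that R(V) is a weight graded dg Poisson
algebra (`isWeightGradedDGPoisson_c2`), and that the inherited operations are those induced from
A(V) (`isGrFStructure`, `isGrWStructure`, `isGrFWStructure`). For the weight filtration the degree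
grading is transported as well, and the required filtered structure is the one attached to it
(`IsWeightGradedDGPoisson.filtered`, `grFilt_eq`).

That A(V) is well defined is a residue computation: `pmode` is the residue of xⁿ p(x) Y(u, x) v, and
the Jacobi identity is used in the form `jacobi_pmode`, with p a power of 1 + x. -/

noncomputable section

/-! ### Internally graded spaces -/

namespace Grading

/-- An internally graded space is the direct sum of its components. -/
def equiv {ι M : Type*} [DecidableEq ι] [AddCommGroup M] [Module ℂ M] {G : ι → Submodule ℂ M}
    (h : DirectSum.IsInternal G) : M ≃ₗ[ℂ] ⨁ i, G i :=
  LinearEquiv.symm (LinearEquiv.ofBijective (DirectSum.coeLinearMap G)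
    (show Function.Bijective (DirectSum.coeLinearMap G) from h))

open Classical in
/-- The projection onto the sum of the components with index in `S`. -/
def proj {ι M : Type*} [DecidableEq ι] [AddCommGroup M] [Module ℂ M] {G : ι → Submodule ℂ M}
    (h : DirectSum.IsInternal G) (S : Set ι) : M →ₗ[ℂ] M :=
  DirectSum.toModule ℂ ι M (fun i => if i ∈ S then (G i).subtype else 0) ∘ₗ
    (equiv h).toLinearMap

/-- The sum of the components with index in `S`. -/
def supp {ι M : Type*} [AddCommGroup M] [Module ℂ M] (G : ι → Submodule ℂ M) (S : Set ι) :
    Submodule ℂ M := ⨆ i ∈ S, G i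

section

variable {ι M N : Type*} [DecidableEq ι] [AddCommGroup M] [Module ℂ M] [AddCommGroup N]
  [Module ℂ N] {G : ι → Submodule ℂ M} (h : DirectSum.IsInternal G)

lemma coe_equiv (x : M) : DirectSum.coeLinearMap G (equiv h x) = x :=
  LinearEquiv.apply_symm_apply (LinearEquiv.ofBijective (DirectSum.coeLinearMap G)
    (show Function.Bijective (DirectSum.coeLinearMap G) from h)) x

lemma equiv_of_mem {i : ι} {x : M} (hx : x ∈ G i) :
    equiv h x = DirectSum.lof ℂ ι (fun i => G i) i ⟨x, hx⟩ := by
  apply h.1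
  exact (coe_equiv h x).trans (DirectSum.coeLinearMap_lof G i ⟨x, hx⟩).symm

lemma proj_of_mem {S : Set ι} {i : ι} {x : M} (hx : x ∈ G i) (hi : i ∈ S) :
    proj h S x = x := by
  simp [proj, equiv_of_mem h hx, hi]

lemma proj_of_notMem {S : Set ι} {i : ι} {x : M} (hx : x ∈ G i) (hi : i ∉ S) :
    proj h S x = 0 := by
  simp [proj, equiv_of_mem h hx, hi]

lemma proj_self {i : ι} {x : M} (hx : x ∈ G i) : proj h {i} x = x :=
  proj_of_mem h hx (Set.mem_singleton i)

lemma proj_of_ne {i j : ι} {x : M} (hx : x ∈ G j) (hij : j ≠ i) : proj h {i} x = 0 :=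
  proj_of_notMem h hx (by simpa using hij)

include h in
@[elab_as_elim]
lemma induction {p : M → Prop} (x : M) (mem : ∀ i, ∀ x ∈ G i, p x) (zero : p 0)
    (add : ∀ x y, p x → p y → p (x + y)) : p x := by
  have hx : x ∈ ⨆ i, G i := by rw [h.submodule_iSup_eq_top]; trivial
  exact Submodule.iSup_induction G (motive := p) hx mem zero add

include h in
lemma hom_ext {f g : M →ₗ[ℂ] N} (H : ∀ i, ∀ x ∈ G i, f x = g x) : f = g := by
  ext x
  refine induction h x H (by simp) (fun x y hx hy => by simp [hx, hy])

omit [DecidableEq ι] in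
lemma mem_supp {S : Set ι} {i : ι} (hi : i ∈ S) {x : M} (hx : x ∈ G i) : x ∈ supp G S :=
  Submodule.mem_iSup_of_mem i (Submodule.mem_iSup_of_mem hi hx)

omit [DecidableEq ι] in
lemma supp_mono {S T : Set ι} (hST : S ⊆ T) : supp G S ≤ supp G T :=
  biSup_mono hST

omit [DecidableEq ι] in
lemma supp_le {S : Set ι} {P : Submodule ℂ M} (H : ∀ i ∈ S, G i ≤ P) : supp G S ≤ P :=
  iSup₂_le H

lemma proj_mem (S : Set ι) (x : M) : proj h S x ∈ supp G S := by
  refine induction h x (fun i x hx => ?_) (by simp) (fun x y hx hy => ?_)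
  · by_cases hi : i ∈ S
    · rw [proj_of_mem h hx hi]; exact mem_supp hi hx
    · rw [proj_of_notMem h hx hi]; exact zero_mem _
  · rw [map_add]; exact add_mem hx hy

lemma proj_comp (S T : Set ι) (x : M) : proj h S (proj h T x) = proj h (S ∩ T) x := by
  refine induction h x (fun i x hx => ?_) (by simp) (fun x y hx hy => by simp [hx, hy])
  by_cases hT : i ∈ T
  · rw [proj_of_mem h hx hT]
    by_cases hS : i ∈ S
    · rw [proj_of_mem h hx hS, proj_of_mem h hx (show i ∈ S ∩ T from ⟨hS, hT⟩)]
    · rw [proj_of_notMem h hx hS, proj_of_notMem h hx (fun H => hS H.1)]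
  · rw [proj_of_notMem h hx hT, map_zero, proj_of_notMem h hx (fun H => hT H.2)]

lemma proj_of_mem_supp {S : Set ι} {x : M} (hx : x ∈ supp G S) : proj h S x = x := by
  have : supp G S ≤ LinearMap.eqLocus (proj h S) LinearMap.id :=
    supp_le fun i hi y hy => proj_of_mem h hy hi
  exact this hx

lemma proj_singleton_mem (i : ι) (x : M) : proj h {i} x ∈ G i := by
  simpa [supp] using proj_mem h {i} x

lemma proj_mem_inter {S T : Set ι} {x : M} (hx : x ∈ supp G T) : proj h S x ∈ supp G (S ∩ T) := by
  rw [← proj_of_mem_supp h hx, proj_comp]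
  exact proj_mem h _ x

lemma proj_add_proj_compl (S : Set ι) (x : M) : proj h S x + proj h Sᶜ x = x := by
  refine induction h x (fun i x hx => ?_) (by simp) (fun x y hx hy => ?_)
  · by_cases hi : i ∈ S
    · rw [proj_of_mem h hx hi, proj_of_notMem h hx (by simpa using hi), add_zero]
    · rw [proj_of_notMem h hx hi, proj_of_mem h hx (by simpa using hi), zero_add]
  · rw [map_add, map_add, add_add_add_comm, hx, hy]

lemma proj_eq_zero_of_disjoint {S T : Set ι} (hST : S ∩ T = ∅) {x : M} (hx : x ∈ supp G T) :
    proj h S x = 0 := by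
  have := proj_mem_inter h (S := S) hx
  rw [hST] at this
  simpa [supp] using this

lemma equiv_apply_coe (i : ι) (x : M) :
    (equiv h x i : M) = proj h {i} x := by
  refine induction h x (fun j x hx => ?_) (by simp) (fun x y hx hy => ?_)
  · rw [equiv_of_mem h hx]
    by_cases hij : j = i
    · subst hij
      rw [DirectSum.lof_apply, proj_self h hx]
    · rw [proj_of_ne h hx hij, DirectSum.lof_eq_of,
        DirectSum.of_eq_of_ne _ _ _ (Ne.symm hij)]
      rfl
  · rw [map_add, map_add, ← hx, ← hy]; rfl

/-- An element lies in a subspace as soon as all its components do. -/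
lemma mem_of_proj_mem {P : Submodule ℂ M} {x : M} (H : ∀ i, proj h {i} x ∈ P) : x ∈ P := by
  classical
  rw [← coe_equiv h x, DirectSum.coeLinearMap_eq_dfinsuppSum]
  refine Submodule.sum_mem _ fun i _ => ?_
  have := H i
  rwa [← equiv_apply_coe] at this

lemma eq_zero_of_proj {x : M} (H : ∀ i, proj h {i} x = 0) : x = 0 := by
  simpa using mem_of_proj_mem h (P := ⊥) (fun i => by simpa using H i)

end

/-! ### Gradings obtained from projections, on quotients and on direct sums -/

section

variable {ι M N : Type*} [DecidableEq ι] [AddCommGroup M] [Module ℂ M] [AddCommGroup N]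
  [Module ℂ N]

/-- A spanning family of subspaces separated by projections is a grading. -/
lemma isInternal_of_projections (G : ι → Submodule ℂ M) (π : ι → M →ₗ[ℂ] M)
    (same : ∀ i, ∀ x ∈ G i, π i x = x) (ne : ∀ i j, i ≠ j → ∀ x ∈ G j, π i x = 0)
    (top : ⨆ i, G i = ⊤) : DirectSum.IsInternal G := by
  refine DirectSum.isInternal_submodule_of_iSupIndep_of_iSup_eq_top ?_ top
  intro i
  rw [Submodule.disjoint_def]
  intro x hx hx'
  have : (⨆ j, ⨆ (_ : j ≠ i), G j) ≤ LinearMap.ker (π i) :=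
    iSup₂_le fun j hj y hy => ne i j hj.symm y hy
  rw [← same i x hx]
  exact this hx'

/-- A quotient by a homogeneous subspace is graded by the images of the components. -/
lemma isInternal_map {G : ι → Submodule ℂ M} (h : DirectSum.IsInternal G) (f : M →ₗ[ℂ] N)
    (hf : Function.Surjective f) (hker : ∀ x, f x = 0 → ∀ i, f (proj h {i} x) = 0) :
    DirectSum.IsInternal fun i => (G i).map f := by
  obtain ⟨s, hs⟩ := f.exists_rightInverse_of_surjective (LinearMap.range_eq_top.2 hf)
  have hfs : ∀ y, f (s y) = y := fun y => LinearMap.congr_fun hs y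
  -- The candidate projections on the quotient use a linear section s. Homogeneity of the kernel
  -- makes them independent of its choice.
  have key : ∀ i x, f (proj h {i} (s (f x))) = f (proj h {i} x) := by
    intro i x
    rw [← sub_eq_zero, ← map_sub, ← map_sub]
    exact hker _ (by rw [map_sub, hfs, sub_self]) i
  refine isInternal_of_projections _ (fun i => f ∘ₗ proj h {i} ∘ₗ s) ?_ ?_ ?_
  · rintro i _ ⟨x, hx, rfl⟩
    simp only [LinearMap.comp_apply, key, proj_self h hx]
  · rintro i j hij _ ⟨x, hx, rfl⟩
    simp only [LinearMap.comp_apply, key]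
    rw [proj_of_ne h hx hij.symm, map_zero]
  · rw [← Submodule.map_iSup, h.submodule_iSup_eq_top, Submodule.map_top,
      LinearMap.range_eq_top.2 hf]

/-- The map between graded spaces given by maps on the components. -/
def gradedMap {P : ι → Type*} [∀ i, AddCommGroup (P i)] [∀ i, Module ℂ (P i)]
    {G : ι → Submodule ℂ M} (h : DirectSum.IsInternal G) (g : ∀ i, G i →ₗ[ℂ] P i) :
    M →ₗ[ℂ] ⨁ i, P i :=
  DirectSum.lmap g ∘ₗ (equiv h).toLinearMap

variable {P : ι → Type*} [∀ i, AddCommGroup (P i)] [∀ i, Module ℂ (P i)]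
    {G : ι → Submodule ℂ M} (h : DirectSum.IsInternal G) (g : ∀ i, G i →ₗ[ℂ] P i)

lemma gradedMap_of_mem {i : ι} {x : M} (hx : x ∈ G i) :
    gradedMap h g x = DirectSum.lof ℂ ι P i (g i ⟨x, hx⟩) := by
  simp [gradedMap, equiv_of_mem h hx]

lemma gradedMap_surjective (hg : ∀ i, Function.Surjective (g i)) :
    Function.Surjective (gradedMap h g) :=
  ((DirectSum.lmap_surjective g).2 hg).comp (LinearEquiv.surjective _)

lemma gradedMap_eq_zero_iff (x : M) :
    gradedMap h g x = 0 ↔ ∀ i, g i ⟨proj h {i} x, proj_singleton_mem h i x⟩ = 0 := by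
  have : ∀ i, gradedMap h g x i = g i ⟨proj h {i} x, proj_singleton_mem h i x⟩ := by
    intro i
    simp only [gradedMap, LinearMap.comp_apply, DirectSum.lmap_apply]
    congr 1
    exact Subtype.ext (equiv_apply_coe h i x)
  rw [DFinsupp.ext_iff]
  simp only [← this]
  rfl

lemma map_gradedMap (hg : ∀ i, Function.Surjective (g i)) (i : ι) :
    (G i).map (gradedMap h g) = LinearMap.range (DirectSum.lof ℂ ι P i) := by
  ext y
  constructor
  · rintro ⟨x, hx, rfl⟩
    exact ⟨_, (gradedMap_of_mem h g hx).symm⟩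
  · rintro ⟨z, rfl⟩
    obtain ⟨x, rfl⟩ := hg i z
    exact ⟨x, x.2, gradedMap_of_mem h g x.2⟩

end

end Grading

/-! ### Transport of structure -/

section Transport

variable {B C : Type*} [AddCommGroup B] [Module ℂ B] [AddCommGroup C] [Module ℂ C]

/-- The kernel of `f` is stable under the operations of `P`. -/
structure KerStable (P : PoissonData B) (f : B →ₗ[ℂ] C) : Prop where
  d : ∀ a, f a = 0 → f (P.d a) = 0
  mul_left : ∀ a b, f a = 0 → f (P.mul a b) = 0
  mul_right : ∀ a b, f b = 0 → f (P.mul a b) = 0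
  bracket_left : ∀ a b, f a = 0 → f (P.bracket a b) = 0
  bracket_right : ∀ a b, f b = 0 → f (P.bracket a b) = 0

/-- The operations are pulled back along a linear section s and pushed forward again. Since s (f a)
- a lies in the kernel, stability shows that f respects the result. -/
lemma KerStable.exists_image {P : PoissonData B} {f : B →ₗ[ℂ] C} (hP : KerStable P f)
    (hf : Function.Surjective f) :
    ∃ Q : PoissonData C, IsAlgHom P.toAlgData Q.toAlgData f ∧
      ∀ a b, f (P.bracket a b) = Q.bracket (f a) (f b) := by
  obtain ⟨s, hs⟩ := f.exists_rightInverse_of_surjective (LinearMap.range_eq_top.2 hf)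
  have hfs : ∀ a, f (s (f a) - a) = 0 := fun a => by
    rw [map_sub, sub_eq_zero]; exact LinearMap.congr_fun hs (f a)
  refine ⟨⟨⟨f P.one, (P.mul.compl₁₂ s s).compr₂ f, f ∘ₗ P.d ∘ₗ s⟩,
    (P.bracket.compl₁₂ s s).compr₂ f⟩, ⟨rfl, fun a b => ?_, fun a => ?_⟩, fun a b => ?_⟩
  · have h1 := hP.mul_left _ (s (f b)) (hfs a)
    have h2 := hP.mul_right a _ (hfs b)
    simp only [map_sub, LinearMap.sub_apply, sub_eq_zero] at h1 h2
    exact (h1.trans h2).symm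
  · have h1 := hP.d _ (hfs a)
    simp only [map_sub, sub_eq_zero] at h1
    exact h1.symm
  · have h1 := hP.bracket_left _ (s (f b)) (hfs a)
    have h2 := hP.bracket_right a _ (hfs b)
    simp only [map_sub, LinearMap.sub_apply, sub_eq_zero] at h1 h2
    exact (h1.trans h2).symm

/-- The image of a weight graded dg Poisson algebra under a surjection that preserves the
operations and is compatible with the gradings. -/
lemma IsWeightGradedDGPoisson.map {P : PoissonData B} {deg wt : ℤ → Submodule ℂ B}
    (hP : IsWeightGradedDGPoisson P deg wt) {Q : PoissonData C} {f : B →ₗ[ℂ] C}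
    (hf : Function.Surjective f) (hom : IsAlgHom P.toAlgData Q.toAlgData f)
    (map_bracket : ∀ a b, f (P.bracket a b) = Q.bracket (f a) (f b))
    {deg' wt' : ℤ → Submodule ℂ C}
    (hdeg : ∀ p, (deg p).map f = deg' p) (hwt : ∀ k, (wt k).map f = wt' k)
    (internal : DirectSum.IsInternal deg') (wt_internal : DirectSum.IsInternal wt')
    (bigrading : DirectSum.IsInternal fun i : ℤ × ℤ => deg' i.1 ⊓ wt' i.2) :
    IsWeightGradedDGPoisson Q deg' wt' := by
  obtain rfl : (fun p => (deg p).map f) = deg' := funext hdeg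
  obtain rfl : (fun p => (wt p).map f) = wt' := funext hwt
  have mm := hom.map_mul
  have md := hom.map_d
  have mo := hom.map_one
  refine
    { internal := internal
      wt_internal := wt_internal
      bigrading := bigrading
      d_mem := ?_
      d_d := ?_
      one_mem := ?_
      mul_mem := ?_
      one_mul := ?_
      mul_one := ?_
      mul_assoc := ?_
      mul_comm := ?_
      d_mul := ?_
      bracket_mem := ?_
      bracket_skew := ?_
      bracket_jacobi := ?_
      bracket_mul := ?_
      d_bracket := ?_
      d_wt := ?_
      one_wt := ?_
      mul_wt := ?_
      bracket_wt := ?_ }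
  · rintro p _ ⟨a, ha, rfl⟩; exact ⟨_, hP.d_mem p a ha, md a⟩
  · intro a; obtain ⟨a, rfl⟩ := hf a; rw [← md, ← md, hP.d_d, map_zero]
  · exact ⟨_, hP.one_mem, mo⟩
  · rintro p q _ ⟨a, ha, rfl⟩ _ ⟨b, hb, rfl⟩; exact ⟨_, hP.mul_mem p q a ha b hb, mm a b⟩
  · intro a; obtain ⟨a, rfl⟩ := hf a; rw [← mo, ← mm, hP.one_mul]
  · intro a; obtain ⟨a, rfl⟩ := hf a; rw [← mo, ← mm, hP.mul_one]
  · intro a b c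
    obtain ⟨a, rfl⟩ := hf a; obtain ⟨b, rfl⟩ := hf b; obtain ⟨c, rfl⟩ := hf c
    rw [← mm, ← mm, ← mm, ← mm, hP.mul_assoc]
  · rintro p q _ ⟨a, ha, rfl⟩ _ ⟨b, hb, rfl⟩
    rw [← mm, ← mm, hP.mul_comm p q a ha b hb, map_smul]
  · rintro p _ ⟨a, ha, rfl⟩ b
    obtain ⟨b, rfl⟩ := hf b
    rw [← mm, ← md, ← md, ← md, ← mm, ← mm, hP.d_mul p a ha b, map_add, map_smul]
  · rintro p q _ ⟨a, ha, rfl⟩ _ ⟨b, hb, rfl⟩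
    exact ⟨_, hP.bracket_mem p q a ha b hb, map_bracket a b⟩
  · rintro p q _ ⟨a, ha, rfl⟩ _ ⟨b, hb, rfl⟩
    rw [← map_bracket, ← map_bracket, hP.bracket_skew p q a ha b hb, map_neg, map_smul]
  · rintro p q _ ⟨a, ha, rfl⟩ _ ⟨b, hb, rfl⟩ c
    obtain ⟨c, rfl⟩ := hf c
    simp only [← map_bracket]
    rw [hP.bracket_jacobi p q a ha b hb, map_sub, map_smul]
  · rintro p q _ ⟨a, ha, rfl⟩ _ ⟨b, hb, rfl⟩ c
    obtain ⟨c, rfl⟩ := hf c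
    simp only [← map_bracket, ← mm]
    rw [hP.bracket_mul p q a ha b hb, map_add, map_smul]
  · rintro p _ ⟨a, ha, rfl⟩ b
    obtain ⟨b, rfl⟩ := hf b
    simp only [← map_bracket, ← md]
    rw [hP.d_bracket p a ha, map_add, map_smul]
  · rintro p _ ⟨a, ha, rfl⟩; exact ⟨_, hP.d_wt p a ha, md a⟩
  · exact ⟨_, hP.one_wt, mo⟩
  · rintro p q _ ⟨a, ha, rfl⟩ _ ⟨b, hb, rfl⟩; exact ⟨_, hP.mul_wt p q a ha b hb, mm a b⟩
  · rintro p q _ ⟨a, ha, rfl⟩ _ ⟨b, hb, rfl⟩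
    exact ⟨_, hP.bracket_wt p q a ha b hb, map_bracket a b⟩

end Transport

/-! ### The filtration of a graded algebra -/

namespace Grading

/-- When B refines G, the projections of the two gradings commute. A vector of G p therefore has no
component in B i unless τ i = p. -/
lemma eq_supp_of_le {ι κ M : Type*} [DecidableEq ι] [DecidableEq κ] [AddCommGroup M] [Module ℂ M]
    {G : κ → Submodule ℂ M} (hG : DirectSum.IsInternal G) {B : ι → Submodule ℂ M}
    (hB : DirectSum.IsInternal B) (τ : ι → κ) (hτ : ∀ i, B i ≤ G (τ i)) (p : κ) :
    G p = supp B {i | τ i = p} := by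
  refine le_antisymm (fun u hu => ?_) (supp_le fun i hi => hi ▸ hτ i)
  have h0 : ∀ i, τ i ≠ p → proj hB {i} u = 0 := by
    intro i hi
    have e : proj hG {τ i} ∘ₗ proj hB {i} = proj hB {i} ∘ₗ proj hG {τ i} := by
      refine hom_ext hB fun j x hx => ?_
      rw [LinearMap.comp_apply, LinearMap.comp_apply]
      by_cases hij : j = i
      · subst hij
        rw [proj_self hB hx, proj_self hG (hτ j hx), proj_self hB hx]
      · rw [proj_of_ne hB hx hij, map_zero]
        by_cases hj : τ j = τ i
        · rw [← hj, proj_self hG (hτ j hx), proj_of_ne hB hx hij]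
        · rw [proj_of_ne hG (hτ j hx) hj, map_zero]
    have := LinearMap.congr_fun e u
    rwa [LinearMap.comp_apply, LinearMap.comp_apply, proj_of_ne hG hu (Ne.symm hi), map_zero,
      proj_self hG (hτ i (proj_singleton_mem hB i u))] at this
  refine mem_of_proj_mem hB fun i => ?_
  by_cases hi : τ i = p
  · exact mem_supp (G := B) (show i ∈ {i | τ i = p} from hi) (proj_singleton_mem hB i u)
  · rw [h0 i hi]; exact zero_mem _

end Grading

section

variable {B : Type*} [AddCommGroup B] [Module ℂ B]

/-- The filtration attached to a grading. -/
abbrev filtOf (deg : ℤ → Submodule ℂ B) (i : ℤ) : Submodule ℂ B := ⨆ q : ℤ, ⨆ _ : q ≤ i, deg q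

lemma mem_filtOf {deg : ℤ → Submodule ℂ B} {q i : ℤ} (h : q ≤ i) {a : B} (ha : a ∈ deg q) :
    a ∈ filtOf deg i :=
  Submodule.mem_iSup_of_mem q (Submodule.mem_iSup_of_mem h ha)

lemma filtOf_mono (deg : ℤ → Submodule ℂ B) : Monotone (filtOf deg) := fun _ _ h =>
  Grading.supp_mono fun _ hq => le_trans hq h

lemma filtOf_le {deg : ℤ → Submodule ℂ B} {i : ℤ} {P : Submodule ℂ B}
    (h : ∀ q ≤ i, deg q ≤ P) : filtOf deg i ≤ P := iSup₂_le h

variable {P : PoissonData B} {deg wt : ℤ → Submodule ℂ B}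

lemma IsDGPoisson.d_filtOf (hP : IsDGPoisson P deg) {i : ℤ} {a : B} (ha : a ∈ filtOf deg i) :
    P.d a ∈ filtOf deg (i + 1) :=
  filtOf_le (P := (filtOf deg (i + 1)).comap P.d)
    (fun q hq a ha => mem_filtOf (by omega) (hP.d_mem q a ha)) ha

lemma IsDGPoisson.mul_filtOf (hP : IsDGPoisson P deg) {i j k : ℤ} (hk : i + j ≤ k) {a b : B}
    (ha : a ∈ filtOf deg i) (hb : b ∈ filtOf deg j) : P.mul a b ∈ filtOf deg k := by
  refine filtOf_le (P := (filtOf deg k).comap (P.mul.flip b)) (fun q hq a ha => ?_) ha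
  refine filtOf_le (P := (filtOf deg k).comap (P.mul a)) (fun r hr b hb => ?_) hb
  exact mem_filtOf (by omega) (hP.mul_mem q r a ha b hb)

/-- A weight graded dg Poisson algebra is filtered by degree. -/
theorem IsWeightGradedDGPoisson.filtered (hP : IsWeightGradedDGPoisson P deg wt) :
    IsWeightGradedDiffFilteredComm P.toAlgData wt (filtOf deg) where
  wt_internal := hP.wt_internal
  mono := filtOf_mono deg
  iInf_eq := by
    rw [eq_bot_iff]
    intro x hx
    refine Grading.eq_zero_of_proj hP.internal fun p => ?_
    -- No boundedness is needed: membership in the single step p - 1 already kills the component of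
    -- degree p.
    refine Grading.proj_eq_zero_of_disjoint hP.internal (T := {q | q ≤ p - 1}) ?_
      ((Submodule.mem_iInf _).1 hx (p - 1))
    ext q
    simp only [Set.mem_inter_iff, Set.mem_singleton_iff, Set.mem_ofPred_eq, Set.mem_empty_iff_false,
      iff_false]
    omega
  iSup_eq := by
    rw [eq_top_iff, ← hP.internal.submodule_iSup_eq_top]
    exact iSup_le fun p => le_iSup_of_le p fun a ha => mem_filtOf le_rfl ha
  homogeneous i := by
    refine le_antisymm (filtOf_le fun q hq => ?_) (iSup_le fun k => inf_le_left)
    rw [Grading.eq_supp_of_le hP.internal hP.bigrading Prod.fst (fun i => inf_le_left) q]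
    rintro a ha
    refine Grading.supp_le (P := ⨆ k, filtOf deg i ⊓ wt k) ?_ ha
    rintro ⟨_, k⟩ rfl a ha
    exact Submodule.mem_iSup_of_mem k ⟨mem_filtOf hq ha.1, ha.2⟩
  d_filt _ _ ha := hP.d_filtOf ha
  d_d_filt _ a _ := by rw [hP.d_d]; exact zero_mem _
  d_wt := hP.d_wt
  one_filt := mem_filtOf le_rfl hP.one_mem
  one_wt := hP.one_wt
  mul_filt _ _ _ ha _ hb := hP.mul_filtOf le_rfl ha hb
  mul_wt := hP.mul_wt
  one_mul := hP.one_mul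
  mul_one := hP.mul_one
  mul_assoc := hP.mul_assoc
  d_mul p q x hx b hb := by
    refine filtOf_le (P := (filtOf deg (p + q)).comap
      (P.d ∘ₗ P.mul.flip b - (P.mul.flip b ∘ₗ P.d + (-1 : ℂ) ^ p • P.mul.flip (P.d b))))
      (fun r hr a ha => ?_) hx
    simp only [Submodule.mem_comap, LinearMap.sub_apply, LinearMap.add_apply,
      LinearMap.comp_apply, LinearMap.flip_apply, LinearMap.smul_apply]
    -- In the top degree r = p the Leibniz rule is exact. For r < p the sign may be wrong, but each
    -- term already lies in step r + q + 1 ≤ p + q.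
    rcases hr.eq_or_lt with rfl | hr
    · rw [hP.d_mul r a ha b, sub_self]
      exact zero_mem _
    · have ha' := mem_filtOf le_rfl ha
      refine sub_mem (filtOf_mono deg (show r + q + 1 ≤ p + q by omega)
        (hP.d_filtOf (hP.mul_filtOf le_rfl ha' hb))) (add_mem ?_ (Submodule.smul_mem _ _ ?_))
      · exact hP.mul_filtOf (by omega) (hP.d_filtOf ha') hb
      · exact hP.mul_filtOf (by omega) ha' (hP.d_filtOf hb)
  mul_comm p q x hx y hy := by
    refine filtOf_le (P := (filtOf deg (p + q - 1)).comap
      (P.mul.flip y - (-1 : ℂ) ^ (p * q) • P.mul y)) (fun r hr a ha => ?_) hx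
    refine filtOf_le (P := (filtOf deg (p + q - 1)).comap
      (P.mul a - (-1 : ℂ) ^ (p * q) • P.mul.flip a)) (fun s hs b hb => ?_) hy
    simp only [Submodule.mem_comap, LinearMap.sub_apply, LinearMap.flip_apply,
      LinearMap.smul_apply]
    -- The sign only matters when both factors have top degree. Otherwise r + s ≤ p + q - 1 and both
    -- products are small enough.
    by_cases h : r = p ∧ s = q
    · obtain ⟨rfl, rfl⟩ := h
      rw [hP.mul_comm r s a ha b hb, sub_self]
      exact zero_mem _
    · exact sub_mem (mem_filtOf (by omega) (hP.mul_mem r s a ha b hb))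
        (Submodule.smul_mem _ _ (mem_filtOf (by omega) (hP.mul_mem s r b hb a ha)))

end

/-! ### Modes smeared with a power series -/

section Modes

open PowerSeries Filter

variable {X : Type*} [AddCommGroup X] [Module ℂ X]

lemma mode_add_left (Y : X →ₗ[ℂ] VertexOperator ℂ X) (n : ℤ) (u u' v : X) :
    mode Y (u + u') n v = mode Y u n v + mode Y u' n v := by
  unfold mode
  rw [map_add, map_add]
  rfl

lemma mode_smul_left (Y : X →ₗ[ℂ] VertexOperator ℂ X) (n : ℤ) (c : ℂ) (u v : X) :
    mode Y (c • u) n v = c • mode Y u n v := by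
  unfold mode
  rw [map_smul, map_smul]
  rfl

lemma mode_zero_left (Y : X →ₗ[ℂ] VertexOperator ℂ X) (n : ℤ) (v : X) :
    mode Y 0 n v = 0 := by
  unfold mode
  rw [map_zero, map_zero]
  rfl

/-- The product `uₙ v` as a bilinear map. -/
def modeₗ (Y : X →ₗ[ℂ] VertexOperator ℂ X) (n : ℤ) : X →ₗ[ℂ] X →ₗ[ℂ] X :=
  LinearMap.mk₂ ℂ (fun u v => mode Y u n v) (mode_add_left Y n) (mode_smul_left Y n)
    (fun _ _ _ => map_add _ _ _) (fun _ _ _ => map_smul _ _ _)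

lemma modeₗ_apply (Y : X →ₗ[ℂ] VertexOperator ℂ X) (n : ℤ) (u v : X) :
    modeₗ Y n u v = mode Y u n v := rfl

/-- Truncation is phrased with a filter so that finitely many bounds combine into one, after which
every `finsum` becomes a sum over a common range. -/
lemma eventually_mode_eq_zero (Y : X →ₗ[ℂ] VertexOperator ℂ X) (n : ℤ) (u v : X) :
    ∀ᶠ N : ℕ in atTop, ∀ i ≥ N, mode Y u (n + i) v = 0 := by
  refine eventually_atTop.2
    ⟨(-HahnSeries.order ((HahnModule.of ℂ).symm (Y u v)) - n).toNat, fun N hN i hi => ?_⟩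
  apply VertexOperator.ncoeff_eq_zero_of_lt_order
  have := Int.self_le_toNat (-HahnSeries.order ((HahnModule.of ℂ).symm (Y u v)) - n)
  omega

omit [Module ℂ X] in
lemma finsum_eq_sum_range {f : ℕ → X} {N : ℕ} (h : ∀ i ≥ N, f i = 0) :
    ∑ᶠ i, f i = ∑ i ∈ Finset.range N, f i := by
  refine finsum_eq_finsetSum_of_support_subset _ fun i hi => ?_
  by_contra hN
  exact hi (h i (by simpa using hN))

lemma finsum_smul_mode (Y : X →ₗ[ℂ] VertexOperator ℂ X) (c : ℕ → ℂ) (n : ℤ) (u v : X) {N : ℕ}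
    (h : ∀ i ≥ N, mode Y u (n + i) v = 0) :
    ∑ᶠ i : ℕ, c i • mode Y u (n + i) v = ∑ i ∈ Finset.range N, c i • mode Y u (n + i) v :=
  finsum_eq_sum_range fun i hi => by rw [h i hi, smul_zero]

/-- `∑ⱼ pⱼ u₍ₙ₊ⱼ₎ v` for a power series `p`: the residue of `xⁿ p(x) Y(u, x) v`. -/
def pmode (Y : X →ₗ[ℂ] VertexOperator ℂ X) (n : ℤ) : ℂ⟦X⟧ →ₗ[ℂ] X →ₗ[ℂ] X →ₗ[ℂ] X where
  toFun p := LinearMap.mk₂ ℂ (fun u v => ∑ᶠ i : ℕ, coeff i p • mode Y u (n + i) v)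
    (fun u u' v => by
      obtain ⟨N, h, h'⟩ :=
        ((eventually_mode_eq_zero Y n u v).and (eventually_mode_eq_zero Y n u' v)).exists
      rw [finsum_smul_mode Y _ n u v h, finsum_smul_mode Y _ n u' v h',
        finsum_smul_mode Y _ n (u + u') v (fun i hi => by rw [mode_add_left, h i hi, h' i hi, add_zero]),
        ← Finset.sum_add_distrib]
      simp only [mode_add_left, smul_add])
    (fun c u v => by
      obtain ⟨N, h⟩ := (eventually_mode_eq_zero Y n u v).exists
      rw [finsum_smul_mode Y _ n u v h,
        finsum_smul_mode Y _ n (c • u) v (fun i hi => by rw [mode_smul_left, h i hi, smul_zero]),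
        Finset.smul_sum]
      simp only [mode_smul_left, smul_comm c])
    (fun u v v' => by
      obtain ⟨N, h, h'⟩ :=
        ((eventually_mode_eq_zero Y n u v).and (eventually_mode_eq_zero Y n u v')).exists
      rw [finsum_smul_mode Y _ n u v h, finsum_smul_mode Y _ n u v' h',
        finsum_smul_mode Y _ n u (v + v') (fun i hi => by rw [map_add, h i hi, h' i hi, add_zero]),
        ← Finset.sum_add_distrib]
      simp only [map_add, smul_add])
    (fun c u v => by
      obtain ⟨N, h⟩ := (eventually_mode_eq_zero Y n u v).exists
      rw [finsum_smul_mode Y _ n u v h,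
        finsum_smul_mode Y _ n u (c • v) (fun i hi => by rw [map_smul, h i hi, smul_zero]),
        Finset.smul_sum]
      simp only [map_smul, smul_comm c])
  map_add' p q := by
    ext u v
    obtain ⟨N, h⟩ := (eventually_mode_eq_zero Y n u v).exists
    simp only [LinearMap.mk₂_apply, LinearMap.add_apply]
    rw [finsum_smul_mode Y _ n u v h, finsum_smul_mode Y _ n u v h, finsum_smul_mode Y _ n u v h,
      ← Finset.sum_add_distrib]
    simp only [map_add, add_smul]
  map_smul' c p := by
    ext u v
    obtain ⟨N, h⟩ := (eventually_mode_eq_zero Y n u v).exists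
    simp only [LinearMap.mk₂_apply, LinearMap.smul_apply, RingHom.id_apply]
    rw [finsum_smul_mode Y _ n u v h, finsum_smul_mode Y _ n u v h, Finset.smul_sum]
    simp only [map_smul, smul_assoc]

lemma pmode_apply (Y : X →ₗ[ℂ] VertexOperator ℂ X) (n : ℤ) (p : ℂ⟦X⟧) (u v : X) :
    pmode Y n p u v = ∑ᶠ i : ℕ, coeff i p • mode Y u (n + i) v := rfl

lemma pmode_eq_sum (Y : X →ₗ[ℂ] VertexOperator ℂ X) (n : ℤ) (p : ℂ⟦X⟧) (u v : X) {N : ℕ}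
    (h : ∀ i ≥ N, mode Y u (n + i) v = 0) :
    pmode Y n p u v = ∑ i ∈ Finset.range N, coeff i p • mode Y u (n + i) v :=
  finsum_smul_mode Y _ n u v h

/-- A subspace containing all the modes involved contains the smeared mode. -/
lemma pmode_mem {Y : X →ₗ[ℂ] VertexOperator ℂ X} {n : ℤ} {p : ℂ⟦X⟧} {u v : X}
    {P : Submodule ℂ X} (h : ∀ i : ℕ, coeff i p ≠ 0 → mode Y u (n + i) v ∈ P) :
    pmode Y n p u v ∈ P := by
  rw [pmode_apply]
  refine finsum_induction (· ∈ P) (zero_mem _) (fun _ _ => add_mem) fun i => ?_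
  by_cases hi : coeff i p = 0
  · rw [hi, zero_smul]; exact zero_mem _
  · exact P.smul_mem _ (h i hi)

lemma pmode_X_mul (Y : X →ₗ[ℂ] VertexOperator ℂ X) (n : ℤ) (p : ℂ⟦X⟧) (u v : X) :
    pmode Y n (PowerSeries.X * p) u v = pmode Y (n + 1) p u v := by
  obtain ⟨N, h⟩ := (eventually_mode_eq_zero Y (n + 1) u v).exists
  have h' : ∀ i ≥ N + 1, mode Y u (n + i) v = 0 := by
    intro i hi
    obtain ⟨j, rfl⟩ : ∃ j, i = j + 1 := ⟨i - 1, by omega⟩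
    rw [← h j (by omega)]
    push_cast
    rw [add_right_comm, add_assoc]
  rw [pmode_eq_sum Y _ _ u v h, pmode_eq_sum Y _ _ u v h', Finset.sum_range_succ']
  simp only [coeff_succ_X_mul, coeff_zero_X_mul, zero_smul, add_zero]
  refine Finset.sum_congr rfl fun i _ => ?_
  push_cast
  rw [add_right_comm, add_assoc]

lemma pmode_X_pow_mul (Y : X →ₗ[ℂ] VertexOperator ℂ X) (n : ℤ) (t : ℕ) (p : ℂ⟦X⟧) (u v : X) :
    pmode Y n (PowerSeries.X ^ t * p) u v = pmode Y (n + t) p u v := by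
  induction t generalizing n with
  | zero => simp
  | succ t ih =>
    rw [pow_succ', mul_assoc, pmode_X_mul, ih]
    push_cast
    rw [add_right_comm, add_assoc]

lemma pmode_one_add_X_mul (Y : X →ₗ[ℂ] VertexOperator ℂ X) (n : ℤ) (p : ℂ⟦X⟧) (u v : X) :
    pmode Y n ((1 + PowerSeries.X) * p) u v = pmode Y n p u v + pmode Y (n + 1) p u v := by
  rw [add_mul, one_mul, map_add, LinearMap.add_apply, LinearMap.add_apply, pmode_X_mul]

/-- The power series `(1 + x)^a`. -/
abbrev bin (a : ℂ) : ℂ⟦X⟧ := binomialSeries ℂ a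

lemma coeff_bin (a : ℂ) (i : ℕ) : coeff i (bin a) = Ring.choose a i := by
  simp

lemma bin_add_natCast (a : ℂ) (e : ℕ) : bin (a + e) = (1 + PowerSeries.X) ^ e * bin a := by
  rw [bin, binomialSeries_add, binomialSeries_nat, mul_comm]

/-- The power series `x^(i-m) (1/i!) (d/dx)^i (x^m p(x))`. -/
def dividedDeriv (m : ℂ) (i : ℕ) (p : ℂ⟦X⟧) : ℂ⟦X⟧ :=
  PowerSeries.mk fun a => coeff a p * Ring.choose (m + a) i

/-- This is the Leibniz rule for the i-th divided derivative of x^m (1 + x)^A. On coefficients it is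
Vandermonde's identity together with C(A, a) C(a, t) = C(A, t) C(A - t, a - t). -/
lemma dividedDeriv_bin (m A : ℂ) (i : ℕ) :
    dividedDeriv m i (bin A) = ∑ t ∈ Finset.range (i + 1),
      (Ring.choose m (i - t) * Ring.choose A t) • (PowerSeries.X ^ t * bin (A - t)) := by
  ext a
  rw [dividedDeriv, coeff_mk, coeff_bin, add_comm m, Ring.add_choose_eq i (Commute.all _ _),
    Finset.Nat.sum_antidiagonal_eq_sum_range_succ
      (fun x y => Ring.choose (a : ℂ) x * Ring.choose m y), Finset.mul_sum, map_sum]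
  refine Finset.sum_congr rfl fun t _ => ?_
  rw [PowerSeries.coeff_smul, coeff_X_pow_mul', Ring.choose_natCast]
  split_ifs with h
  · have := Ring.choose_smul_choose A h
    rw [nsmul_eq_mul] at this
    rw [coeff_bin, smul_eq_mul]
    linear_combination (Ring.choose m (i - t)) * this
  · rw [Nat.choose_eq_zero_of_lt (not_le.1 h)]
    simp

lemma dividedDeriv_zero_bin (A : ℂ) (i : ℕ) :
    dividedDeriv 0 i (bin A)
      = Ring.choose A i • (PowerSeries.X ^ i * bin (A - i)) := by
  rw [dividedDeriv_bin, Finset.sum_range_succ, Finset.sum_eq_zero, zero_add, Nat.sub_self,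
    Ring.choose_zero_right, one_mul]
  intro t ht
  rw [Ring.choose_zero_pos ℂ (by have := Finset.mem_range.1 ht; omega), zero_mul, zero_smul]

/-- The Cauchy product runs over the triangle a + b < N. Filling it up to a square costs nothing
because f vanishes from N on. -/
lemma sum_range_coeff_mul (p q : ℂ⟦X⟧) (f : ℕ → X) {N : ℕ} (hf : ∀ i ≥ N, f i = 0) :
    ∑ s ∈ Finset.range N, coeff s (p * q) • f s
      = ∑ a ∈ Finset.range N, ∑ b ∈ Finset.range N, (coeff a p * coeff b q) • f (a + b) := by
  simp only [coeff_mul, Finset.sum_smul]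
  rw [← Finset.sum_product', Finset.sum_sigma']
  refine Finset.sum_bij_ne_zero (fun x _ _ => x.2) ?_ ?_ ?_ ?_
  · rintro ⟨s, a, b⟩ h _
    obtain ⟨h1, h2⟩ := Finset.mem_sigma.1 h
    have h1 : s < N := Finset.mem_range.1 h1
    have h2 : a + b = s := Finset.HasAntidiagonal.mem_antidiagonal.1 h2
    simp only [Finset.mem_product, Finset.mem_range]
    omega
  · rintro ⟨s, a, b⟩ h _ ⟨s', a', b'⟩ h' _ hab
    have h2 : a + b = s := Finset.HasAntidiagonal.mem_antidiagonal.1 (Finset.mem_sigma.1 h).2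
    have h2' : a' + b' = s' := Finset.HasAntidiagonal.mem_antidiagonal.1 (Finset.mem_sigma.1 h').2
    obtain ⟨rfl, rfl⟩ : a = a' ∧ b = b' := by simpa using hab
    subst h2 h2'
    rfl
  · rintro ⟨a, b⟩ h h0
    have hlt : a + b < N := by
      by_contra hN
      exact h0 (by rw [hf _ (not_lt.1 hN), smul_zero])
    exact ⟨⟨a + b, a, b⟩, by simpa using hlt, h0, rfl⟩
  · rintro ⟨s, a, b⟩ h _
    have h2 : a + b = s := Finset.HasAntidiagonal.mem_antidiagonal.1 (Finset.mem_sigma.1 h).2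
    subst h2
    rfl

/-- The Jacobi identity, smeared with two power series. -/
theorem DGVertexAlgebra.jacobi_pmode (V : DGVertexAlgebra X) {p q : ℤ} {u v : X}
    (hu : u ∈ V.deg p) (hv : v ∈ V.deg q) (f g : ℂ⟦X⟧) (l m n : ℤ) (w : X) :
    ∑ᶠ i : ℕ, ((-1 : ℂ) ^ i * Ring.choose (l : ℂ) i) •
        (pmode V.Y (m + l - i) f u (pmode V.Y (n + i) g v w)
          - ((-1 : ℂ) ^ l * (-1 : ℂ) ^ (p * q)) •
            pmode V.Y (n + l - i) g v (pmode V.Y (m + i) f u w))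
      = ∑ᶠ i : ℕ, pmode V.Y (m + n - i) (dividedDeriv m i f * g) (mode V.Y u (l + i) v) w := by
  -- K bounds the inner modes. Once they vanish from K on, only finitely many outer modes are left
  -- to truncate, and N serves for all of them.
  obtain ⟨K, h1, h2, h3⟩ := ((eventually_mode_eq_zero V.Y l u v).and
    ((eventually_mode_eq_zero V.Y n v w).and (eventually_mode_eq_zero V.Y m u w))).exists
  have E4 : ∀ᶠ N : ℕ in atTop, ∀ i ∈ Finset.range K, ∀ b ∈ Finset.range K, ∀ a ≥ N,
      mode V.Y u (m + l - i + a) (mode V.Y v (n + i + b) w) = 0 := by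
    simp only [eventually_all_finset]
    exact fun i _ b _ => eventually_mode_eq_zero V.Y _ _ _
  have E5 : ∀ᶠ N : ℕ in atTop, ∀ i ∈ Finset.range K, ∀ a ∈ Finset.range K, ∀ b ≥ N,
      mode V.Y v (n + l - i + b) (mode V.Y u (m + i + a) w) = 0 := by
    simp only [eventually_all_finset]
    exact fun i _ b _ => eventually_mode_eq_zero V.Y _ _ _
  have E6 : ∀ᶠ N : ℕ in atTop, ∀ i ∈ Finset.range K, ∀ s ≥ N,
      mode V.Y (mode V.Y u (l + i) v) (m + n - i + s) w = 0 := by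
    simp only [eventually_all_finset]
    exact fun i _ => eventually_mode_eq_zero V.Y _ _ _
  obtain ⟨N, hKN, h4, h5, h6⟩ := ((eventually_ge_atTop K).and (E4.and (E5.and E6))).exists
  have h2' : ∀ i b : ℕ, K ≤ i + b → mode V.Y v (n + i + b) w = 0 := fun i b h => by
    rw [← h2 (i + b) h]; push_cast; rw [add_assoc]
  have h3' : ∀ i b : ℕ, K ≤ i + b → mode V.Y u (m + i + b) w = 0 := fun i b h => by
    rw [← h3 (i + b) h]; push_cast; rw [add_assoc]
  have h4' : ∀ i b : ℕ, ∀ a ≥ N,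
      mode V.Y u (m + l - i + a) (mode V.Y v (n + i + b) w) = 0 := by
    intro i b a ha
    by_cases h : K ≤ i + b
    · rw [h2' i b h, map_zero]
    · exact h4 i (by simp; omega) b (by simp; omega) a ha
  have h5' : ∀ i a : ℕ, ∀ b ≥ N,
      mode V.Y v (n + l - i + b) (mode V.Y u (m + i + a) w) = 0 := by
    intro i b a ha
    by_cases h : K ≤ i + b
    · rw [h3' i b h, map_zero]
    · exact h5 i (by simp; omega) b (by simp; omega) a ha
  have h6' : ∀ i : ℕ, ∀ s ≥ N, mode V.Y (mode V.Y u (l + i) v) (m + n - i + s) w = 0 := by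
    intro i s hs
    by_cases h : K ≤ i
    · rw [h1 i h, mode_zero_left]
    · exact h6 i (by simp; omega) s hs
  have hL : ∀ i : ℕ, pmode V.Y (m + l - i) f u (pmode V.Y (n + i) g v w)
      = ∑ a ∈ Finset.range N, ∑ b ∈ Finset.range N, (coeff a f * coeff b g) •
        mode V.Y u (m + l - i + a) (mode V.Y v (n + i + b) w) := by
    intro i
    rw [pmode_eq_sum V.Y (n + i) g v w (N := N) (fun b hb => h2' i b (by omega)), map_sum,
      Finset.sum_comm]
    refine Finset.sum_congr rfl fun b _ => ?_
    rw [map_smul, pmode_eq_sum V.Y _ f u _ (h4' i b), Finset.smul_sum]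
    exact Finset.sum_congr rfl fun a _ => by rw [smul_smul, mul_comm]
  have hL' : ∀ i : ℕ, pmode V.Y (n + l - i) g v (pmode V.Y (m + i) f u w)
      = ∑ a ∈ Finset.range N, ∑ b ∈ Finset.range N, (coeff a f * coeff b g) •
        mode V.Y v (n + l - i + b) (mode V.Y u (m + i + a) w) := by
    intro i
    rw [pmode_eq_sum V.Y (m + i) f u w (N := N) (fun b hb => h3' i b (by omega)), map_sum]
    refine Finset.sum_congr rfl fun b _ => ?_
    rw [map_smul, pmode_eq_sum V.Y _ g v _ (h5' i b), Finset.smul_sum]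
    exact Finset.sum_congr rfl fun a _ => by rw [smul_smul]
  have hJ : ∀ a b : ℕ, ∑ i ∈ Finset.range N, ((-1 : ℂ) ^ i * Ring.choose (l : ℂ) i) •
        (mode V.Y u (m + l - i + a) (mode V.Y v (n + i + b) w)
          - ((-1 : ℂ) ^ l * (-1 : ℂ) ^ (p * q)) •
            mode V.Y v (n + l - i + b) (mode V.Y u (m + i + a) w))
      = ∑ i ∈ Finset.range N, Ring.choose ((m : ℂ) + a) i •
          mode V.Y (mode V.Y u (l + i) v) (m + n - i + ((a + b : ℕ) : ℤ)) w := by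
    intro a b
    -- The coefficient of x₁^a x₂^b in f(x₁) g(x₂) shifts m to m + a and n to n + b. The binomials
    -- C(m + a, i) that appear are what `dividedDeriv` collects.
    have := V.jacobi p q u hu v hv l (m + a) (n + b) w
    rw [finsum_eq_sum_range (N := N), finsum_eq_sum_range (N := N)] at this
    · push_cast at this ⊢
      convert this using 5 <;> ring_nf
    · intro i hi
      rw [h1 i (by omega), mode_zero_left, smul_zero]
    · intro i hi
      have e1 := h2' b i (by omega)
      have e2 := h3' a i (by omega)
      rw [e1, e2]
      simp
  rw [finsum_eq_sum_range (N := N), finsum_eq_sum_range (N := N)]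
  · simp only [hL, hL', Finset.smul_sum, ← Finset.sum_sub_distrib]
    rw [Finset.sum_comm]
    have hR : ∀ i : ℕ, pmode V.Y (m + n - i) (dividedDeriv m i f * g) (mode V.Y u (l + i) v) w
        = ∑ a ∈ Finset.range N, ∑ b ∈ Finset.range N, (coeff a f * coeff b g) •
          (Ring.choose ((m : ℂ) + a) i •
            mode V.Y (mode V.Y u (l + i) v) (m + n - i + ((a + b : ℕ) : ℤ)) w) := by
      intro i
      rw [pmode_eq_sum V.Y _ _ _ _ (h6' i), sum_range_coeff_mul _ _ _ (h6' i)]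
      refine Finset.sum_congr rfl fun a _ => Finset.sum_congr rfl fun b _ => ?_
      rw [dividedDeriv, coeff_mk, smul_smul, mul_right_comm]
    simp only [hR]
    rw [Finset.sum_comm (s := Finset.range N) (t := Finset.range N)
      (f := fun i a => ∑ b ∈ Finset.range N, (coeff a f * coeff b g) •
          (Ring.choose ((m : ℂ) + a) i •
            mode V.Y (mode V.Y u (l + i) v) (m + n - i + ((a + b : ℕ) : ℤ)) w))]
    refine Finset.sum_congr rfl fun a _ => ?_
    rw [Finset.sum_comm, Finset.sum_comm (s := Finset.range N) (t := Finset.range N)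
      (f := fun i b => (coeff a f * coeff b g) •
          (Ring.choose ((m : ℂ) + a) i •
            mode V.Y (mode V.Y u (l + i) v) (m + n - i + ((a + b : ℕ) : ℤ)) w))]
    refine Finset.sum_congr rfl fun b _ => ?_
    rw [← Finset.smul_sum, ← hJ a b, Finset.smul_sum]
    refine Finset.sum_congr rfl fun i _ => ?_
    rw [smul_comm ((-1 : ℂ) ^ l * (-1 : ℂ) ^ (p * q)), ← smul_sub, smul_comm]
  · intro i hi
    rw [h1 i (by omega)]
    simp
  · intro i hi
    have e1 : pmode V.Y (n + i) g v w = 0 := by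
      rw [pmode_eq_sum V.Y _ _ _ _ (N := 0) fun b _ => h2' i b (by omega)]; rfl
    have e2 : pmode V.Y (m + i) f u w = 0 := by
      rw [pmode_eq_sum V.Y _ _ _ _ (N := 0) fun b _ => h3' i b (by omega)]; rfl
    rw [e1, e2]
    simp

end Modes

/-! ### Consequences of the Jacobi identity -/

section

variable {X : Type*} [AddCommGroup X] [Module ℂ X]

namespace Grading

lemma map_proj {ι M : Type*} [DecidableEq ι] [AddCommGroup M] [Module ℂ M]
    {G : ι → Submodule ℂ M} (h : DirectSum.IsInternal G) (S : Set ι) {f : M →ₗ[ℂ] M}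
    (hf : ∀ i, ∀ x ∈ G i, f x ∈ G i) (x : M) : f (proj h S x) = proj h S (f x) := by
  refine induction h x (fun i x hx => ?_) (by rw [map_zero, map_zero, map_zero])
    (fun x y hx hy => by rw [map_add, map_add, map_add, map_add, hx, hy])
  by_cases hi : i ∈ S
  · rw [proj_of_mem h hx hi, proj_of_mem h (hf i x hx) hi]
  · rw [proj_of_notMem h hx hi, proj_of_notMem h (hf i x hx) hi, map_zero]

lemma proj_mem_of_mem {ι M : Type*} [DecidableEq ι] [AddCommGroup M] [Module ℂ M]
    {G : ι → Submodule ℂ M} (h : DirectSum.IsInternal G) (i : ι) {f : M →ₗ[ℂ] M} {c : ℂ}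
    (hf : ∀ i, ∀ x ∈ G i, f x ∈ G i) {x : M} (hx : f x = c • x) :
    f (proj h {i} x) = c • proj h {i} x := by
  rw [map_proj h _ hf, hx, map_smul]

end Grading

/-! ### Commutator, associator and translation formulas -/

namespace DGVertexAlgebra

variable (V : DGVertexAlgebra X)

lemma commutator {p q : ℤ} {u v : X} (hu : u ∈ V.deg p) (hv : v ∈ V.deg q) (m n : ℤ) (w : X) :
    mode V.Y u m (mode V.Y v n w) - (-1 : ℂ) ^ (p * q) • mode V.Y v n (mode V.Y u m w)
      = ∑ᶠ i : ℕ, Ring.choose (m : ℂ) i • mode V.Y (mode V.Y u i v) (m + n - i) w := by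
  have h := V.jacobi p q u hu v hv 0 m n w
  rw [finsum_eq_single _ 0 (fun i hi => by
    rw [Int.cast_zero, Ring.choose_zero_pos ℂ (Nat.pos_of_ne_zero hi), mul_zero, zero_smul])] at h
  simpa using h

lemma associator {p q : ℤ} {u v : X} (hu : u ∈ V.deg p) (hv : v ∈ V.deg q) (l n : ℤ) (w : X) :
    ∑ᶠ i : ℕ, ((-1 : ℂ) ^ i * Ring.choose (l : ℂ) i) •
        (mode V.Y u (l - i) (mode V.Y v (n + i) w)
          - ((-1 : ℂ) ^ l * (-1 : ℂ) ^ (p * q)) • mode V.Y v (n + l - i) (mode V.Y u i w))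
      = mode V.Y (mode V.Y u l v) n w := by
  have h := V.jacobi p q u hu v hv l 0 n w
  rw [finsum_eq_single (fun i : ℕ => Ring.choose (((0 : ℤ)) : ℂ) i • _) 0 (fun i hi => by
    rw [Int.cast_zero, Ring.choose_zero_pos ℂ (Nat.pos_of_ne_zero hi), zero_smul])] at h
  simpa using h

lemma neg_one_pow_mul_choose_neg_two (i : ℕ) :
    (-1 : ℂ) ^ i * Ring.choose (-2 : ℂ) i = i + 1 := by
  rw [Ring.choose_neg', Ring.multichoose_two]
  rcases Nat.even_or_odd i with h | h
  · simp [Int.negOnePow_even _ ((Int.even_coe_nat i).2 h), h.neg_one_pow]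
  · simp [Int.negOnePow_odd _ ((Int.odd_coe_nat i).2 h), h.neg_one_pow, add_comm]

/-- This is the translation formula for u₋₂ 1, read off from the associator formula with second
vector the vacuum. Since only the mode -1 of the vacuum is nonzero, at most one term survives: i =
-1 - n from the first product if n < 0, i = n - 1 from the second if n > 0. In both cases i + 1 =
|n| gives the coefficient. -/
lemma mode_translate_of_mem {p : ℤ} {u : X} (hu : u ∈ V.deg p) (n : ℤ) (w : X) :
    mode V.Y (mode V.Y u (-2) V.vac) n w = -(n : ℂ) • mode V.Y u (n - 1) w := by
  rw [← V.associator hu V.vac_mem]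
  simp only [V.vacuum, mul_zero, zpow_zero, mul_one]
  have h2 : ((-2 : ℤ) : ℂ) = -2 := by norm_num
  rw [h2]
  simp only [neg_one_pow_mul_choose_neg_two]
  rcases lt_trichotomy n 0 with h | h | h
  · obtain ⟨j, rfl⟩ : ∃ j : ℕ, n = -1 - j := ⟨(-1 - n).toNat, by omega⟩
    rw [finsum_eq_single _ j]
    · rw [if_pos (by omega), if_neg (by omega), smul_zero, sub_zero,
        show (-2 - (j : ℤ)) = -1 - j - 1 by ring]
      congr 1
      push_cast
      ring
    · intro i hi
      rw [if_neg (by omega), if_neg (by omega), map_zero, smul_zero, sub_zero, smul_zero]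
  · subst h
    rw [finsum_eq_zero_of_forall_eq_zero]
    · simp
    · intro i
      rw [if_neg (by omega), if_neg (by omega), map_zero, smul_zero, sub_zero, smul_zero]
  · obtain ⟨j, rfl⟩ : ∃ j : ℕ, n = j + 1 := ⟨(n - 1).toNat, by omega⟩
    rw [finsum_eq_single _ j]
    · rw [if_neg (by omega), if_pos (by omega), map_zero, zero_sub,
        show ((-1 : ℂ) ^ (-2 : ℤ)) = 1 by norm_num, one_smul, smul_neg, ← neg_smul,
        show (j : ℤ) + 1 - 1 = j by ring]
      congr 1
      push_cast
      ring
    · intro i hi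
      rw [if_neg (by omega), if_neg (by omega), map_zero, smul_zero, sub_zero, smul_zero]

lemma mode_translate (u : X) (n : ℤ) (w : X) :
    mode V.Y (mode V.Y u (-2) V.vac) n w = -(n : ℂ) • mode V.Y u (n - 1) w := by
  have : ((modeₗ V.Y n).flip w) ∘ₗ ((modeₗ V.Y (-2)).flip V.vac)
      = -(n : ℂ) • ((modeₗ V.Y (n - 1)).flip w) :=
    Grading.hom_ext V.deg_internal fun p u hu => V.mode_translate_of_mem hu n w
  exact LinearMap.congr_fun this u

end DGVertexAlgebra

/-! ### The bigrading by degree and weight -/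

namespace DGVertexOperatorAlgebra

variable (V : DGVertexOperatorAlgebra X)

lemma mem_wt_iff {k : ℤ} {u : X} :
    u ∈ V.wt k ↔ mode V.Y V.omega 1 u = ((k : ℂ) / 2) • u :=
  Module.End.mem_eigenspace_iff

lemma L0_deg (p : ℤ) (u : X) (hu : u ∈ V.deg p) : mode V.Y V.omega 1 u ∈ V.deg p := by
  have := V.Y_mem 4 p 1 _ V.omega_mem u hu
  rwa [show (4 : ℤ) + p - 2 * 1 - 2 = p by ring] at this

/-- The bihomogeneous component of degree `i.1` and weight `i.2 / 2`. -/
def bi (i : ℤ × ℤ) : Submodule ℂ X := V.deg i.1 ⊓ V.wt i.2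

/-- L(0) has degree 0, so the degree components of an eigenvector are again eigenvectors. This makes
the two gradings compatible. -/
lemma proj_deg_wt {k : ℤ} {u : X} (hu : u ∈ V.wt k) (p : ℤ) :
    Grading.proj V.deg_internal {p} u ∈ V.wt k := by
  rw [mem_wt_iff] at hu ⊢
  exact Grading.proj_mem_of_mem V.deg_internal p V.L0_deg hu

lemma wt_le_supp_bi (k : ℤ) : V.wt k ≤ Grading.supp V.bi {i | i.2 = k} := fun u hu =>
  Grading.mem_of_proj_mem V.deg_internal fun p =>
    Grading.mem_supp (G := V.bi) (show (p, k) ∈ {i : ℤ × ℤ | i.2 = k} from rfl)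
      (show _ ∈ V.bi (p, k) from
        ⟨Grading.proj_singleton_mem V.deg_internal p u, V.proj_deg_wt hu p⟩)

lemma isInternal_wt : DirectSum.IsInternal V.wt := V.weight_internal

lemma bi_internal : DirectSum.IsInternal V.bi := by
  refine Grading.isInternal_of_projections _
    (fun i => Grading.proj V.deg_internal {i.1} ∘ₗ Grading.proj V.isInternal_wt {i.2}) ?_ ?_ ?_
  · rintro ⟨p, k⟩ x ⟨hx, hx'⟩
    rw [LinearMap.comp_apply, Grading.proj_self V.isInternal_wt hx',
      Grading.proj_self V.deg_internal hx]
  · rintro ⟨p, k⟩ ⟨q, l⟩ hij x ⟨hx, hx'⟩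
    rw [LinearMap.comp_apply]
    by_cases hkl : k = l
    · subst hkl
      rw [Grading.proj_self V.isInternal_wt hx', Grading.proj_of_ne V.deg_internal hx]
      rintro rfl
      exact hij rfl
    · rw [Grading.proj_of_ne V.isInternal_wt hx' (Ne.symm hkl), map_zero]
  · rw [eq_top_iff, ← V.isInternal_wt.submodule_iSup_eq_top]
    refine iSup_le fun k => (V.wt_le_supp_bi k).trans ?_
    exact Grading.supp_le fun i _ => le_iSup V.bi i

lemma wt_eq (k : ℤ) : V.wt k = Grading.supp V.bi {i | i.2 = k} :=
  Grading.eq_supp_of_le V.isInternal_wt V.bi_internal Prod.snd (fun _ => inf_le_right) k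

lemma deg_eq (p : ℤ) : V.deg p = Grading.supp V.bi {i | i.1 = p} :=
  Grading.eq_supp_of_le V.deg_internal V.bi_internal Prod.fst (fun _ => inf_le_left) p

lemma mode_omega_zero_mode (u : X) (n : ℤ) (w : X) :
    mode V.Y (mode V.Y V.omega 0 u) n w = -(n : ℂ) • mode V.Y u (n - 1) w := by
  rw [V.translation, V.mode_translate]

/-- For the weight, the commutator formula for ω₁ = L(0) has two terms: (L(-1) u)ₙ₊₁ = -(n + 1) uₙ
and (L(0) u)ₙ. Hence [L(0), uₙ] = (wt u - n - 1) uₙ. -/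
lemma mode_mem_bi {i j : ℤ × ℤ} {u v : X} (hu : u ∈ V.bi i) (hv : v ∈ V.bi j) (n : ℤ) :
    mode V.Y u n v ∈ V.bi (i.1 + j.1 - 2 * n - 2, i.2 + j.2 - 2 * n - 2) := by
  refine ⟨V.Y_mem _ _ n u hu.1 v hv.1, ?_⟩
  have hu2 := V.mem_wt_iff.1 hu.2
  have hv2 := V.mem_wt_iff.1 hv.2
  refine V.mem_wt_iff.2 ?_
  have h := V.commutator V.omega_mem hu.1 1 n v
  rw [finsum_eq_sum_range (N := 2), Finset.sum_range_succ, Finset.sum_range_one] at h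
  · simp only [Int.cast_one, Ring.choose_zero_right, Ring.choose_one_right, one_smul,
      Nat.cast_zero, Nat.cast_one, mode_omega_zero_mode, hu2, hv2, mode_smul_left, map_smul] at h
    rw [show ((-1 : ℂ) ^ (4 * i.1)) = 1 by rw [zpow_mul]; norm_num, one_smul,
      show (1 : ℤ) + n - 0 - 1 = n by ring, show (1 : ℤ) + n - 1 = n by ring,
      sub_eq_iff_eq_add] at h
    rw [h]
    push_cast
    module
  · intro a ha
    rw [show ((1 : ℤ) : ℂ) = ((1 : ℕ) : ℂ) by norm_num, Ring.choose_natCast,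
      Nat.choose_eq_zero_of_lt (by omega), Nat.cast_zero, zero_smul]

lemma vac_mem_bi : V.vac ∈ V.bi (0, 0) := by
  refine ⟨V.vac_mem, V.mem_wt_iff.2 ?_⟩
  rw [V.creation_regular 1 (by norm_num)]
  simp

/-- Since ω is closed and of even degree, d commutes with L(0). -/
lemma d_mem_wt {k : ℤ} {u : X} (hu : u ∈ V.wt k) : V.d u ∈ V.wt k := by
  rw [mem_wt_iff] at hu ⊢
  have h := V.d_Y 4 1 V.omega V.omega_mem u
  rw [V.d_omega, mode_zero_left, zero_add, show ((-1 : ℂ) ^ (4 : ℤ)) = 1 by norm_num, one_smul,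
    hu, map_smul] at h
  exact h.symm

lemma d_mem_bi {i : ℤ × ℤ} {u : X} (hu : u ∈ V.bi i) : V.d u ∈ V.bi (i.1 + 1, i.2) :=
  ⟨V.d_mem _ u hu.1, V.d_mem_wt hu.2⟩

/-- Bilinear maps agreeing on bihomogeneous vectors are equal. -/
lemma bilin_ext {N : Type*} [AddCommGroup N] [Module ℂ N] {f g : X →ₗ[ℂ] X →ₗ[ℂ] N}
    (H : ∀ i j, ∀ u ∈ V.bi i, ∀ v ∈ V.bi j, f u v = g u v) : f = g :=
  Grading.hom_ext V.bi_internal fun i u hu =>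
    Grading.hom_ext V.bi_internal fun j v hv => H i j u hu v hv

/-- A bilinear map takes values in a subspace if it does so on bihomogeneous vectors. -/
lemma bilin_mem {N : Type*} [AddCommGroup N] [Module ℂ N] (f : X →ₗ[ℂ] X →ₗ[ℂ] N)
    (P : Submodule ℂ N) (H : ∀ i j, ∀ u ∈ V.bi i, ∀ v ∈ V.bi j, f u v ∈ P) (u v : X) :
    f u v ∈ P := by
  have h1 : ∀ i, ∀ u ∈ V.bi i, ∀ v, f u v ∈ P := fun i u hu v =>
    Grading.mem_of_proj_mem V.bi_internal (P := P.comap (f u)) fun j =>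
      H i j u hu _ (Grading.proj_singleton_mem V.bi_internal j v)
  exact Grading.mem_of_proj_mem V.bi_internal (P := P.comap (f.flip v)) fun i =>
    h1 i _ (Grading.proj_singleton_mem V.bi_internal i u) v

end DGVertexOperatorAlgebra

end

/-! ### The `C₂`-algebra is a weight graded dg Poisson algebra -/

section

variable {X : Type*} [AddCommGroup X] [Module ℂ X]

lemma finsum_mem_of_forall {P : Submodule ℂ X} {f : ℕ → X} (h : ∀ i, f i ∈ P) :
    ∑ᶠ i, f i ∈ P :=
  finsum_induction (· ∈ P) (zero_mem _) (fun _ _ => add_mem) h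

lemma finsum_sub_zero_mem {P : Submodule ℂ X} {f : ℕ → X}
    (hf : ∀ᶠ N : ℕ in Filter.atTop, ∀ i ≥ N, f i = 0) (h : ∀ i, f (i + 1) ∈ P) :
    ∑ᶠ i, f i - f 0 ∈ P := by
  obtain ⟨N, hN⟩ := hf.exists
  rw [finsum_eq_sum_range (N := N + 1) (fun i hi => hN i (by omega)), Finset.sum_range_succ',
    add_sub_cancel_right]
  exact Submodule.sum_mem _ fun i _ => h i

namespace Grading

/-- Images of intersections are intersections of images because the kernel is homogeneous: if f a =
f b with a supported in S, the S-part of b still maps to f a. -/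
lemma map_supp_inf {ι M N : Type*} [DecidableEq ι] [AddCommGroup M] [Module ℂ M]
    [AddCommGroup N] [Module ℂ N] {G : ι → Submodule ℂ M} (h : DirectSum.IsInternal G)
    {f : M →ₗ[ℂ] N} (hker : ∀ x, f x = 0 → ∀ S, f (proj h S x) = 0) (S T : Set ι) :
    (supp G S).map f ⊓ (supp G T).map f = (supp G (S ∩ T)).map f := by
  refine le_antisymm ?_ (le_inf (Submodule.map_mono (supp_mono Set.inter_subset_left))
    (Submodule.map_mono (supp_mono Set.inter_subset_right)))
  rintro _ ⟨⟨a, ha, rfl⟩, ⟨b, hb, hab⟩⟩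
  have h0 := hker (b - a) (by rw [map_sub, hab, sub_self]) S
  rw [map_sub, map_sub, proj_of_mem_supp h ha, sub_eq_zero] at h0
  exact ⟨_, proj_mem_inter h hb, h0⟩

end Grading

namespace DGVertexOperatorAlgebra

variable (V : DGVertexOperatorAlgebra X)

lemma bilin_ext_deg {N : Type*} [AddCommGroup N] [Module ℂ N] {f g : X →ₗ[ℂ] X →ₗ[ℂ] N}
    (H : ∀ p q, ∀ u ∈ V.deg p, ∀ v ∈ V.deg q, f u v = g u v) : f = g :=
  V.bilin_ext fun i j u hu v hv => H i.1 j.1 u hu.1 v hv.1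

lemma bi_eq_supp (i : ℤ × ℤ) :
    V.bi i = Grading.supp V.bi ({j | j.1 = i.1} ∩ {j | j.2 = i.2}) := by
  have : ({j | j.1 = i.1} ∩ {j | j.2 = i.2} : Set (ℤ × ℤ)) = {i} := by
    ext j
    exact Prod.ext_iff.symm
  rw [this]
  simp [Grading.supp]

lemma proj_deg_eq (p : ℤ) (x : X) :
    Grading.proj V.deg_internal {p} x = Grading.proj V.bi_internal {i | i.1 = p} x := by
  refine LinearMap.congr_fun (Grading.hom_ext V.bi_internal fun i x hx => ?_) x
  by_cases h : i.1 = p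
  · rw [Grading.proj_of_mem V.deg_internal hx.1 (show i.1 ∈ ({p} : Set ℤ) from h),
      Grading.proj_of_mem V.bi_internal hx (show i ∈ {i : ℤ × ℤ | i.1 = p} from h)]
  · rw [Grading.proj_of_ne V.deg_internal hx.1 h,
      Grading.proj_of_notMem V.bi_internal hx (show i ∉ {i : ℤ × ℤ | i.1 = p} from h)]

lemma proj_wt_eq (k : ℤ) (x : X) :
    Grading.proj V.isInternal_wt {k} x = Grading.proj V.bi_internal {i | i.2 = k} x := by
  refine LinearMap.congr_fun (Grading.hom_ext V.bi_internal fun i x hx => ?_) x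
  by_cases h : i.2 = k
  · rw [Grading.proj_of_mem V.isInternal_wt hx.2 (show i.2 ∈ ({k} : Set ℤ) from h),
      Grading.proj_of_mem V.bi_internal hx (show i ∈ {i : ℤ × ℤ | i.2 = k} from h)]
  · rw [Grading.proj_of_ne V.isInternal_wt hx.2 h,
      Grading.proj_of_notMem V.bi_internal hx (show i ∉ {i : ℤ × ℤ | i.2 = k} from h)]

/-! ### Gradings on the image of a map with bigraded kernel -/

section Image

variable {N : Type*} [AddCommGroup N] [Module ℂ N] {f : X →ₗ[ℂ] N}
  (hf : Function.Surjective f)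
  (hker : ∀ x, f x = 0 → ∀ S, f (Grading.proj V.bi_internal S x) = 0)

include hf hker

lemma isInternal_map_deg : DirectSum.IsInternal fun p => (V.deg p).map f :=
  Grading.isInternal_map V.deg_internal f hf fun x hx p => by
    rw [proj_deg_eq]; exact hker x hx _

lemma isInternal_map_wt : DirectSum.IsInternal fun k => (V.wt k).map f :=
  Grading.isInternal_map V.isInternal_wt f hf fun x hx p => by
    rw [proj_wt_eq]; exact hker x hx _

lemma isInternal_map_bi :
    DirectSum.IsInternal fun i : ℤ × ℤ => (V.deg i.1).map f ⊓ (V.wt i.2).map f := by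
  have : ∀ i : ℤ × ℤ, (V.deg i.1).map f ⊓ (V.wt i.2).map f = (V.bi i).map f := fun i => by
    rw [deg_eq, wt_eq, Grading.map_supp_inf V.bi_internal hker, ← bi_eq_supp]
  simp only [this]
  exact Grading.isInternal_map V.bi_internal f hf fun x hx i => hker x hx _

end Image

/-- Replacing u by L(-1) u turns uₙ into -n uₙ₋₁, and n ≠ 0 can be divided out, so lower modes
follow inductively from the mode -2. -/
lemma mode_mem_C2 (u v : X) (n : ℤ) (hn : n ≤ -2) : mode V.Y u n v ∈ V.C2 := by
  obtain ⟨j, rfl⟩ : ∃ j : ℕ, n = -2 - j := ⟨(-2 - n).toNat, by omega⟩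
  induction j generalizing u with
  | zero => exact Submodule.subset_span ⟨u, v, by simp⟩
  | succ j ih =>
    have h := ih (mode V.Y u (-2) V.vac) (by omega)
    rw [V.mode_translate] at h
    have hj : (-((-2 - (j : ℤ) : ℤ) : ℂ)) ≠ 0 := by
      rw [← Int.cast_neg, Int.cast_ne_zero]
      omega
    have := (Submodule.smul_mem_iff _ hj).1 h
    rwa [show (-2 : ℤ) - ((j + 1 : ℕ) : ℤ) = -2 - j - 1 by push_cast; ring]

lemma C2_le {P : Submodule ℂ X} (H : ∀ i j, ∀ u ∈ V.bi i, ∀ v ∈ V.bi j,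
    mode V.Y u (-2) v ∈ P) : V.C2 ≤ P := by
  refine Submodule.span_le.2 ?_
  rintro _ ⟨u, v, rfl⟩
  exact V.bilin_mem (modeₗ V.Y (-2)) P H u v

lemma proj_mem_C2 (S : Set (ℤ × ℤ)) {x : X} (hx : x ∈ V.C2) :
    Grading.proj V.bi_internal S x ∈ V.C2 := by
  refine V.C2_le (P := V.C2.comap (Grading.proj V.bi_internal S)) (fun i j u hu v hv => ?_) hx
  rw [Submodule.mem_comap]
  have h := V.mode_mem_bi hu hv (-2)
  by_cases hS : (i.1 + j.1 - 2 * -2 - 2, i.2 + j.2 - 2 * -2 - 2) ∈ S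
  · rw [Grading.proj_of_mem V.bi_internal h hS]
    exact V.mode_mem_C2 u v _ le_rfl
  · rw [Grading.proj_of_notMem V.bi_internal h hS]
    exact zero_mem _

/-- The operator u₀ is a derivation of every n-th product. For n = 0 this is the Jacobi identity and
for n = -1 the Leibniz rule of the bracket on R(V), both valid before passing to the quotient. -/
lemma commutator_zero {p q : ℤ} {u v : X} (hu : u ∈ V.deg p) (hv : v ∈ V.deg q) (n : ℤ) (w : X) :
    mode V.Y u 0 (mode V.Y v n w) - (-1 : ℂ) ^ (p * q) • mode V.Y v n (mode V.Y u 0 w)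
      = mode V.Y (mode V.Y u 0 v) n w := by
  rw [V.commutator hu hv, finsum_eq_single _ 0 (fun i hi => by
    rw [Int.cast_zero, Ring.choose_zero_pos ℂ (Nat.pos_of_ne_zero hi), zero_smul])]
  simp

/-- The operations on `X` that induce those of the `C₂`-algebra. -/
def c2Ops : PoissonData X where
  one := V.vac
  mul := modeₗ V.Y (-1)
  d := V.d
  bracket := modeₗ V.Y 0

lemma d_mem_C2 {x : X} (hx : x ∈ V.C2) : V.d x ∈ V.C2 := by
  refine V.C2_le (P := V.C2.comap V.d) (fun i j u hu v hv => ?_) hx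
  rw [Submodule.mem_comap, V.d_Y _ _ u hu.1]
  exact add_mem (V.mode_mem_C2 _ _ _ le_rfl) (Submodule.smul_mem _ _ (V.mode_mem_C2 _ _ _ le_rfl))

/-- Commuting uₙ past v₋₂ produces corrections with outer mode n - 2 - i, which is at most -2 for
these n. -/
lemma mode_C2_right (n : ℤ) (hn : n = -1 ∨ n = 0) (u : X) {x : X} (hx : x ∈ V.C2) :
    mode V.Y u n x ∈ V.C2 := by
  have key : ∀ i, ∀ u ∈ V.bi i, ∀ x ∈ V.C2, mode V.Y u n x ∈ V.C2 := by
    intro i u hu x hx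
    refine V.C2_le (P := V.C2.comap (mode V.Y u n)) (fun j k v hv w hw => ?_) hx
    rw [Submodule.mem_comap]
    have h := V.commutator hu.1 hv.1 n (-2) w
    rw [sub_eq_iff_eq_add] at h
    rw [h]
    refine add_mem ?_ (Submodule.smul_mem _ _ (V.mode_mem_C2 _ _ _ le_rfl))
    rcases hn with rfl | rfl
    · exact finsum_mem_of_forall fun i => Submodule.smul_mem _ _
        (V.mode_mem_C2 _ _ _ (by omega))
    · exact finsum_mem_of_forall fun i => Submodule.smul_mem _ _
        (V.mode_mem_C2 _ _ _ (by omega))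
  exact Grading.mem_of_proj_mem V.bi_internal (P := V.C2.comap ((modeₗ V.Y n).flip x)) fun i =>
    key i _ (Grading.proj_singleton_mem V.bi_internal i u) x hx

/-- Expanding (u₋₂ v)ₙ by the associator formula leaves outer modes -2 - i and n - 2 - i, all at
most -2. -/
lemma mode_C2_left (n : ℤ) (hn : n ≤ 0) (w : X) {x : X} (hx : x ∈ V.C2) :
    mode V.Y x n w ∈ V.C2 := by
  refine V.C2_le (P := V.C2.comap ((modeₗ V.Y n).flip w)) (fun j k u hu v hv => ?_) hx
  rw [Submodule.mem_comap, LinearMap.flip_apply, modeₗ_apply, ← V.associator hu.1 hv.1]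
  exact finsum_mem_of_forall fun i => Submodule.smul_mem _ _ (sub_mem
    (V.mode_mem_C2 _ _ _ (by omega)) (Submodule.smul_mem _ _ (V.mode_mem_C2 _ _ _ (by omega))))

lemma kerStable_c2Ops : KerStable V.c2Ops V.C2.mkQ where
  d a ha := by
    simp only [Submodule.mkQ_apply, Submodule.Quotient.mk_eq_zero] at ha ⊢
    exact V.d_mem_C2 ha
  mul_left a b ha := by
    simp only [Submodule.mkQ_apply, Submodule.Quotient.mk_eq_zero] at ha ⊢
    exact V.mode_C2_left _ (by norm_num) b ha
  mul_right a b ha := by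
    simp only [Submodule.mkQ_apply, Submodule.Quotient.mk_eq_zero] at ha ⊢
    exact V.mode_C2_right _ (by norm_num) a ha
  bracket_left a b ha := by
    simp only [Submodule.mkQ_apply, Submodule.Quotient.mk_eq_zero] at ha ⊢
    exact V.mode_C2_left _ (by norm_num) b ha
  bracket_right a b ha := by
    simp only [Submodule.mkQ_apply, Submodule.Quotient.mk_eq_zero] at ha ⊢
    exact V.mode_C2_right _ (by norm_num) a ha

theorem exists_isC2Structure : ∃ R : PoissonData V.C2Algebra, V.IsC2Structure R := by
  obtain ⟨R, hR, hb⟩ := V.kerStable_c2Ops.exists_image V.C2.mkQ_surjective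
  exact ⟨R, hR.map_one.symm, fun u => (hR.map_d u).symm, fun u v => (hR.map_mul u v).symm,
    fun u v => (hb u v).symm⟩

lemma mul_assoc_C2 {p q : ℤ} {u v : X} (hu : u ∈ V.deg p) (hv : v ∈ V.deg q) (w : X) :
    mode V.Y (mode V.Y u (-1) v) (-1) w - mode V.Y u (-1) (mode V.Y v (-1) w) ∈ V.C2 := by
  rw [← V.associator hu hv]
  obtain ⟨N, hN, hN'⟩ := ((eventually_mode_eq_zero V.Y (-1) v w).and
    (eventually_mode_eq_zero V.Y 0 u w)).exists
  have h := finsum_sub_zero_mem (P := V.C2) (f := fun i : ℕ =>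
    ((-1 : ℂ) ^ i * Ring.choose ((-1 : ℤ) : ℂ) i) •
        (mode V.Y u (-1 - i) (mode V.Y v (-1 + i) w)
          - ((-1 : ℂ) ^ (-1 : ℤ) * (-1 : ℂ) ^ (p * q)) •
            mode V.Y v (-1 + -1 - i) (mode V.Y u i w))) ?_ ?_
  -- The term i = 0 is u₋₁ v₋₁ w plus a multiple of v₋₂ u₀ w, and the latter is in C₂(V) too.
  · convert (add_mem h (Submodule.smul_mem V.C2 (-((-1 : ℂ) ^ (-1 : ℤ) * (-1 : ℂ) ^ (p * q)))
      (V.mode_mem_C2 v (mode V.Y u 0 w) (-2) le_rfl))) using 1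
    simp only [pow_zero, Ring.choose_zero_right, mul_one, one_smul, Nat.cast_zero, sub_zero,
      add_zero]
    rw [show (-1 : ℤ) + -1 = -2 by norm_num]
    module
  · refine Filter.eventually_atTop.2 ⟨N, fun M hM i hi => ?_⟩
    have h1 := hN i (by omega)
    have h2 := hN' i (by omega)
    rw [zero_add] at h2
    simp only [h1, h2, map_zero, smul_zero, sub_zero]
  · exact fun i => Submodule.smul_mem _ _ (sub_mem (V.mode_mem_C2 _ _ _ (by omega))
      (Submodule.smul_mem _ _ (V.mode_mem_C2 _ _ _ (by omega))))

/-- Applied to the vacuum, the commutator of u₋₁ and v₋₁ is a sum of (uᵢ v)₋₂₋ᵢ 1. -/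
lemma mul_comm_C2 {p q : ℤ} {u v : X} (hu : u ∈ V.deg p) (hv : v ∈ V.deg q) :
    mode V.Y u (-1) v - (-1 : ℂ) ^ (p * q) • mode V.Y v (-1) u ∈ V.C2 := by
  have h := V.commutator hu hv (-1) (-1) V.vac
  rw [V.creation, V.creation] at h
  rw [h]
  exact finsum_mem_of_forall fun i => Submodule.smul_mem _ _ (V.mode_mem_C2 _ _ _ (by omega))

/-- The Jacobi identity with l = 1, m = n = -1 on the vacuum: only i = 0 survives on the left, and
it pairs u₀ v with v₀ u; on the right stand (u₁₊ᵢ v)₋₂₋ᵢ 1. -/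
lemma bracket_skew_C2 {p q : ℤ} {u v : X} (hu : u ∈ V.deg p) (hv : v ∈ V.deg q) :
    mode V.Y u 0 v + (-1 : ℂ) ^ (p * q) • mode V.Y v 0 u ∈ V.C2 := by
  have h := V.jacobi p q u hu v hv 1 (-1) (-1) V.vac
  rw [finsum_eq_sum_range (N := 2), Finset.sum_range_succ, Finset.sum_range_one] at h
  · simp only [Nat.cast_zero, Nat.cast_one, sub_zero, add_zero, V.creation, pow_zero,
      Ring.choose_zero_right, one_smul, one_mul, neg_add_cancel,
      V.creation_regular 0 le_rfl, map_zero, smul_zero, zpow_one, neg_mul, neg_smul,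
      sub_neg_eq_add] at h
    rw [h]
    exact finsum_mem_of_forall fun i => Submodule.smul_mem _ _ (V.mode_mem_C2 _ _ _ (by omega))
  · intro i hi
    rw [V.creation_regular _ (by omega), V.creation_regular _ (by omega)]
    simp

theorem isWeightGradedDGPoisson_c2 {R : PoissonData V.C2Algebra} (hR : V.IsC2Structure R) :
    IsWeightGradedDGPoisson R V.c2Deg V.c2Wt := by
  have hsurj := V.C2.mkQ_surjective
  have mk_eq : ∀ {x y : X}, x - y ∈ V.C2 → V.C2.mkQ x = V.C2.mkQ y := fun h =>
    (Submodule.Quotient.eq _).2 h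
  have hker : ∀ x, V.C2.mkQ x = 0 → ∀ S, V.C2.mkQ (Grading.proj V.bi_internal S x) = 0 := by
    intro x hx S
    simp only [Submodule.mkQ_apply, Submodule.Quotient.mk_eq_zero] at hx ⊢
    exact V.proj_mem_C2 S hx
  have deg_mode : ∀ {p q r : ℤ} (n : ℤ), r = p + q - 2 * n - 2 → ∀ {u v : X}, u ∈ V.deg p →
      v ∈ V.deg q → mode V.Y u n v ∈ V.deg r := by
    rintro p q _ n rfl u v hu hv
    exact V.Y_mem p q n u hu v hv
  have wt_mode : ∀ {k l r : ℤ} (n : ℤ), r = k + l - 2 * n - 2 → ∀ {u v : X}, u ∈ V.wt k →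
      v ∈ V.wt l → mode V.Y u n v ∈ V.wt r := by
    rintro k l _ n rfl u v hu hv
    rw [wt_eq] at hu hv
    rw [← Grading.proj_of_mem_supp V.bi_internal hu, ← Grading.proj_of_mem_supp V.bi_internal hv]
    refine V.bilin_mem ((modeₗ V.Y n).compl₁₂ (Grading.proj V.bi_internal {i | i.2 = k})
      (Grading.proj V.bi_internal {i | i.2 = l})) _ (fun i j a ha b hb => ?_) u v
    simp only [LinearMap.compl₁₂_apply, modeₗ_apply]
    by_cases hi : i.2 = k
    · by_cases hj : j.2 = l
      · rw [Grading.proj_of_mem V.bi_internal ha hi, Grading.proj_of_mem V.bi_internal hb hj]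
        have := (V.mode_mem_bi ha hb n).2
        rwa [hi, hj] at this
      · rw [Grading.proj_of_notMem V.bi_internal hb hj, map_zero]
        exact zero_mem _
    · rw [Grading.proj_of_notMem V.bi_internal ha hi, mode_zero_left]
      exact zero_mem _
  refine
    { internal := V.isInternal_map_deg hsurj hker
      wt_internal := V.isInternal_map_wt hsurj hker
      bigrading := V.isInternal_map_bi hsurj hker
      d_mem := ?_
      d_d := ?_
      one_mem := ?_
      mul_mem := ?_
      one_mul := ?_
      mul_one := ?_
      mul_assoc := ?_
      mul_comm := ?_
      d_mul := ?_
      bracket_mem := ?_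
      bracket_skew := ?_
      bracket_jacobi := ?_
      bracket_mul := ?_
      d_bracket := ?_
      d_wt := ?_
      one_wt := ?_
      mul_wt := ?_
      bracket_wt := ?_ }
  · rintro p _ ⟨u, hu, rfl⟩
    exact ⟨_, V.d_mem p u hu, (hR.d u).symm⟩
  · intro a
    obtain ⟨u, rfl⟩ := hsurj a
    rw [hR.d, hR.d, V.d_d, map_zero]
  · exact ⟨_, V.vac_mem, hR.one.symm⟩
  · rintro p q _ ⟨u, hu, rfl⟩ _ ⟨v, hv, rfl⟩
    exact ⟨_, deg_mode (-1) (by ring) hu hv, (hR.mul u v).symm⟩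
  · intro a
    obtain ⟨u, rfl⟩ := hsurj a
    rw [hR.one, hR.mul, V.vacuum, if_pos rfl]
  · intro a
    obtain ⟨u, rfl⟩ := hsurj a
    rw [hR.one, hR.mul, V.creation]
  · intro a b c
    obtain ⟨u, rfl⟩ := hsurj a
    obtain ⟨v, rfl⟩ := hsurj b
    obtain ⟨w, rfl⟩ := hsurj c
    rw [hR.mul, hR.mul, hR.mul, hR.mul]
    have := V.bilin_ext_deg
      (f := ((modeₗ V.Y (-1)).compr₂ ((modeₗ V.Y (-1)).flip w)).compr₂ V.C2.mkQ)
      (g := ((modeₗ V.Y (-1)).compl₂ ((modeₗ V.Y (-1)).flip w)).compr₂ V.C2.mkQ)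
      (fun p q u hu v hv => mk_eq (V.mul_assoc_C2 hu hv w))
    exact LinearMap.congr_fun₂ this u v
  · rintro p q _ ⟨u, hu, rfl⟩ _ ⟨v, hv, rfl⟩
    rw [hR.mul, hR.mul, ← map_smul]
    exact mk_eq (V.mul_comm_C2 hu hv)
  · rintro p _ ⟨u, hu, rfl⟩ b
    obtain ⟨v, rfl⟩ := hsurj b
    rw [hR.mul, hR.d, hR.d, hR.d, hR.mul, hR.mul, V.d_Y p _ u hu, map_add, map_smul]
  · rintro p q _ ⟨u, hu, rfl⟩ _ ⟨v, hv, rfl⟩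
    exact ⟨_, deg_mode 0 (by ring) hu hv, (hR.bracket u v).symm⟩
  · rintro p q _ ⟨u, hu, rfl⟩ _ ⟨v, hv, rfl⟩
    rw [hR.bracket, hR.bracket, ← map_smul, ← map_neg]
    exact mk_eq (by rw [sub_neg_eq_add]; exact V.bracket_skew_C2 hu hv)
  · rintro p q _ ⟨u, hu, rfl⟩ _ ⟨v, hv, rfl⟩ c
    obtain ⟨w, rfl⟩ := hsurj c
    rw [hR.bracket, hR.bracket, hR.bracket, hR.bracket, hR.bracket, hR.bracket,
      ← V.commutator_zero hu hv, map_sub, map_smul]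
  · rintro p q _ ⟨u, hu, rfl⟩ _ ⟨v, hv, rfl⟩ c
    obtain ⟨w, rfl⟩ := hsurj c
    rw [hR.bracket, hR.bracket, hR.mul, hR.mul, hR.bracket, hR.mul,
      ← V.commutator_zero hu hv, map_sub, map_smul, sub_add_cancel]
  · rintro p _ ⟨u, hu, rfl⟩ b
    obtain ⟨v, rfl⟩ := hsurj b
    rw [hR.bracket, hR.d, hR.d, hR.d, hR.bracket, hR.bracket, V.d_Y p _ u hu, map_add, map_smul]
  · rintro k _ ⟨u, hu, rfl⟩
    exact ⟨_, V.d_mem_wt hu, (hR.d u).symm⟩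
  · exact ⟨_, V.vac_mem_bi.2, hR.one.symm⟩
  · rintro p q _ ⟨u, hu, rfl⟩ _ ⟨v, hv, rfl⟩
    exact ⟨_, wt_mode (-1) (by ring) hu hv, (hR.mul u v).symm⟩
  · rintro p q _ ⟨u, hu, rfl⟩ _ ⟨v, hv, rfl⟩
    exact ⟨_, wt_mode 0 (by ring) hu hv, (hR.bracket u v).symm⟩

end DGVertexOperatorAlgebra

end

/-! ### The Zhu algebra -/

section

open PowerSeries

variable {X : Type*} [AddCommGroup X] [Module ℂ X]

lemma pmode_sub_mode_mem {Y : X →ₗ[ℂ] VertexOperator ℂ X} {n : ℤ} {p : ℂ⟦X⟧} {u v : X}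
    {P : Submodule ℂ X} (hp : coeff 0 p = 1) (h : ∀ i : ℕ, mode Y u (n + (i + 1 : ℕ)) v ∈ P) :
    pmode Y n p u v - mode Y u n v ∈ P := by
  have := finsum_sub_zero_mem (P := P) (f := fun i : ℕ => coeff i p • mode Y u (n + i) v)
    ((eventually_mode_eq_zero Y n u v).mono fun N hN i hi => by rw [hN i hi, smul_zero])
    (fun i => P.smul_mem _ (h i))
  rwa [hp, one_smul, Nat.cast_zero, add_zero, ← pmode_apply] at this

lemma coeff_zero_bin (a : ℂ) : coeff 0 (bin a) = 1 := by
  rw [coeff_bin, Ring.choose_zero_right]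

namespace DGVertexAlgebra

variable (V : DGVertexAlgebra X)

lemma d_pmode {p : ℤ} {u : X} (hu : u ∈ V.deg p) (n : ℤ) (f : ℂ⟦X⟧) (v : X) :
    V.d (pmode V.Y n f u v)
      = pmode V.Y n f (V.d u) v + (-1 : ℂ) ^ p • pmode V.Y n f u (V.d v) := by
  obtain ⟨N, h1, h2, h3⟩ := ((eventually_mode_eq_zero V.Y n u v).and
    ((eventually_mode_eq_zero V.Y n (V.d u) v).and
      (eventually_mode_eq_zero V.Y n u (V.d v)))).exists
  rw [pmode_eq_sum _ _ _ _ _ h1, pmode_eq_sum _ _ _ _ _ h2, pmode_eq_sum _ _ _ _ _ h3, map_sum,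
    Finset.smul_sum, ← Finset.sum_add_distrib]
  refine Finset.sum_congr rfl fun i _ => ?_
  rw [map_smul, V.d_Y p _ u hu, smul_add, smul_comm]

lemma pmode_vac {f : ℂ⟦X⟧} (hf : coeff 0 f = 1) (u : X) : pmode V.Y (-1) f u V.vac = u := by
  have := pmode_sub_mode_mem (P := ⊥) (Y := V.Y) (n := -1) (u := u) (v := V.vac) hf
    (fun i => by rw [V.creation_regular _ (by omega)]; exact zero_mem _)
  rwa [V.creation, Submodule.mem_bot, sub_eq_zero] at this

end DGVertexAlgebra

namespace DGVertexOperatorAlgebra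

variable (V : DGVertexOperatorAlgebra X)

/-- The sum of the components whose bidegree is obtained from `i` by lowering the degree and twice
the weight by the same nonnegative even integer. -/
def low (i : ℤ × ℤ) : Submodule ℂ X :=
  Grading.supp V.bi {j | ∃ t : ℕ, j = (i.1 - 2 * t, i.2 - 2 * t)}

lemma mem_low {i j : ℤ × ℤ} (t : ℕ) (hj : j = (i.1 - 2 * t, i.2 - 2 * t)) {x : X}
    (hx : x ∈ V.bi j) : x ∈ V.low i :=
  Grading.mem_supp (G := V.bi) (show j ∈ {j | ∃ t : ℕ, j = (i.1 - 2 * t, i.2 - 2 * t)} from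
    ⟨t, hj⟩) hx

lemma mode_mem_low {i j k : ℤ × ℤ} {u v : X} (hu : u ∈ V.bi i) (hv : v ∈ V.bi j) (n : ℤ)
    (t : ℕ) (h1 : k.1 - 2 * t = i.1 + j.1 - 2 * n - 2) (h2 : k.2 - 2 * t = i.2 + j.2 - 2 * n - 2) :
    mode V.Y u n v ∈ V.low k :=
  V.mem_low t (Prod.ext h1.symm h2.symm) (V.mode_mem_bi hu hv n)

lemma pmode_mem_low {i j k : ℤ × ℤ} {u v : X} (hu : u ∈ V.bi i) (hv : v ∈ V.bi j) (n : ℤ)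
    (f : ℂ⟦X⟧) (h1 : k.1 = i.1 + j.1 - 2 * n - 2) (h2 : k.2 = i.2 + j.2 - 2 * n - 2) :
    pmode V.Y n f u v ∈ V.low k :=
  pmode_mem fun t _ => V.mode_mem_low hu hv _ t (by omega) (by omega)

lemma pmode_sub_mem_low {i j k : ℤ × ℤ} {u v : X} (hu : u ∈ V.bi i) (hv : v ∈ V.bi j) (n : ℤ)
    {f : ℂ⟦X⟧} (hf : coeff 0 f = 1) (h1 : k.1 = i.1 + j.1 - 2 * n - 4)
    (h2 : k.2 = i.2 + j.2 - 2 * n - 4) :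
    pmode V.Y n f u v - mode V.Y u n v ∈ V.low k :=
  pmode_sub_mode_mem hf fun t => V.mode_mem_low hu hv _ t (by push_cast; omega)
    (by push_cast; omega)

/-- The bilinear map `(u, v) ↦ Res xⁿ (1 + x)^(wt u) Y(u, x) v`. -/
def zhuMode (n : ℤ) : X →ₗ[ℂ] X →ₗ[ℂ] X :=
  DirectSum.toModule ℂ ℤ _ (fun k => pmode V.Y n (bin ((k : ℂ) / 2)) ∘ₗ (V.wt k).subtype) ∘ₗ
    (Grading.equiv V.isInternal_wt).toLinearMap

lemma zhuMode_of_mem {k : ℤ} {u : X} (hu : u ∈ V.wt k) (n : ℤ) (v : X) :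
    V.zhuMode n u v = pmode V.Y n (bin ((k : ℂ) / 2)) u v := by
  simp [zhuMode, Grading.equiv_of_mem V.isInternal_wt hu]

lemma star_eq (k : ℤ) (u v : X) : V.star k u v = pmode V.Y (-1) (bin ((k : ℂ) / 2)) u v := by
  rw [star, pmode_apply]
  refine finsum_congr fun i => ?_
  rw [coeff_bin, sub_eq_neg_add]

lemma circ_eq (k : ℤ) (u v : X) : V.circ k u v = pmode V.Y (-2) (bin ((k : ℂ) / 2)) u v := by
  rw [circ, pmode_apply]
  refine finsum_congr fun i => ?_
  rw [coeff_bin, sub_eq_neg_add]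

/-- The formula for u ∘ v depends on the weight of u. Its bilinear extension `zhuMode` allows a
reduction to vectors that are homogeneous for the degree as well. -/
lemma O_le {P : Submodule ℂ X} (H : ∀ i j, ∀ u ∈ V.bi i, ∀ v ∈ V.bi j,
    pmode V.Y (-2) (bin ((i.2 : ℂ) / 2)) u v ∈ P) : V.O ≤ P := by
  refine Submodule.span_le.2 ?_
  rintro _ ⟨k, u, hu, v, rfl⟩
  rw [circ_eq, ← V.zhuMode_of_mem hu]
  refine V.bilin_mem _ P (fun i j u hu v hv => ?_) u v
  rw [V.zhuMode_of_mem hu.2]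
  exact H i j u hu v hv

/-! ### Residues in O(V), and O(V) as a two-sided ideal -/

lemma coeff_bin_translate (a n : ℂ) (i : ℕ) :
    (n + i) * Ring.choose (a + 1) i
      = n * Ring.choose a i + (n + a + 1) * coeff i (PowerSeries.X * bin a) := by
  cases i with
  | zero => simp
  | succ i =>
    rw [coeff_succ_X_mul, coeff_bin]
    have h1 := Ring.choose_succ_succ a i
    have h2 := Ring.choose_smul_choose (a + 1) (show 1 ≤ i + 1 by omega)
    rw [Nat.choose_one_right, Ring.choose_one_right, nsmul_eq_mul, Nat.cast_one,
      add_sub_cancel_right, Nat.add_sub_cancel] at h2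
    linear_combination h2 + n * h1

/-- Integration by parts: Y(L(-1) u, x) is the derivative of Y(u, x), and -d/dx (xⁿ (1 + x)^(a+1))
is expanded in multiples of (1 + x)^a. -/
lemma pmode_translate (a : ℂ) (n : ℤ) (u v : X) :
    pmode V.Y n (bin (a + 1)) (mode V.Y V.omega 0 u) v
      = -((n : ℂ) • pmode V.Y (n - 1) (bin a) u v + (n + a + 1) • pmode V.Y n (bin a) u v) := by
  have h := pmode_X_mul V.Y (n - 1) (bin a) u v
  rw [sub_add_cancel] at h
  have e : -((n : ℂ) • pmode V.Y (n - 1) (bin a) u v + (n + a + 1) • pmode V.Y n (bin a) u v)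
      = pmode V.Y (n - 1) (-((n : ℂ) • bin a + (n + a + 1) • (PowerSeries.X * bin a))) u v := by
    rw [← h]
    simp only [map_neg, map_add, map_smul, LinearMap.neg_apply, LinearMap.add_apply,
      LinearMap.smul_apply]
  rw [e, pmode_apply, pmode_apply]
  refine finsum_congr fun i => ?_
  rw [mode_omega_zero_mode, smul_smul, coeff_bin, show n - 1 + (i : ℤ) = n + i - 1 by ring]
  congr 1
  have := coeff_bin_translate a n i
  simp only [map_neg, map_add, PowerSeries.coeff_smul, coeff_bin, smul_eq_mul]
  push_cast
  linear_combination -this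

/-- L(-1) raises the weight by one, so `pmode_translate` expresses a residue for L(-1) u through
those for u at n - 1 and n. The coefficient n of the former is nonzero, which gives the descent in
n. -/
lemma pmode_mem_O {k : ℤ} {u : X} (hu : u ∈ V.wt k) (v : X) {n : ℤ} (hn : n ≤ -2) :
    pmode V.Y n (bin ((k : ℂ) / 2)) u v ∈ V.O := by
  obtain ⟨j, rfl⟩ : ∃ j : ℕ, n = -2 - j := ⟨(-2 - n).toNat, by omega⟩
  have omega_wt : ∀ {k : ℤ} {u : X}, u ∈ V.wt k → mode V.Y V.omega 0 u ∈ V.wt (k + 2) := by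
    intro k u hu
    rw [wt_eq] at hu
    rw [← Grading.proj_of_mem_supp V.bi_internal hu]
    refine Grading.mem_of_proj_mem V.bi_internal (P := (V.wt (k + 2)).comap
      (mode V.Y V.omega 0 ∘ₗ Grading.proj V.bi_internal {i | i.2 = k})) fun i => ?_
    have hi := Grading.proj_singleton_mem V.bi_internal i u
    rw [Submodule.mem_comap, LinearMap.comp_apply]
    by_cases h : i.2 = k
    · rw [Grading.proj_of_mem V.bi_internal hi h]
      have := (V.mode_mem_bi (i := (4, 4)) ⟨V.omega_mem, V.omega_weight⟩ hi 0).2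
      rw [← h, show i.2 + 2 = 4 + i.2 - 2 * 0 - 2 by ring]
      exact this
    · rw [Grading.proj_of_notMem V.bi_internal hi h, map_zero]
      exact zero_mem _
  induction j generalizing k u with
  | zero => exact Submodule.subset_span ⟨k, u, hu, v, by rw [circ_eq]; simp⟩
  | succ j ih =>
    have h1 := ih hu (by omega)
    have h2 := ih (omega_wt hu) (by omega)
    rw [show (((k + 2 : ℤ) : ℂ) / 2) = (k : ℂ) / 2 + 1 by push_cast; ring, V.pmode_translate,
      neg_mem_iff] at h2
    have h3 := (Submodule.add_mem_iff_left _ (Submodule.smul_mem _ _ h1)).1 h2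
    have hj : ((-2 - (j : ℤ) : ℤ) : ℂ) ≠ 0 := by
      rw [Int.cast_ne_zero]
      omega
    have := (Submodule.smul_mem_iff _ hj).1 h3
    rwa [show (-2 : ℤ) - ((j + 1 : ℕ) : ℤ) = -2 - j - 1 by push_cast; ring]

/-- The extra factor (1 + x)^e spreads xⁿ over exponents n, ..., n + e, all still at most -2. -/
lemma pmode_pow_mem_O {k : ℤ} {u : X} (hu : u ∈ V.wt k) (v : X) (e : ℕ) {n : ℤ}
    (hn : n + e ≤ -2) :
    pmode V.Y n ((1 + PowerSeries.X) ^ e * bin ((k : ℂ) / 2)) u v ∈ V.O := by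
  induction e generalizing n with
  | zero => simpa using V.pmode_mem_O hu v (by simpa using hn)
  | succ e ih =>
    rw [pow_succ', mul_assoc, pmode_one_add_X_mul]
    push_cast at hn
    exact add_mem (ih (by omega)) (ih (by omega))

/-- Here the top exponent n + e is -1, so exactly one term escapes O(V). -/
lemma pmode_pow_sub_mem_O {k : ℤ} {u : X} (hu : u ∈ V.wt k) (v : X) (e : ℕ) {n : ℤ}
    (hn : n + e = -1) :
    pmode V.Y n ((1 + PowerSeries.X) ^ e * bin ((k : ℂ) / 2)) u v
      - pmode V.Y (-1) (bin ((k : ℂ) / 2)) u v ∈ V.O := by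
  induction e generalizing n with
  | zero =>
    obtain rfl : n = -1 := by simpa using hn
    simp
  | succ e ih =>
    rw [pow_succ', mul_assoc, pmode_one_add_X_mul, add_sub_assoc]
    push_cast at hn
    exact add_mem (V.pmode_pow_mem_O hu v e (by omega)) (ih (by omega))

/-- With A = wt u and B = wt v, the hypothesis says that k / 2 is the weight of the I-th product of
u and v. Each summand then carries the matching power of 1 + x times (1 + x)^(I+1-t), as the two
preceding lemmas require. -/
lemma pmode_dividedDeriv {A B : ℂ} {k : ℤ} (I : ℕ) (hk : (k : ℂ) / 2 = A + B - I - 1) (m : ℂ)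
    (n : ℤ) (u v : X) :
    pmode V.Y n (dividedDeriv m I (bin A) * bin B) u v
      = ∑ t ∈ Finset.range (I + 1), (Ring.choose m (I - t) * Ring.choose A t) •
          pmode V.Y (n + t) ((1 + PowerSeries.X) ^ (I + 1 - t) * bin ((k : ℂ) / 2)) u v := by
  rw [dividedDeriv_bin, Finset.sum_mul, map_sum, LinearMap.sum_apply, LinearMap.sum_apply]
  refine Finset.sum_congr rfl fun t ht => ?_
  have ht : t ≤ I + 1 := (Finset.mem_range.1 ht).le
  rw [smul_mul_assoc, map_smul, LinearMap.smul_apply, LinearMap.smul_apply, mul_assoc,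
    pmode_X_pow_mul, ← binomialSeries_add, ← bin_add_natCast, hk]
  congr 5
  rw [Nat.cast_sub ht]
  push_cast
  ring

/-- The super commutator of u ∗ and v ∘ is a sum of residues with n + e = (-3 - I + t) + (I + 1 - t)
= -2, so it lies in O(V). -/
lemma zhuMode_O_right (u : X) {x : X} (hx : x ∈ V.O) : V.zhuMode (-1) u x ∈ V.O := by
  refine Grading.mem_of_proj_mem V.bi_internal (P := V.O.comap ((V.zhuMode (-1)).flip x))
    fun i => ?_
  have hu := Grading.proj_singleton_mem V.bi_internal i u
  refine V.O_le (P := V.O.comap (V.zhuMode (-1) (Grading.proj V.bi_internal {i} u)))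
    (fun j k v hv w hw => ?_) hx
  generalize Grading.proj V.bi_internal {i} u = u at hu
  rw [Submodule.mem_comap, V.zhuMode_of_mem hu.2]
  have h := V.jacobi_pmode hu.1 hv.1 (bin ((i.2 : ℂ) / 2)) (bin ((j.2 : ℂ) / 2)) 0 (-1) (-2) w
  rw [finsum_eq_single _ 0 (fun i hi => by
    rw [Int.cast_zero, Ring.choose_zero_pos ℂ (Nat.pos_of_ne_zero hi), mul_zero, zero_smul])] at h
  simp only [pow_zero, Int.cast_zero, Ring.choose_zero_right, mul_one, one_smul, Nat.cast_zero,
    add_zero, sub_zero, zpow_zero, one_mul, zero_add] at h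
  rw [sub_eq_iff_eq_add] at h
  rw [h]
  refine add_mem (finsum_mem_of_forall fun I => ?_)
    (Submodule.smul_mem _ _ (V.pmode_mem_O hv.2 _ le_rfl))
  have hc := (V.mode_mem_bi hu hv I).2
  rw [V.pmode_dividedDeriv I (k := i.2 + j.2 - 2 * I - 2) (by push_cast; ring)]
  refine Submodule.sum_mem _ fun t ht => Submodule.smul_mem _ _ (V.pmode_pow_mem_O hc _ _ ?_)
  have := Finset.mem_range.1 ht
  omega

lemma zhuMode_O_left (w : X) {x : X} (hx : x ∈ V.O) : V.zhuMode (-1) x w ∈ V.O := by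
  refine V.O_le (P := V.O.comap ((V.zhuMode (-1)).flip w)) (fun i j u hu v hv => ?_) hx
  rw [Submodule.mem_comap, LinearMap.flip_apply]
  -- The additional factor 1 + x compensates the mode -2: u₋₂₊ᵢ v has weight wt u + wt v + 1 - i, so
  -- the right side becomes (u ∘ v) ∗ w. On the left this factor is harmless, as v then occurs with
  -- exponents at most -3.
  have h := V.jacobi_pmode hu.1 hv.1 (bin ((i.2 : ℂ) / 2)) (bin ((j.2 : ℂ) / 2 + (1 : ℕ)))
    (-2) 0 (-1) w
  have hR : V.zhuMode (-1) (pmode V.Y (-2) (bin ((i.2 : ℂ) / 2)) u v) w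
      = ∑ᶠ I : ℕ, pmode V.Y (0 + -1 - I) (dividedDeriv ((0 : ℤ) : ℂ) I (bin ((i.2 : ℂ) / 2)) *
          bin ((j.2 : ℂ) / 2 + (1 : ℕ))) (mode V.Y u (-2 + I) v) w := by
    obtain ⟨N, hN⟩ := (eventually_mode_eq_zero V.Y (-2) u v).exists
    rw [finsum_eq_sum_range (N := N) (fun I hI => by
      rw [hN I hI, map_zero, LinearMap.zero_apply]), pmode_eq_sum _ _ _ _ _ hN, map_sum,
      LinearMap.sum_apply]
    refine Finset.sum_congr rfl fun I _ => ?_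
    rw [map_smul, LinearMap.smul_apply, V.zhuMode_of_mem (V.mode_mem_bi hu hv _).2, coeff_bin,
      Int.cast_zero, dividedDeriv_zero_bin, smul_mul_assoc, map_smul, LinearMap.smul_apply,
      LinearMap.smul_apply, mul_assoc, pmode_X_pow_mul, ← binomialSeries_add]
    congr 5
    · ring
    · push_cast
      ring
  rw [hR, ← h]
  refine finsum_mem_of_forall fun I => Submodule.smul_mem _ _ (sub_mem ?_
    (Submodule.smul_mem _ _ ?_))
  · exact V.pmode_mem_O hu.2 _ (by omega)
  · rw [bin_add_natCast]
    exact V.pmode_pow_mem_O hv.2 _ 1 (by push_cast; omega)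

lemma d_mem_O {x : X} (hx : x ∈ V.O) : V.d x ∈ V.O := by
  refine V.O_le (P := V.O.comap V.d) (fun i j u hu v hv => ?_) hx
  rw [Submodule.mem_comap, V.d_pmode hu.1]
  exact add_mem (V.pmode_mem_O (V.d_mem_wt hu.2) _ le_rfl)
    (Submodule.smul_mem _ _ (V.pmode_mem_O hu.2 _ le_rfl))

/-- The operations on `X` that induce those of the Zhu algebra, with zero bracket. -/
def zhuOps : PoissonData X where
  one := V.vac
  mul := V.zhuMode (-1)
  d := V.d
  bracket := 0

lemma kerStable_zhuOps : KerStable V.zhuOps V.O.mkQ where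
  d a ha := by
    simp only [Submodule.mkQ_apply, Submodule.Quotient.mk_eq_zero] at ha ⊢
    exact V.d_mem_O ha
  mul_left a b ha := by
    simp only [Submodule.mkQ_apply, Submodule.Quotient.mk_eq_zero] at ha ⊢
    exact V.zhuMode_O_left b ha
  mul_right a b ha := by
    simp only [Submodule.mkQ_apply, Submodule.Quotient.mk_eq_zero] at ha ⊢
    exact V.zhuMode_O_right a ha
  bracket_left _ _ _ := map_zero _
  bracket_right _ _ _ := map_zero _

theorem exists_isZhuStructure : ∃ A : AlgData V.Zhu, V.IsZhuStructure A := by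
  obtain ⟨R, hR, -⟩ := V.kerStable_zhuOps.exists_image V.O.mkQ_surjective
  refine ⟨R.toAlgData, hR.map_one.symm, fun u => (hR.map_d u).symm, fun k u hu v => ?_⟩
  rw [star_eq, ← V.zhuMode_of_mem hu]
  exact (hR.map_mul u v).symm

lemma IsZhuStructure.mul_mkQ {V : DGVertexOperatorAlgebra X} {A : AlgData V.Zhu}
    (hA : V.IsZhuStructure A) (u v : X) :
    A.mul (V.O.mkQ u) (V.O.mkQ v) = V.O.mkQ (V.zhuMode (-1) u v) := by
  have : A.mul.compl₁₂ V.O.mkQ V.O.mkQ = (V.zhuMode (-1)).compr₂ V.O.mkQ := by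
    refine Grading.hom_ext V.isInternal_wt fun k u hu => LinearMap.ext fun v => ?_
    simp only [LinearMap.compl₁₂_apply, LinearMap.compr₂_apply]
    rw [hA.mul k u hu, star_eq, ← V.zhuMode_of_mem hu]
  exact LinearMap.congr_fun₂ this u v

/-- The super commutator of bihomogeneous vectors for the product of the Zhu algebra is `u₀ v` up to
lower terms. -/
lemma zhuMode_commutator {i j : ℤ × ℤ} {u v : X} (hu : u ∈ V.bi i) (hv : v ∈ V.bi j) :
    V.zhuMode (-1) u v - (-1 : ℂ) ^ (i.1 * j.1) • V.zhuMode (-1) v u - mode V.Y u 0 v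
      ∈ V.O ⊔ V.low (i.1 + j.1 - 4, i.2 + j.2 - 4) := by
  -- On the vacuum the inner smeared modes return u and v, so the left side is the super commutator
  -- itself.
  have h := V.jacobi_pmode hu.1 hv.1 (bin ((i.2 : ℂ) / 2)) (bin ((j.2 : ℂ) / 2)) 0 (-1) (-1) V.vac
  rw [finsum_eq_single _ 0 (fun i hi => by
    rw [Int.cast_zero, Ring.choose_zero_pos ℂ (Nat.pos_of_ne_zero hi), mul_zero, zero_smul])] at h
  simp only [pow_zero, Int.cast_zero, Ring.choose_zero_right, mul_one, one_smul, Nat.cast_zero,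
    add_zero, sub_zero, zpow_zero, one_mul, zero_add, V.pmode_vac (coeff_zero_bin _)] at h
  rw [V.zhuMode_of_mem hu.2, V.zhuMode_of_mem hv.2, h]
  -- Every residue has total exponent -1 and so reduces to uᵢ v modulo O(V). The coefficients would
  -- sum to C(wt u - 1, I), but only the one for I = 0, which is 1, matters; the terms with I ≥ 1
  -- are lower.
  have key : ∀ I : ℕ, ∀ t ∈ Finset.range (I + 1),
      pmode V.Y (-1 + -1 - (I : ℤ) + t) ((1 + PowerSeries.X) ^ (I + 1 - t) *
        bin (((i.2 + j.2 - 2 * I - 2 : ℤ) : ℂ) / 2)) (mode V.Y u I v) V.vac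
        - mode V.Y u I v ∈ V.O := by
    intro I t ht
    have ht := Finset.mem_range.1 ht
    have := V.pmode_pow_sub_mem_O (V.mode_mem_bi hu hv I).2 V.vac (I + 1 - t)
      (n := -1 + -1 - (I : ℤ) + t) (by omega)
    rwa [V.pmode_vac (coeff_zero_bin _)] at this
  have hdd : ∀ I : ℕ, pmode V.Y (-1 + -1 - (I : ℤ)) (dividedDeriv ((-1 : ℤ) : ℂ) I
      (bin ((i.2 : ℂ) / 2)) * bin ((j.2 : ℂ) / 2)) (mode V.Y u I v) V.vac = _ := fun I =>
    V.pmode_dividedDeriv I (k := i.2 + j.2 - 2 * I - 2) (by push_cast; ring) _ _ _ _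
  simp only [hdd]
  have hfin : ∀ᶠ N : ℕ in Filter.atTop, ∀ I ≥ N,
      ∑ t ∈ Finset.range (I + 1), (Ring.choose ((-1 : ℤ) : ℂ) (I - t) *
        Ring.choose ((i.2 : ℂ) / 2) t) • pmode V.Y (-1 + -1 - (I : ℤ) + t)
        ((1 + PowerSeries.X) ^ (I + 1 - t) * bin (((i.2 + j.2 - 2 * I - 2 : ℤ) : ℂ) / 2))
        (mode V.Y u I v) V.vac = 0 := by
    refine (eventually_mode_eq_zero V.Y 0 u v).mono fun N hN I hI => ?_
    have := hN I hI
    rw [zero_add] at this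
    simp [this]
  have h0 := finsum_sub_zero_mem (P := V.O ⊔ V.low (i.1 + j.1 - 4, i.2 + j.2 - 4)) hfin ?_
  · have h1 := add_mem h0 (Submodule.mem_sup_left (T := V.low (i.1 + j.1 - 4, i.2 + j.2 - 4))
      (key 0 0 (by simp)))
    convert h1 using 1
    rw [Finset.sum_range_one]
    simp only [Nat.sub_self, Ring.choose_zero_right, mul_one, one_smul, Nat.cast_zero]
    abel
  · intro I
    refine Submodule.sum_mem _ fun t ht => Submodule.smul_mem _ _ ?_
    have h2 := V.mode_mem_low (k := (i.1 + j.1 - 4, i.2 + j.2 - 4)) hu hv ((I + 1 : ℕ) : ℤ) I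
      (by push_cast; ring) (by push_cast; ring)
    have := add_mem (Submodule.mem_sup_left (T := V.low (i.1 + j.1 - 4, i.2 + j.2 - 4))
      (key (I + 1) t ht)) (Submodule.mem_sup_right h2)
    rwa [sub_add_cancel] at this

/-- `O(V)` is graded by the orbits of the shift by `(2, 2)`. -/
lemma proj_mem_O {S : Set (ℤ × ℤ)} (hS : ∀ i : ℤ × ℤ, (i.1 - 2, i.2 - 2) ∈ S ↔ i ∈ S) {x : X}
    (hx : x ∈ V.O) : Grading.proj V.bi_internal S x ∈ V.O := by
  have hS' : ∀ (i : ℤ × ℤ) (t : ℕ), (i.1 - 2 * t, i.2 - 2 * t) ∈ S ↔ i ∈ S := by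
    intro i t
    induction t with
    | zero => simp
    | succ t ih =>
      rw [← ih, ← hS (i.1 - 2 * t, i.2 - 2 * t)]
      push_cast
      ring_nf
  refine V.O_le (P := V.O.comap (Grading.proj V.bi_internal S)) (fun i j u hu v hv => ?_) hx
  have h := V.pmode_mem_low (k := (i.1 + j.1 - 2 * -2 - 2, i.2 + j.2 - 2 * -2 - 2)) hu hv (-2)
    (bin ((i.2 : ℂ) / 2)) rfl rfl
  rw [Submodule.mem_comap]
  by_cases hm : (i.1 + j.1 - 2 * -2 - 2, i.2 + j.2 - 2 * -2 - 2) ∈ S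
  · rw [Grading.proj_of_mem_supp V.bi_internal (Grading.supp_mono ?_ h)]
    · exact V.pmode_mem_O hu.2 v le_rfl
    · rintro _ ⟨t, rfl⟩
      exact (hS' _ t).2 hm
  · rw [Grading.proj_eq_zero_of_disjoint V.bi_internal ?_ h]
    · exact zero_mem _
    · rw [Set.eq_empty_iff_forall_notMem]
      rintro _ ⟨h1, t, rfl⟩
      exact hm ((hS' _ t).1 h1)

end DGVertexOperatorAlgebra

end

/-! ### Filtrations of the Zhu algebra and the common kernel -/

section

open PowerSeries

variable {X : Type*} [AddCommGroup X] [Module ℂ X]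

namespace DGVertexOperatorAlgebra

variable (V : DGVertexOperatorAlgebra X)

/-- The image in `A(V)` of the sum of the bihomogeneous components with index in `S`. -/
def fil (S : Set (ℤ × ℤ)) : Submodule ℂ V.Zhu := (Grading.supp V.bi S).map V.O.mkQ

lemma fil_mono {S T : Set (ℤ × ℤ)} (h : S ⊆ T) : V.fil S ≤ V.fil T :=
  Submodule.map_mono (Grading.supp_mono h)

lemma mkQ_mem_fil {S : Set (ℤ × ℤ)} {x : X} (hx : x ∈ Grading.supp V.bi S) :
    V.O.mkQ x ∈ V.fil S := Submodule.mem_map_of_mem hx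

lemma mkQ_mem_fil_iff {S : Set (ℤ × ℤ)} {x : X} :
    V.O.mkQ x ∈ V.fil S ↔ x ∈ V.O ⊔ Grading.supp V.bi S := by
  rw [← Submodule.comap_map_mkQ]
  rfl

lemma mkQ_eq_iff {x y : X} : V.O.mkQ x = V.O.mkQ y ↔ x - y ∈ V.O :=
  Submodule.Quotient.eq _

lemma filtOf_deg (p : ℤ) : filtOf V.deg p = Grading.supp V.bi {i | i.1 ≤ p} := by
  refine le_antisymm (filtOf_le fun q hq => ?_) (Grading.supp_le fun i hi => ?_)
  · rw [deg_eq]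
    refine Grading.supp_mono ?_
    rintro i rfl
    exact hq
  · exact fun x hx => mem_filtOf hi hx.1

lemma filtOf_wt (k : ℤ) : filtOf V.wt k = Grading.supp V.bi {i | i.2 ≤ k} := by
  refine le_antisymm (filtOf_le fun q hq => ?_) (Grading.supp_le fun i hi => ?_)
  · rw [wt_eq]
    refine Grading.supp_mono ?_
    rintro i rfl
    exact hq
  · exact fun x hx => mem_filtOf hi hx.2

lemma zhuF_eq (p : ℤ) : V.zhuF p = V.fil {i | i.1 ≤ p} := by
  rw [fil, ← filtOf_deg]
  rfl

lemma zhuW_eq (k : ℤ) : V.zhuW k = V.fil {i | i.2 ≤ k} := by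
  rw [fil, ← filtOf_wt]
  rfl

/-- The nontrivial inclusion rests on the orbit grading of O(V). Given y of degree at most p and z
of weight at most k with the same class, each orbit can be taken from y or from z, whichever
satisfies both bounds there. -/
lemma zhuF_inf_zhuW (p k : ℤ) : V.zhuF p ⊓ V.zhuW k = V.fil {i | i.1 ≤ p ∧ i.2 ≤ k} := by
  rw [zhuF_eq, zhuW_eq]
  refine le_antisymm ?_ (le_inf (V.fil_mono fun i hi => hi.1) (V.fil_mono fun i hi => hi.2))
  rintro _ ⟨⟨y, hy, rfl⟩, ⟨z, hz, hyz⟩⟩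
  rw [mkQ_eq_iff] at hyz
  -- The difference i.1 - i.2 is constant on orbits. On S the bound on the degree implies that on
  -- the weight; off S it is the other way round.
  set S : Set (ℤ × ℤ) := {i | p - k ≤ i.1 - i.2} with hS
  have hO := V.proj_mem_O (S := S) (fun i => by
    show p - k ≤ i.1 - 2 - (i.2 - 2) ↔ p - k ≤ i.1 - i.2
    omega) hyz
  rw [map_sub] at hO
  have hz' := Grading.proj_add_proj_compl V.bi_internal S z
  have : V.O.mkQ y
      = V.O.mkQ (Grading.proj V.bi_internal S y + Grading.proj V.bi_internal Sᶜ z) := by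
    rw [mkQ_eq_iff]
    have := sub_mem hO hyz
    convert this using 1
    rw [eq_sub_of_add_eq hz']
    abel
  rw [this]
  refine V.mkQ_mem_fil (add_mem (Grading.supp_mono ?_ (Grading.proj_mem_inter V.bi_internal hy))
    (Grading.supp_mono ?_ (Grading.proj_mem_inter V.bi_internal hz)))
  · rintro i ⟨h1, h2⟩
    have h1 : p - k ≤ i.1 - i.2 := h1
    have h2 : i.1 ≤ p := h2
    exact ⟨h2, by omega⟩
  · rintro i ⟨h1, h2⟩
    have h1 : ¬ p - k ≤ i.1 - i.2 := h1
    have h2 : i.2 ≤ k := h2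
    exact ⟨by omega, h2⟩

/-- A bilinear map sends sums of components into a subspace if it does so on components. -/
lemma bilin_supp_mem {N : Type*} [AddCommGroup N] [Module ℂ N] (f : X →ₗ[ℂ] X →ₗ[ℂ] N)
    {P : Submodule ℂ N} {S T : Set (ℤ × ℤ)}
    (H : ∀ i ∈ S, ∀ j ∈ T, ∀ u ∈ V.bi i, ∀ v ∈ V.bi j, f u v ∈ P) {x y : X}
    (hx : x ∈ Grading.supp V.bi S) (hy : y ∈ Grading.supp V.bi T) : f x y ∈ P := by
  refine Grading.supp_le (P := P.comap (f.flip y)) (fun i hi u hu => ?_) hx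
  exact Grading.supp_le (P := P.comap (f u)) (fun j hj v hv => H i hi j hj u hu v hv) hy

lemma low_le_supp {i : ℤ × ℤ} {U : Set (ℤ × ℤ)}
    (h : ∀ t : ℕ, (i.1 - 2 * (t : ℤ), i.2 - 2 * (t : ℤ)) ∈ U) :
    V.low i ≤ Grading.supp V.bi U := by
  refine Grading.supp_mono ?_
  rintro _ ⟨t, rfl⟩
  exact h t

lemma zhuMode_mem_supp {S T U : Set (ℤ × ℤ)}
    (hU : ∀ i ∈ S, ∀ j ∈ T, ∀ t : ℕ, (i.1 + j.1 - 2 * (t : ℤ), i.2 + j.2 - 2 * (t : ℤ)) ∈ U)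
    {x y : X} (hx : x ∈ Grading.supp V.bi S) (hy : y ∈ Grading.supp V.bi T) :
    V.zhuMode (-1) x y ∈ Grading.supp V.bi U := by
  refine V.bilin_supp_mem (V.zhuMode (-1)) (fun i hi j hj u hu v hv => ?_) hx hy
  rw [V.zhuMode_of_mem hu.2]
  exact V.low_le_supp (i := (i.1 + j.1, i.2 + j.2)) (hU i hi j hj)
    (V.pmode_mem_low hu hv _ _ (by ring) (by ring))

lemma zhuMode_sub_mode_mem_supp {S T U : Set (ℤ × ℤ)}
    (hU : ∀ i ∈ S, ∀ j ∈ T, ∀ t : ℕ,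
      (i.1 + j.1 - 2 - 2 * (t : ℤ), i.2 + j.2 - 2 - 2 * (t : ℤ)) ∈ U)
    {x y : X} (hx : x ∈ Grading.supp V.bi S) (hy : y ∈ Grading.supp V.bi T) :
    V.zhuMode (-1) x y - mode V.Y x (-1) y ∈ Grading.supp V.bi U := by
  refine V.bilin_supp_mem (V.zhuMode (-1) - modeₗ V.Y (-1)) (fun i hi j hj u hu v hv => ?_) hx hy
  rw [LinearMap.sub_apply, LinearMap.sub_apply, V.zhuMode_of_mem hu.2]
  exact V.low_le_supp (i := (i.1 + j.1 - 2, i.2 + j.2 - 2)) (hU i hi j hj)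
    (V.pmode_sub_mem_low hu hv _ (coeff_zero_bin _) (by ring) (by ring))

/-- The super commutator with the sign attached to the degrees `p` and `q`. -/
def superComm (p q : ℤ) : X →ₗ[ℂ] X →ₗ[ℂ] X :=
  V.zhuMode (-1) - (-1 : ℂ) ^ (p * q) • (V.zhuMode (-1)).flip

lemma superComm_apply (p q : ℤ) (u v : X) : V.superComm p q u v
    = V.zhuMode (-1) u v - (-1 : ℂ) ^ (p * q) • V.zhuMode (-1) v u := rfl

/-- Lower terms differ in degree by even numbers, so the Koszul sign of the leading bidegree serves
for all of them. This permits one bilinear super commutator on vectors that are not homogeneous. -/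
lemma superComm_sub_mode_mem {p q : ℤ} {S T U : Set (ℤ × ℤ)}
    (hS : ∀ i ∈ S, Even (p - i.1)) (hT : ∀ j ∈ T, Even (q - j.1))
    (hU : ∀ i ∈ S, ∀ j ∈ T, ∀ t : ℕ,
      (i.1 + j.1 - 4 - 2 * (t : ℤ), i.2 + j.2 - 4 - 2 * (t : ℤ)) ∈ U)
    {x y : X} (hx : x ∈ Grading.supp V.bi S) (hy : y ∈ Grading.supp V.bi T) :
    V.superComm p q x y - mode V.Y x 0 y ∈ V.O ⊔ Grading.supp V.bi U := by
  refine V.bilin_supp_mem (V.superComm p q - modeₗ V.Y 0) (fun i hi j hj u hu v hv => ?_) hx hy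
  have hsign : (-1 : ℂ) ^ (p * q) = (-1 : ℂ) ^ (i.1 * j.1) := by
    obtain ⟨a, ha⟩ := hS i hi
    obtain ⟨b, hb⟩ := hT j hj
    have e : p * q = i.1 * j.1 + 2 * (a * q + i.1 * b) := by
      rw [show p = i.1 + (a + a) by omega, show q = j.1 + (b + b) by omega]
      ring
    have h2 : (-1 : ℂ) ^ (2 : ℤ) = 1 := by norm_num
    rw [e, zpow_add₀ (by norm_num), zpow_mul _ 2, h2, one_zpow, mul_one]
  rw [LinearMap.sub_apply, LinearMap.sub_apply, superComm_apply, hsign]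
  exact sup_le_sup_left
    (V.low_le_supp (i := (i.1 + j.1 - 4, i.2 + j.2 - 4)) (hU i hi j hj)) V.O
    (V.zhuMode_commutator hu hv)

/-! ### The common kernel and its stability under the operations of R(V) -/

/-- The vectors whose components become equal in `A(V)` to vectors of lower bidegree. -/
def grKer : Submodule ℂ X :=
  ⨅ i : ℤ × ℤ, (V.O ⊔ V.low (i.1 - 2, i.2 - 2)).comap (Grading.proj V.bi_internal {i})

lemma mem_grKer {x : X} : x ∈ V.grKer ↔
    ∀ i : ℤ × ℤ, Grading.proj V.bi_internal {i} x ∈ V.O ⊔ V.low (i.1 - 2, i.2 - 2) := by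
  simp [grKer, Submodule.mem_iInf]

lemma mem_grKer_of_mem_bi {i : ℤ × ℤ} {x : X} (hx : x ∈ V.bi i)
    (h : x ∈ V.O ⊔ V.low (i.1 - 2, i.2 - 2)) : x ∈ V.grKer := by
  rw [mem_grKer]
  intro j
  by_cases hij : i = j
  · subst hij
    rwa [Grading.proj_self V.bi_internal hx]
  · rw [Grading.proj_of_ne V.bi_internal hx hij]
    exact zero_mem _

lemma proj_singleton_proj (i : ℤ × ℤ) (S : Set (ℤ × ℤ)) (x : X) :
    (i ∈ S ∧ Grading.proj V.bi_internal {i} (Grading.proj V.bi_internal S x)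
      = Grading.proj V.bi_internal {i} x) ∨
    (i ∉ S ∧ Grading.proj V.bi_internal {i} (Grading.proj V.bi_internal S x) = 0) := by
  by_cases hi : i ∈ S
  · left
    rw [Grading.proj_comp, Set.inter_eq_left.2 (by simpa using hi)]
    exact ⟨hi, rfl⟩
  · right
    refine ⟨hi, Grading.proj_eq_zero_of_disjoint V.bi_internal ?_ (Grading.proj_mem _ _ _)⟩
    simpa using hi

lemma proj_mem_grKer (S : Set (ℤ × ℤ)) {x : X} (hx : x ∈ V.grKer) :
    Grading.proj V.bi_internal S x ∈ V.grKer := by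
  rw [mem_grKer] at hx ⊢
  intro i
  rcases V.proj_singleton_proj i S x with ⟨-, h⟩ | ⟨-, h⟩
  · rw [h]; exact hx i
  · rw [h]; exact zero_mem _

/-- The leading term u₋₂ v of u ∘ v ∈ O(V) is minus the sum of the other terms, which are lower. -/
lemma C2_le_grKer : V.C2 ≤ V.grKer := by
  refine V.C2_le fun i j u hu v hv => ?_
  refine V.mem_grKer_of_mem_bi (V.mode_mem_bi hu hv _) ?_
  have h1 := V.pmode_mem_O hu.2 v (le_refl (-2))
  have h2 := V.pmode_sub_mem_low
    (k := (i.1 + j.1 - 2 * -2 - 2 - 2, i.2 + j.2 - 2 * -2 - 2 - 2)) hu hv (-2)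
    (coeff_zero_bin ((i.2 : ℂ) / 2)) (by ring) (by ring)
  have := sub_mem (Submodule.mem_sup_left (T := V.low _) h1) (Submodule.mem_sup_right h2)
  rwa [sub_sub_cancel] at this

lemma d_mem_low {i : ℤ × ℤ} {x : X} (hx : x ∈ V.low i) : V.d x ∈ V.low (i.1 + 1, i.2) := by
  refine Grading.supp_le (P := (V.low (i.1 + 1, i.2)).comap V.d) ?_ hx
  rintro _ ⟨t, rfl⟩ x hx
  exact V.mem_low t (by ext <;> simp; ring) (V.d_mem_bi hx)

lemma d_mem_grKer {x : X} (hx : x ∈ V.grKer) : V.d x ∈ V.grKer := by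
  refine Grading.mem_of_proj_mem V.bi_internal (P := V.grKer.comap V.d) fun i => ?_
  have hu := Grading.proj_singleton_mem V.bi_internal i x
  obtain ⟨o, ho, u', hu', h⟩ := Submodule.mem_sup.1 (V.mem_grKer.1 hx i)
  refine V.mem_grKer_of_mem_bi (V.d_mem_bi hu) ?_
  rw [← h, map_add]
  refine Submodule.add_mem_sup (V.d_mem_O ho) ?_
  have := V.d_mem_low hu'
  rwa [show (i.1 - 2 + 1 : ℤ) = i.1 + 1 - 2 by ring] at this

lemma bilin_mem_grKer {f : X →ₗ[ℂ] X →ₗ[ℂ] X}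
    (H : ∀ i j, ∀ u ∈ V.bi i, u ∈ V.grKer → ∀ v ∈ V.bi j, f u v ∈ V.grKer)
    {x : X} (hx : x ∈ V.grKer) (y : X) : f x y ∈ V.grKer := by
  refine Grading.mem_of_proj_mem V.bi_internal (P := V.grKer.comap (f.flip y)) fun i => ?_
  refine Grading.mem_of_proj_mem V.bi_internal
    (P := V.grKer.comap (f (Grading.proj V.bi_internal {i} x))) fun j => ?_
  exact H i j _ (Grading.proj_singleton_mem V.bi_internal i x) (V.proj_mem_grKer {i} hx) _
    (Grading.proj_singleton_mem V.bi_internal j y)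

lemma exists_lower_of_mem_grKer {i : ℤ × ℤ} {u : X} (hu : u ∈ V.bi i) (h : u ∈ V.grKer) :
    ∃ o ∈ V.O, ∃ u' ∈ V.low (i.1 - 2, i.2 - 2), o + u' = u := by
  have := V.mem_grKer.1 h i
  rw [Grading.proj_self V.bi_internal hu] at this
  exact Submodule.mem_sup.1 this

lemma mem_supp_singleton {j : ℤ × ℤ} {v : X} (hv : v ∈ V.bi j) : v ∈ Grading.supp V.bi {j} :=
  Grading.mem_supp (Set.mem_singleton j) hv

/-- With u = o + u', the product o₋₁ v cannot be controlled directly because o is not homogeneous.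
One goes through ∗ instead: u₋₁ v is u ∗ v up to lower terms, o ∗ v is in O(V), and u' ∗ v is lower.
-/
lemma mul_left_mem_grKer {x : X} (hx : x ∈ V.grKer) (y : X) :
    mode V.Y x (-1) y ∈ V.grKer := by
  refine V.bilin_mem_grKer (f := modeₗ V.Y (-1)) (fun i j u hu hK v hv => ?_) hx y
  obtain ⟨o, ho, u', hu', rfl⟩ := V.exists_lower_of_mem_grKer hu hK
  refine V.mem_grKer_of_mem_bi (V.mode_mem_bi hu hv _) ?_
  have h1 := V.zhuMode_sub_mode_mem_supp (S := {i}) (T := {j}) (U := {l | ∃ t : ℕ, l =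
      (i.1 + j.1 - 2 * -1 - 2 - 2 - 2 * (t : ℤ), i.2 + j.2 - 2 * -1 - 2 - 2 - 2 * (t : ℤ))})
    (by rintro _ rfl _ rfl t; exact ⟨t, by ext <;> simp⟩) (V.mem_supp_singleton hu)
    (V.mem_supp_singleton hv)
  have h2 := V.zhuMode_mem_supp (T := {j}) (U := {l | ∃ t : ℕ, l =
      (i.1 + j.1 - 2 * -1 - 2 - 2 - 2 * (t : ℤ), i.2 + j.2 - 2 * -1 - 2 - 2 - 2 * (t : ℤ))})
    (by
      rintro _ ⟨s, rfl⟩ _ rfl t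
      exact ⟨s + t, by ext <;> push_cast <;> ring⟩) hu' (V.mem_supp_singleton hv)
  have h3 := V.zhuMode_O_left v ho
  have := Submodule.add_mem_sup h3 (sub_mem h2 h1)
  have e : V.zhuMode (-1) o v + (V.zhuMode (-1) u' v - (V.zhuMode (-1) (o + u') v
      - mode V.Y (o + u') (-1) v)) = modeₗ V.Y (-1) (o + u') v := by
    rw [map_add (V.zhuMode (-1)), LinearMap.add_apply, modeₗ_apply]
    abel
  rw [e] at this
  exact this

lemma mul_right_mem_grKer {x : X} (hx : x ∈ V.grKer) (y : X) :
    mode V.Y y (-1) x ∈ V.grKer := by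
  refine V.bilin_mem_grKer (f := (modeₗ V.Y (-1)).flip) (fun i j u hu hK v hv => ?_) hx y
  have := add_mem (V.C2_le_grKer (V.mul_comm_C2 hv.1 hu.1))
    (Submodule.smul_mem V.grKer ((-1 : ℂ) ^ (j.1 * i.1)) (V.mul_left_mem_grKer hK v))
  rwa [sub_add_cancel] at this

/-- The same detour as for the product, through the super commutator: that of o and v lies in O(V)
since O(V) is a two-sided ideal, and that of u' and v is lower. -/
lemma bracket_left_mem_grKer {x : X} (hx : x ∈ V.grKer) (y : X) :
    mode V.Y x 0 y ∈ V.grKer := by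
  refine V.bilin_mem_grKer (f := modeₗ V.Y 0) (fun i j u hu hK v hv => ?_) hx y
  obtain ⟨o, ho, u', hu', rfl⟩ := V.exists_lower_of_mem_grKer hu hK
  refine V.mem_grKer_of_mem_bi (V.mode_mem_bi hu hv _) ?_
  have h1 := V.superComm_sub_mode_mem (p := i.1) (q := j.1) (S := {i}) (T := {j})
    (U := {l | ∃ t : ℕ, l =
      (i.1 + j.1 - 2 * 0 - 2 - 2 - 2 * (t : ℤ), i.2 + j.2 - 2 * 0 - 2 - 2 - 2 * (t : ℤ))})
    (by rintro _ rfl; simp) (by rintro _ rfl; simp)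
    (by rintro _ rfl _ rfl t; exact ⟨t, by ext <;> simp <;> ring⟩) (V.mem_supp_singleton hu)
    (V.mem_supp_singleton hv)
  have h2 := V.superComm_sub_mode_mem (p := i.1) (q := j.1) (T := {j})
    (U := {l | ∃ t : ℕ, l =
      (i.1 + j.1 - 2 * 0 - 2 - 2 - 2 * (t : ℤ), i.2 + j.2 - 2 * 0 - 2 - 2 - 2 * (t : ℤ))})
    (by rintro _ ⟨s, rfl⟩; exact ⟨1 + s, by push_cast; ring⟩) (by rintro _ rfl; simp)
    (by
      rintro _ ⟨s, rfl⟩ _ rfl t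
      exact ⟨s + 1 + t, by ext <;> push_cast <;> ring⟩) hu' (V.mem_supp_singleton hv)
  have h3 : V.superComm i.1 j.1 o v ∈ V.O :=
    sub_mem (V.zhuMode_O_left v ho) (Submodule.smul_mem _ _ (V.zhuMode_O_right v ho))
  have h4 : mode V.Y u' 0 v ∈ V.low (i.1 + j.1 - 2 * 0 - 2 - 2, i.2 + j.2 - 2 * 0 - 2 - 2) := by
    refine V.bilin_supp_mem (modeₗ V.Y 0) (T := {j}) ?_ hu' (V.mem_supp_singleton hv)
    rintro _ ⟨s, rfl⟩ _ rfl a ha b hb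
    exact V.mode_mem_low ha hb 0 s (by ring) (by ring)
  have := add_mem (sub_mem (add_mem h2 (Submodule.mem_sup_left h3)) h1)
    (Submodule.mem_sup_right h4)
  have e : V.superComm i.1 j.1 u' v - mode V.Y u' 0 v + V.superComm i.1 j.1 o v
      - (V.superComm i.1 j.1 (o + u') v - mode V.Y (o + u') 0 v) + mode V.Y u' 0 v
      = modeₗ V.Y 0 (o + u') v := by
    rw [map_add (V.superComm i.1 j.1), LinearMap.add_apply, modeₗ_apply]
    abel
  rw [e] at this
  exact this

lemma bracket_right_mem_grKer {x : X} (hx : x ∈ V.grKer) (y : X) :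
    mode V.Y y 0 x ∈ V.grKer := by
  refine V.bilin_mem_grKer (f := (modeₗ V.Y 0).flip) (fun i j u hu hK v hv => ?_) hx y
  have := sub_mem (V.C2_le_grKer (V.bracket_skew_C2 hv.1 hu.1))
    (Submodule.smul_mem V.grKer ((-1 : ℂ) ^ (j.1 * i.1)) (V.bracket_left_mem_grKer hK v))
  rwa [add_sub_cancel_right] at this

/-- A vector that is the only one of its components on an orbit of the shift by `(2, 2)`, and whose
class is of lower degree or weight up to vectors of lower weight, lies in the kernel. -/
lemma proj_mem_of_lower {i : ℤ × ℤ} {x : X}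
    (hx : Grading.proj V.bi_internal {j | ∃ t : ℤ, j = (i.1 + 2 * t, i.2 + 2 * t)} x
      = Grading.proj V.bi_internal {i} x)
    (h : V.O.mkQ x ∈ V.zhuF (i.1 - 1) ⊔ V.zhuW (i.2 - 1)) :
    Grading.proj V.bi_internal {i} x ∈ V.O ⊔ V.low (i.1 - 2, i.2 - 2) := by
  obtain ⟨a, ha, b, hb, hab⟩ := Submodule.mem_sup.1 h
  rw [zhuF_eq] at ha
  rw [zhuW_eq] at hb
  obtain ⟨y, hy, rfl⟩ := ha
  obtain ⟨z, hz, rfl⟩ := hb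
  rw [← map_add, eq_comm, mkQ_eq_iff] at hab
  set C : Set (ℤ × ℤ) := {j | ∃ t : ℤ, j = (i.1 + 2 * t, i.2 + 2 * t)} with hC
  -- Cutting down to the orbit of i stays inside O(V). On that orbit, a degree below i.1 or a weight
  -- below i.2 means at least one full step (2, 2) down.
  have hO := V.proj_mem_O (S := C) (fun j => by
    constructor
    · rintro ⟨t, ht⟩
      obtain ⟨h1, h2⟩ := Prod.ext_iff.1 ht
      exact ⟨t + 1, Prod.ext (by simp at h1 ⊢; omega) (by simp at h2 ⊢; omega)⟩
    · rintro ⟨t, rfl⟩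
      exact ⟨t - 1, Prod.ext (by simp; ring) (by simp; ring)⟩) hab
  rw [map_sub, map_add, hx] at hO
  have hy' : Grading.proj V.bi_internal C y ∈ V.low (i.1 - 2, i.2 - 2) := by
    refine Grading.supp_mono ?_ (Grading.proj_mem_inter V.bi_internal hy)
    rintro _ ⟨⟨t, rfl⟩, ht⟩
    have ht : i.1 + 2 * t ≤ i.1 - 1 := ht
    exact ⟨(-1 - t).toNat, Prod.ext (by simp; omega) (by simp; omega)⟩
  have hz' : Grading.proj V.bi_internal C z ∈ V.low (i.1 - 2, i.2 - 2) := by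
    refine Grading.supp_mono ?_ (Grading.proj_mem_inter V.bi_internal hz)
    rintro _ ⟨⟨t, rfl⟩, ht⟩
    have ht : i.2 + 2 * t ≤ i.2 - 1 := ht
    exact ⟨(-1 - t).toNat, Prod.ext (by simp; omega) (by simp; omega)⟩
  have := Submodule.add_mem_sup hO (add_mem hy' hz')
  rwa [sub_add_cancel] at this

end DGVertexOperatorAlgebra

end

/-! ### The maps to the associated graded spaces -/

section

variable {M : Type*} [AddCommGroup M] [Module ℂ M]

lemma grMk_eq_zero_iff (F : ℤ → Submodule ℂ M) (p : ℤ) (x : F p) :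
    grMk F p x = 0 ↔ (x : M) ∈ F (p - 1) :=
  Submodule.Quotient.mk_eq_zero _

lemma grMk_surjective (F : ℤ → Submodule ℂ M) (p : ℤ) : Function.Surjective (grMk F p) :=
  Submodule.mkQ_surjective _

lemma grMk_eq_grMk {F : ℤ → Submodule ℂ M} {p : ℤ} {x y : F p}
    (h : (x : M) - y ∈ F (p - 1)) : grMk F p x = grMk F p y := by
  rw [← sub_eq_zero, ← map_sub, grMk_eq_zero_iff]
  exact h

lemma symbol_eq_symbol {F : ℤ → Submodule ℂ M} {p : ℤ} {x y : M} (hx : x ∈ F p) (hy : y ∈ F p)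
    (h : x - y ∈ F (p - 1)) : symbol F p ⟨x, hx⟩ = symbol F p ⟨y, hy⟩ :=
  congrArg (DirectSum.lof ℂ ℤ (GrPiece F) p) (grMk_eq_grMk (x := ⟨x, hx⟩) (y := ⟨y, hy⟩) h)

/-- The component of `biSymbol` in its bidegree. -/
def biMk (F W : ℤ → Submodule ℂ M) (p k : ℤ) : ↥(F p ⊓ W k) →ₗ[ℂ] BiGrPiece F W (p, k) :=
  grMk (pieceFilt F W p) k ∘ₗ
    LinearMap.codRestrict (pieceFilt F W p k) (grMk F p ∘ₗ Submodule.inclusion inf_le_left)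
      (fun x => ⟨Submodule.inclusion inf_le_left x, x.2.2, rfl⟩)

/-- Vanishing in the iterated quotient means lying in F (p - 1) + (F p ∩ W (k - 1)). For elements of
F p the last intersection may be dropped, because F (p - 1) ≤ F p. -/
lemma biMk_eq_zero_iff {F W : ℤ → Submodule ℂ M} {p k : ℤ} (hF : F (p - 1) ≤ F p)
    (x : ↥(F p ⊓ W k)) :
    biMk F W p k x = 0 ↔ (x : M) ∈ F (p - 1) ⊔ W (k - 1) := by
  rw [biMk, LinearMap.comp_apply, grMk_eq_zero_iff]
  constructor
  · rintro ⟨y, hy, hxy⟩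
    have h : grMk F p (Submodule.inclusion inf_le_left x - y) = 0 := by
      rw [map_sub, sub_eq_zero]
      exact hxy.symm
    rw [grMk_eq_zero_iff] at h
    have := Submodule.add_mem_sup h (show (y : M) ∈ W (k - 1) from hy)
    rwa [Submodule.coe_sub, sub_add_cancel] at this
  · intro h
    obtain ⟨a, ha, b, hb, hab⟩ := Submodule.mem_sup.1 h
    have hbF : b ∈ F p := by
      rw [← eq_sub_iff_add_eq'] at hab
      rw [hab]
      exact sub_mem x.2.1 (hF ha)
    refine ⟨⟨b, hbF⟩, hb, (grMk_eq_grMk ?_).symm⟩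
    show (x : M) - b ∈ _
    rwa [← hab, add_sub_cancel_right]

lemma biSymbol_eq_biSymbol {F W : ℤ → Submodule ℂ M} {p k : ℤ} (hF : F (p - 1) ≤ F p) {x y : M}
    (hx : x ∈ F p ⊓ W k) (hy : y ∈ F p ⊓ W k) (h : x - y ∈ F (p - 1) ⊔ W (k - 1)) :
    biSymbol F W p k ⟨x, hx⟩ = biSymbol F W p k ⟨y, hy⟩ := by
  have : biMk F W p k ⟨x, hx⟩ = biMk F W p k ⟨y, hy⟩ := by
    rw [← sub_eq_zero, ← map_sub, biMk_eq_zero_iff hF]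
    exact h
  exact congrArg (DirectSum.lof ℂ (ℤ × ℤ) (BiGrPiece F W) (p, k)) this

end

/-! ### The three natural maps from V: surjectivity and common kernel -/

section

variable {X : Type*} [AddCommGroup X] [Module ℂ X]

namespace DGVertexOperatorAlgebra

variable (V : DGVertexOperatorAlgebra X)

lemma kerStable_grKer {C : Type*} [AddCommGroup C] [Module ℂ C] {σ : X →ₗ[ℂ] C}
    (hσ : ∀ x, σ x = 0 ↔ x ∈ V.grKer) : KerStable V.c2Ops σ where
  d a ha := (hσ _).2 (V.d_mem_grKer ((hσ a).1 ha))
  mul_left a b ha := (hσ _).2 (V.mul_left_mem_grKer ((hσ a).1 ha) b)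
  mul_right a b hb := (hσ _).2 (V.mul_right_mem_grKer ((hσ b).1 hb) a)
  bracket_left a b ha := (hσ _).2 (V.bracket_left_mem_grKer ((hσ a).1 ha) b)
  bracket_right a b hb := (hσ _).2 (V.bracket_right_mem_grKer ((hσ b).1 hb) a)

/-- A surjection with kernel `grKer` induces a structure on its target and a morphism from the
`C₂`-algebra. -/
theorem exists_image_of_c2 {C : Type*} [AddCommGroup C] [Module ℂ C] {σ : X →ₗ[ℂ] C}
    (hsurj : Function.Surjective σ) (hσ : ∀ x, σ x = 0 ↔ x ∈ V.grKer)
    {R : PoissonData V.C2Algebra} (hR : V.IsC2Structure R) {deg' wt' : ℤ → Submodule ℂ C}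
    (hdeg : ∀ p, (V.deg p).map σ = deg' p) (hwt : ∀ k, (V.wt k).map σ = wt' k) :
    ∃ (Q : PoissonData C) (eta : V.C2Algebra →ₗ[ℂ] C),
      IsAlgHom V.c2Ops.toAlgData Q.toAlgData σ ∧
      (∀ u v, σ (mode V.Y u 0 v) = Q.bracket (σ u) (σ v)) ∧
      IsWeightGradedDGPoisson Q deg' wt' ∧ (∀ u, eta (V.C2.mkQ u) = σ u) ∧
      IsDGPoissonHom R V.c2Deg Q deg' eta ∧ Preserves V.c2Wt wt' eta ∧
      Function.Surjective eta := by
  obtain ⟨Q, hQ, hb⟩ := (V.kerStable_grKer hσ).exists_image hsurj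
  have hker : ∀ x, σ x = 0 → ∀ S, σ (Grading.proj V.bi_internal S x) = 0 := fun x hx S =>
    (hσ _).2 (V.proj_mem_grKer S ((hσ x).1 hx))
  set eta : V.C2Algebra →ₗ[ℂ] C := V.C2.liftQ σ fun x hx => (hσ x).2 (V.C2_le_grKer hx)
  have he : ∀ u, eta (V.C2.mkQ u) = σ u := fun u => rfl
  have hcomp : eta ∘ₗ V.C2.mkQ = σ := LinearMap.ext he
  have mapdeg : ∀ p, (V.c2Deg p).map eta = deg' p := fun p => by
    rw [c2Deg, ← Submodule.map_comp, hcomp, hdeg]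
  have mapwt : ∀ p, (V.c2Wt p).map eta = wt' p := fun p => by
    rw [c2Wt, ← Submodule.map_comp, hcomp, hwt]
  have hs : Function.Surjective eta := fun c => by
    obtain ⟨x, rfl⟩ := hsurj c
    exact ⟨V.C2.mkQ x, rfl⟩
  have hom : IsAlgHom R.toAlgData Q.toAlgData eta := by
    refine ⟨?_, fun a b => ?_, fun a => ?_⟩
    · rw [hR.one, he]
      exact hQ.map_one
    · obtain ⟨u, rfl⟩ := V.C2.mkQ_surjective a
      obtain ⟨v, rfl⟩ := V.C2.mkQ_surjective b
      rw [hR.mul, he, he, he]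
      exact hQ.map_mul u v
    · obtain ⟨u, rfl⟩ := V.C2.mkQ_surjective a
      rw [hR.d, he, he]
      exact hQ.map_d u
  have hbr : ∀ a b, eta (R.bracket a b) = Q.bracket (eta a) (eta b) := by
    intro a b
    obtain ⟨u, rfl⟩ := V.C2.mkQ_surjective a
    obtain ⟨v, rfl⟩ := V.C2.mkQ_surjective b
    rw [hR.bracket, he, he, he]
    exact hb u v
  refine ⟨Q, eta, hQ, hb, ?_, he, ⟨hom, hbr, ?_⟩, ?_, hs⟩
  -- The algebraic identities of Q are images of those of R(V). Only the direct sum decompositions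
  -- need the homogeneity of the kernel.
  · refine (V.isWeightGradedDGPoisson_c2 hR).map hs hom hbr mapdeg mapwt ?_ ?_ ?_
    · rw [← funext hdeg]
      exact V.isInternal_map_deg hsurj hker
    · rw [← funext hwt]
      exact V.isInternal_map_wt hsurj hker
    · rw [← funext hdeg, ← funext hwt]
      exact V.isInternal_map_bi hsurj hker
  · exact fun p a ha => mapdeg p ▸ Submodule.mem_map_of_mem ha
  · exact fun p a ha => mapwt p ▸ Submodule.mem_map_of_mem ha

lemma fil_mono_F {p q : ℤ} (h : p ≤ q) : V.zhuF p ≤ V.zhuF q := by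
  rw [zhuF_eq, zhuF_eq]
  exact V.fil_mono fun i hi => le_trans hi h

lemma mkQ_mem_zhuF {p : ℤ} {u : X} (hu : u ∈ V.deg p) : V.O.mkQ u ∈ V.zhuF p :=
  Submodule.mem_map_of_mem (mem_filtOf le_rfl hu)

lemma mkQ_mem_zhuW {k : ℤ} {u : X} (hu : u ∈ V.wt k) : V.O.mkQ u ∈ V.zhuW k :=
  Submodule.mem_map_of_mem (mem_filtOf le_rfl hu)

/-- The class of a vector of degree `p` in `F p / F (p - 1)`. -/
def toPieceF (p : ℤ) : V.deg p →ₗ[ℂ] GrPiece V.zhuF p :=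
  grMk V.zhuF p ∘ₗ LinearMap.codRestrict (V.zhuF p) (V.O.mkQ ∘ₗ (V.deg p).subtype)
    fun u => V.mkQ_mem_zhuF u.2

/-- The class of a vector of weight `k / 2` in `W k / W (k - 1)`. -/
def toPieceW (k : ℤ) : V.wt k →ₗ[ℂ] GrPiece V.zhuW k :=
  grMk V.zhuW k ∘ₗ LinearMap.codRestrict (V.zhuW k) (V.O.mkQ ∘ₗ (V.wt k).subtype)
    fun u => V.mkQ_mem_zhuW u.2

/-- The class of a bihomogeneous vector in the iterated associated graded space. -/
def toPieceFW (i : ℤ × ℤ) : V.bi i →ₗ[ℂ] BiGrPiece V.zhuF V.zhuW i :=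
  biMk V.zhuF V.zhuW i.1 i.2 ∘ₗ
    LinearMap.codRestrict (V.zhuF i.1 ⊓ V.zhuW i.2) (V.O.mkQ ∘ₗ (V.bi i).subtype)
      fun u => ⟨V.mkQ_mem_zhuF u.2.1, V.mkQ_mem_zhuW u.2.2⟩

lemma exists_deg_of_mem_zhuF {p : ℤ} {x : V.Zhu} (hx : x ∈ V.zhuF p) :
    ∃ u ∈ V.deg p, x - V.O.mkQ u ∈ V.zhuF (p - 1) := by
  rw [zhuF_eq] at hx
  obtain ⟨y, hy, rfl⟩ := hx
  refine ⟨Grading.proj V.bi_internal {i | i.1 = p} y, ?_, ?_⟩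
  · rw [deg_eq]
    exact Grading.proj_mem _ _ _
  · rw [← map_sub, zhuF_eq]
    refine V.mkQ_mem_fil ?_
    rw [sub_eq_of_eq_add' (Grading.proj_add_proj_compl V.bi_internal {i | i.1 = p} y).symm]
    refine Grading.supp_mono ?_ (Grading.proj_mem_inter V.bi_internal hy)
    rintro i ⟨h1, h2⟩
    have h1 : i.1 ≠ p := h1
    have h2 : i.1 ≤ p := h2
    show i.1 ≤ p - 1
    omega

/-- A single representative meets both bounds by `zhuF_inf_zhuW`, and its part of weight k / 2 keeps
the bound on degrees. -/
lemma exists_wt_of_mem_inf {p k : ℤ} {x : V.Zhu} (hx : x ∈ V.zhuF p ⊓ V.zhuW k) :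
    ∃ u ∈ V.wt k, u ∈ Grading.supp V.bi {i | i.1 ≤ p} ∧ x - V.O.mkQ u ∈ V.zhuW (k - 1) := by
  rw [zhuF_inf_zhuW] at hx
  obtain ⟨y, hy, rfl⟩ := hx
  refine ⟨Grading.proj V.bi_internal {i | i.2 = k} y, ?_, ?_, ?_⟩
  · rw [wt_eq]
    exact Grading.proj_mem _ _ _
  · exact Grading.supp_mono (fun i hi => hi.2.1) (Grading.proj_mem_inter V.bi_internal hy)
  · rw [← map_sub, zhuW_eq]
    refine V.mkQ_mem_fil ?_
    rw [sub_eq_of_eq_add' (Grading.proj_add_proj_compl V.bi_internal {i | i.2 = k} y).symm]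
    refine Grading.supp_mono ?_ (Grading.proj_mem_inter V.bi_internal hy)
    rintro i ⟨h1, h2⟩
    have h1 : i.2 ≠ k := h1
    have h2 : i.2 ≤ k := h2.2
    show i.2 ≤ k - 1
    omega

lemma exists_wt_of_mem_zhuW {k : ℤ} {x : V.Zhu} (hx : x ∈ V.zhuW k) :
    ∃ u ∈ V.wt k, x - V.O.mkQ u ∈ V.zhuW (k - 1) := by
  rw [zhuW_eq] at hx
  obtain ⟨y, hy, rfl⟩ := hx
  refine ⟨Grading.proj V.bi_internal {i | i.2 = k} y, ?_, ?_⟩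
  · rw [wt_eq]
    exact Grading.proj_mem _ _ _
  · rw [← map_sub, zhuW_eq]
    refine V.mkQ_mem_fil ?_
    rw [sub_eq_of_eq_add' (Grading.proj_add_proj_compl V.bi_internal {i | i.2 = k} y).symm]
    refine Grading.supp_mono ?_ (Grading.proj_mem_inter V.bi_internal hy)
    rintro i ⟨h1, h2⟩
    have h1 : i.2 ≠ k := h1
    have h2 : i.2 ≤ k := h2
    show i.2 ≤ k - 1
    omega

lemma exists_bi_of_mem_inf {p k : ℤ} {x : V.Zhu} (hx : x ∈ V.zhuF p ⊓ V.zhuW k) :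
    ∃ u ∈ V.bi (p, k),
      x - V.O.mkQ u ∈ V.zhuF (p - 1) ⊓ V.zhuW k ⊔ V.zhuF p ⊓ V.zhuW (k - 1) := by
  simp only [zhuF_inf_zhuW] at hx ⊢
  obtain ⟨y, hy, rfl⟩ := hx
  refine ⟨Grading.proj V.bi_internal {(p, k)} y, Grading.proj_singleton_mem _ _ _, ?_⟩
  rw [← map_sub,
    sub_eq_of_eq_add' (Grading.proj_add_proj_compl V.bi_internal {(p, k)} y).symm]
  have h := Grading.proj_mem_inter V.bi_internal (S := {(p, k)}ᶜ) hy
  rw [fil, fil, ← Submodule.map_sup]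
  refine Submodule.mem_map_of_mem (Grading.supp_le ?_ h)
  rintro i ⟨h1, h2⟩ z hz
  have h2 : i.1 ≤ p ∧ i.2 ≤ k := h2
  by_cases hi : i.1 ≤ p - 1
  · exact Submodule.mem_sup_left (Grading.mem_supp (G := V.bi)
      (show i ∈ {i : ℤ × ℤ | i.1 ≤ p - 1 ∧ i.2 ≤ k} from ⟨hi, h2.2⟩) hz)
  · refine Submodule.mem_sup_right (Grading.mem_supp (G := V.bi)
      (show i ∈ {i : ℤ × ℤ | i.1 ≤ p ∧ i.2 ≤ k - 1} from ⟨h2.1, ?_⟩) hz)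
    have : i.2 ≠ k := fun h3 => h1 (Prod.ext (by omega) h3)
    omega

lemma low_le_zhuF {i : ℤ × ℤ} {x : X} (hx : x ∈ V.O ⊔ V.low (i.1 - 2, i.2 - 2)) :
    V.O.mkQ x ∈ V.zhuF (i.1 - 1) := by
  rw [zhuF_eq, mkQ_mem_fil_iff]
  refine sup_le_sup_left (V.low_le_supp fun t => ?_) _ hx
  show i.1 - 2 - 2 * (t : ℤ) ≤ i.1 - 1
  omega

lemma low_le_zhuW {i : ℤ × ℤ} {x : X} (hx : x ∈ V.O ⊔ V.low (i.1 - 2, i.2 - 2)) :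
    V.O.mkQ x ∈ V.zhuW (i.2 - 1) := by
  rw [zhuW_eq, mkQ_mem_fil_iff]
  refine sup_le_sup_left (V.low_le_supp fun t => ?_) _ hx
  show i.2 - 2 - 2 * (t : ℤ) ≤ i.2 - 1
  omega

/-- The map from `V` to the associated graded space for the filtration by degree. -/
def sigmaF : X →ₗ[ℂ] Gr V.zhuF := Grading.gradedMap V.deg_internal V.toPieceF

/-- The map from `V` to the associated graded space for the filtration by weight. -/
def sigmaW : X →ₗ[ℂ] Gr V.zhuW := Grading.gradedMap V.isInternal_wt V.toPieceW

/-- The map from `V` to the iterated associated graded space. -/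
def sigmaFW : X →ₗ[ℂ] BiGr V.zhuF V.zhuW := Grading.gradedMap V.bi_internal V.toPieceFW

lemma sigmaF_of_mem {p : ℤ} {u : X} (hu : u ∈ V.deg p) :
    V.sigmaF u = symbol V.zhuF p ⟨V.O.mkQ u, V.mkQ_mem_zhuF hu⟩ :=
  Grading.gradedMap_of_mem V.deg_internal V.toPieceF hu

lemma sigmaW_of_mem {k : ℤ} {u : X} (hu : u ∈ V.wt k) :
    V.sigmaW u = symbol V.zhuW k ⟨V.O.mkQ u, V.mkQ_mem_zhuW hu⟩ :=
  Grading.gradedMap_of_mem V.isInternal_wt V.toPieceW hu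

lemma sigmaFW_of_mem {p k : ℤ} {u : X} (hu : u ∈ V.bi (p, k)) :
    V.sigmaFW u
      = biSymbol V.zhuF V.zhuW p k ⟨V.O.mkQ u, V.mkQ_mem_zhuF hu.1, V.mkQ_mem_zhuW hu.2⟩ :=
  Grading.gradedMap_of_mem V.bi_internal V.toPieceFW hu

lemma toPieceF_surjective (p : ℤ) : Function.Surjective (V.toPieceF p) := by
  intro z
  obtain ⟨x, rfl⟩ := grMk_surjective V.zhuF p z
  obtain ⟨u, hu, h⟩ := V.exists_deg_of_mem_zhuF x.2
  exact ⟨⟨u, hu⟩, (grMk_eq_grMk h).symm⟩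

lemma toPieceW_surjective (k : ℤ) : Function.Surjective (V.toPieceW k) := by
  intro z
  obtain ⟨x, rfl⟩ := grMk_surjective V.zhuW k z
  obtain ⟨u, hu, h⟩ := V.exists_wt_of_mem_zhuW x.2
  exact ⟨⟨u, hu⟩, (grMk_eq_grMk h).symm⟩

lemma toPieceFW_surjective (i : ℤ × ℤ) : Function.Surjective (V.toPieceFW i) := by
  intro z
  obtain ⟨⟨_, x, hx, rfl⟩, rfl⟩ := grMk_surjective (pieceFilt V.zhuF V.zhuW i.1) i.2 z
  have hx' : (x : V.Zhu) ∈ V.zhuF i.1 ⊓ V.zhuW i.2 := ⟨x.2, hx⟩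
  obtain ⟨u, hu, h⟩ := V.exists_bi_of_mem_inf hx'
  refine ⟨⟨u, hu⟩, ?_⟩
  show biMk V.zhuF V.zhuW i.1 i.2 _ = biMk V.zhuF V.zhuW i.1 i.2 ⟨x, hx'⟩
  rw [eq_comm, ← sub_eq_zero, ← map_sub, biMk_eq_zero_iff (V.fil_mono_F (by omega))]
  exact (sup_le_sup inf_le_left inf_le_right : V.zhuF (i.1 - 1) ⊓ V.zhuW i.2
    ⊔ V.zhuF i.1 ⊓ V.zhuW (i.2 - 1) ≤ V.zhuF (i.1 - 1) ⊔ V.zhuW (i.2 - 1)) h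

lemma sigmaF_surjective : Function.Surjective V.sigmaF :=
  Grading.gradedMap_surjective _ _ V.toPieceF_surjective

lemma sigmaW_surjective : Function.Surjective V.sigmaW :=
  Grading.gradedMap_surjective _ _ V.toPieceW_surjective

lemma sigmaFW_surjective : Function.Surjective V.sigmaFW :=
  Grading.gradedMap_surjective _ _ V.toPieceFW_surjective

lemma proj_singleton_eq_of_mem {S T : Set (ℤ × ℤ)} {x : X} {i : ℤ × ℤ}
    (h : S ∩ T ⊆ {i}) (hi : i ∈ S ∩ T) :
    Grading.proj V.bi_internal S (Grading.proj V.bi_internal T x)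
      = Grading.proj V.bi_internal {i} x := by
  rw [Grading.proj_comp, h.antisymm (by simpa using hi)]

/-- Each orbit of the shift meets a given degree in one bidegree. So a drop in degree of the whole
degree p part of x can be tested orbit by orbit, that is, on bihomogeneous components. -/
lemma sigmaF_eq_zero_iff (x : X) : V.sigmaF x = 0 ↔ x ∈ V.grKer := by
  have h0 : V.sigmaF x = 0
      ↔ ∀ p, V.O.mkQ (Grading.proj V.bi_internal {i | i.1 = p} x) ∈ V.zhuF (p - 1) := by
    refine (Grading.gradedMap_eq_zero_iff _ _ x).trans (forall_congr' fun p => ?_)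
    rw [← proj_deg_eq]
    exact grMk_eq_zero_iff _ _ _
  rw [h0]
  constructor
  · intro h
    rw [mem_grKer]
    intro i
    have h1 : Grading.proj V.bi_internal {i} (Grading.proj V.bi_internal {j | j.1 = i.1} x)
        = Grading.proj V.bi_internal {i} x :=
      V.proj_singleton_eq_of_mem Set.inter_subset_left ⟨rfl, rfl⟩
    rw [← h1]
    refine V.proj_mem_of_lower ?_ (Submodule.mem_sup_left (h i.1))
    rw [h1]
    refine V.proj_singleton_eq_of_mem ?_ ⟨⟨0, by simp⟩, rfl⟩
    rintro _ ⟨⟨t, rfl⟩, ht⟩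
    have ht : i.1 + 2 * t = i.1 := ht
    exact Prod.ext (by simp; omega) (by simp; omega)
  · intro h p
    refine Grading.mem_of_proj_mem V.bi_internal (P := (V.zhuF (p - 1)).comap V.O.mkQ) fun i => ?_
    rw [Submodule.mem_comap]
    rcases V.proj_singleton_proj i {i | i.1 = p} x with ⟨hi, e⟩ | ⟨-, e⟩
    · obtain rfl : i.1 = p := hi
      rw [e]
      exact V.low_le_zhuF (V.mem_grKer.1 h i)
    · rw [e, map_zero]
      exact zero_mem _

lemma sigmaW_eq_zero_iff (x : X) : V.sigmaW x = 0 ↔ x ∈ V.grKer := by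
  have h0 : V.sigmaW x = 0
      ↔ ∀ k, V.O.mkQ (Grading.proj V.bi_internal {i | i.2 = k} x) ∈ V.zhuW (k - 1) := by
    refine (Grading.gradedMap_eq_zero_iff _ _ x).trans (forall_congr' fun p => ?_)
    rw [← proj_wt_eq]
    exact grMk_eq_zero_iff _ _ _
  rw [h0]
  constructor
  · intro h
    rw [mem_grKer]
    intro i
    have h1 : Grading.proj V.bi_internal {i} (Grading.proj V.bi_internal {j | j.2 = i.2} x)
        = Grading.proj V.bi_internal {i} x :=
      V.proj_singleton_eq_of_mem Set.inter_subset_left ⟨rfl, rfl⟩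
    rw [← h1]
    refine V.proj_mem_of_lower ?_ (Submodule.mem_sup_right (h i.2))
    rw [h1]
    refine V.proj_singleton_eq_of_mem ?_ ⟨⟨0, by simp⟩, rfl⟩
    rintro _ ⟨⟨t, rfl⟩, ht⟩
    have ht : i.2 + 2 * t = i.2 := ht
    exact Prod.ext (by simp; omega) (by simp; omega)
  · intro h k
    refine Grading.mem_of_proj_mem V.bi_internal (P := (V.zhuW (k - 1)).comap V.O.mkQ) fun i => ?_
    rw [Submodule.mem_comap]
    rcases V.proj_singleton_proj i {i | i.2 = k} x with ⟨hi, e⟩ | ⟨-, e⟩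
    · obtain rfl : i.2 = k := hi
      rw [e]
      exact V.low_le_zhuW (V.mem_grKer.1 h i)
    · rw [e, map_zero]
      exact zero_mem _

lemma sigmaFW_eq_zero_iff (x : X) : V.sigmaFW x = 0 ↔ x ∈ V.grKer := by
  rw [sigmaFW, Grading.gradedMap_eq_zero_iff, mem_grKer]
  refine forall_congr' fun i => ?_
  rw [toPieceFW, LinearMap.comp_apply, biMk_eq_zero_iff (V.fil_mono_F (by omega))]
  constructor
  · intro h
    have hi := Grading.proj_singleton_mem V.bi_internal i x
    have h1 := Grading.proj_self V.bi_internal hi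
    rw [← h1]
    refine V.proj_mem_of_lower ?_ h
    rw [h1]
    exact V.proj_singleton_eq_of_mem Set.inter_subset_right ⟨⟨0, by simp⟩, rfl⟩
  · intro h
    exact Submodule.mem_sup_left (V.low_le_zhuF h)

lemma map_sigmaF (p : ℤ) : (V.deg p).map V.sigmaF = grDeg V.zhuF p :=
  Grading.map_gradedMap _ _ V.toPieceF_surjective p

lemma map_sigmaW (k : ℤ) : (V.wt k).map V.sigmaW = grDeg V.zhuW k :=
  Grading.map_gradedMap _ _ V.toPieceW_surjective k

lemma map_sigmaFW (i : ℤ × ℤ) : (V.bi i).map V.sigmaFW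
    = LinearMap.range (DirectSum.lof ℂ (ℤ × ℤ) (BiGrPiece V.zhuF V.zhuW) i) :=
  Grading.map_gradedMap _ _ V.toPieceFW_surjective i

lemma map_sigmaFW_deg (p : ℤ) : (V.deg p).map V.sigmaFW = biGrDeg V.zhuF V.zhuW p := by
  have : V.deg p = ⨆ k, V.bi (p, k) := by
    rw [deg_eq]
    refine le_antisymm (Grading.supp_le ?_) (iSup_le fun k u hu =>
      Grading.mem_supp (G := V.bi) (show (p, k) ∈ {i : ℤ × ℤ | i.1 = p} from rfl) hu)
    rintro ⟨_, k⟩ rfl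
    exact le_iSup (fun k => V.bi (_, k)) k
  rw [this, Submodule.map_iSup, biGrDeg]
  exact iSup_congr fun k => V.map_sigmaFW (p, k)

lemma map_sigmaFW_wt (k : ℤ) : (V.wt k).map V.sigmaFW = biGrWt V.zhuF V.zhuW k := by
  have : V.wt k = ⨆ p, V.bi (p, k) := by
    rw [wt_eq]
    refine le_antisymm (Grading.supp_le ?_) (iSup_le fun p u hu =>
      Grading.mem_supp (G := V.bi) (show (p, k) ∈ {i : ℤ × ℤ | i.2 = k} from rfl) hu)
    rintro ⟨p, _⟩ rfl
    exact le_iSup (fun p => V.bi (p, _)) p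
  rw [this, Submodule.map_iSup, biGrWt]
  exact iSup_congr fun p => V.map_sigmaFW (p, k)

/-- Identifies the filtration induced by F on the graded space for W with the one attached to the
degree grading inherited from V, so that `IsWeightGradedDGPoisson.filtered` applies. -/
lemma grFilt_eq (i : ℤ) :
    grFilt V.zhuF V.zhuW i = filtOf (fun q => (V.deg q).map V.sigmaW) i := by
  have h : filtOf (fun q => (V.deg q).map V.sigmaW) i
      = (Grading.supp V.bi {j | j.1 ≤ i}).map V.sigmaW := by
    rw [← filtOf_deg, filtOf, filtOf]
    simp only [Submodule.map_iSup]
  rw [h]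
  refine le_antisymm (iSup_le fun k => ?_) ?_
  · rintro _ ⟨⟨x, hxW⟩, hxF, rfl⟩
    obtain ⟨u, hu, hu', hx⟩ := V.exists_wt_of_mem_inf (p := i) ⟨hxF, hxW⟩
    refine ⟨u, hu', ?_⟩
    rw [V.sigmaW_of_mem hu]
    exact (symbol_eq_symbol _ _ hx).symm
  · rw [Submodule.map_le_iff_le_comap]
    refine Grading.supp_le fun j hj u hu => ?_
    rw [Submodule.mem_comap, V.sigmaW_of_mem hu.2]
    exact Submodule.mem_iSup_of_mem j.2
      ⟨⟨_, V.mkQ_mem_zhuW hu.2⟩, V.fil_mono_F hj (V.mkQ_mem_zhuF hu.1), rfl⟩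

end DGVertexOperatorAlgebra

end

/-! ### The induced structures on the associated graded spaces -/

section

variable {X : Type*} [AddCommGroup X] [Module ℂ X]

namespace DGVertexOperatorAlgebra

variable {V : DGVertexOperatorAlgebra X} {A : AlgData V.Zhu}

lemma mode_mem_supp {S T U : Set (ℤ × ℤ)} (n : ℤ)
    (hU : ∀ i ∈ S, ∀ j ∈ T, (i.1 + j.1 - 2 * n - 2, i.2 + j.2 - 2 * n - 2) ∈ U) {x y : X}
    (hx : x ∈ Grading.supp V.bi S) (hy : y ∈ Grading.supp V.bi T) :
    mode V.Y x n y ∈ Grading.supp V.bi U :=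
  V.bilin_supp_mem (modeₗ V.Y n)
    (fun i hi j hj _ hu _ hv => Grading.mem_supp (hU i hi j hj) (V.mode_mem_bi hu hv n)) hx hy

lemma mode_mem_deg {p q r : ℤ} (n : ℤ) (hr : r = p + q - 2 * n - 2) {u v : X} (hu : u ∈ V.deg p)
    (hv : v ∈ V.deg q) : mode V.Y u n v ∈ V.deg r := by
  rw [hr]
  exact V.Y_mem p q n u hu v hv

lemma mode_mem_wt {k l m : ℤ} (n : ℤ) (hm : m = k + l - 2 * n - 2) {u v : X} (hu : u ∈ V.wt k)
    (hv : v ∈ V.wt l) : mode V.Y u n v ∈ V.wt m := by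
  rw [wt_eq] at hu hv ⊢
  refine mode_mem_supp n ?_ hu hv
  rintro i rfl j rfl
  exact hm.symm

namespace IsZhuStructure

lemma mul_mem_fil (hA : V.IsZhuStructure A) {S T U : Set (ℤ × ℤ)}
    (hU : ∀ i ∈ S, ∀ j ∈ T, ∀ t : ℕ, (i.1 + j.1 - 2 * (t : ℤ), i.2 + j.2 - 2 * (t : ℤ)) ∈ U)
    {x y : V.Zhu} (hx : x ∈ V.fil S) (hy : y ∈ V.fil T) : A.mul x y ∈ V.fil U := by
  obtain ⟨u, hu, rfl⟩ := hx
  obtain ⟨v, hv, rfl⟩ := hy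
  rw [hA.mul_mkQ]
  exact V.mkQ_mem_fil (V.zhuMode_mem_supp hU hu hv)

lemma mul_mem_zhuF (hA : V.IsZhuStructure A) {p q r : ℤ} (hr : p + q ≤ r) {x y : V.Zhu}
    (hx : x ∈ V.zhuF p)
    (hy : y ∈ V.zhuF q) : A.mul x y ∈ V.zhuF r := by
  rw [zhuF_eq] at hx hy ⊢
  refine hA.mul_mem_fil (fun i hi j hj t => ?_) hx hy
  have hi : i.1 ≤ p := hi
  have hj : j.1 ≤ q := hj
  show i.1 + j.1 - 2 * (t : ℤ) ≤ r
  omega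

lemma mul_mem_zhuW (hA : V.IsZhuStructure A) {k l m : ℤ} (hm : k + l ≤ m) {x y : V.Zhu}
    (hx : x ∈ V.zhuW k)
    (hy : y ∈ V.zhuW l) : A.mul x y ∈ V.zhuW m := by
  rw [zhuW_eq] at hx hy ⊢
  refine hA.mul_mem_fil (fun i hi j hj t => ?_) hx hy
  have hi : i.2 ≤ k := hi
  have hj : j.2 ≤ l := hj
  show i.2 + j.2 - 2 * (t : ℤ) ≤ m
  omega

lemma d_mem_fil (hA : V.IsZhuStructure A) {S U : Set (ℤ × ℤ)} (hU : ∀ i ∈ S, (i.1 + 1, i.2) ∈ U)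
    {x : V.Zhu}
    (hx : x ∈ V.fil S) : A.d x ∈ V.fil U := by
  obtain ⟨u, hu, rfl⟩ := hx
  rw [hA.d]
  exact V.mkQ_mem_fil (Grading.supp_le (P := (Grading.supp V.bi U).comap V.d)
    (fun i hi u hu => Grading.mem_supp (hU i hi) (V.d_mem_bi hu)) hu)

lemma d_mem_zhuF (hA : V.IsZhuStructure A) {p q : ℤ} (hq : p + 1 ≤ q) {x : V.Zhu}
    (hx : x ∈ V.zhuF p) :
    A.d x ∈ V.zhuF q := by
  rw [zhuF_eq] at hx ⊢
  exact hA.d_mem_fil (fun i hi => (add_le_add_left hi 1).trans hq) hx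

lemma d_mem_zhuW (hA : V.IsZhuStructure A) {k : ℤ} {x : V.Zhu}
    (hx : x ∈ V.zhuW k) : A.d x ∈ V.zhuW k := by
  rw [zhuW_eq] at hx ⊢
  exact hA.d_mem_fil (fun i hi => hi) hx

lemma mkQ_mode_sub_mul_mem_zhuF (hA : V.IsZhuStructure A) {p q : ℤ} {u v : X} (hu : u ∈ V.deg p)
    (hv : v ∈ V.deg q) :
    V.O.mkQ (mode V.Y u (-1) v) - A.mul (V.O.mkQ u) (V.O.mkQ v) ∈ V.zhuF (p + q - 1) := by
  rw [hA.mul_mkQ, ← neg_mem_iff, neg_sub, ← map_sub, zhuF_eq]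
  rw [deg_eq] at hu hv
  refine V.mkQ_mem_fil (V.zhuMode_sub_mode_mem_supp ?_ hu hv)
  rintro i rfl j rfl t
  show i.1 + j.1 - 2 - 2 * (t : ℤ) ≤ i.1 + j.1 - 1
  omega

lemma mkQ_mode_sub_mul_mem_zhuW (hA : V.IsZhuStructure A) {k l : ℤ} {u v : X} (hu : u ∈ V.wt k)
    (hv : v ∈ V.wt l) :
    V.O.mkQ (mode V.Y u (-1) v) - A.mul (V.O.mkQ u) (V.O.mkQ v) ∈ V.zhuW (k + l - 1) := by
  rw [hA.mul_mkQ, ← neg_mem_iff, neg_sub, ← map_sub, zhuW_eq]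
  rw [wt_eq] at hu hv
  refine V.mkQ_mem_fil (V.zhuMode_sub_mode_mem_supp ?_ hu hv)
  rintro i rfl j rfl t
  show i.2 + j.2 - 2 - 2 * (t : ℤ) ≤ i.2 + j.2 - 1
  omega

lemma superCommutator_eq (hA : V.IsZhuStructure A) (p q : ℤ) (u v : X) :
    V.superCommutator A p q u v = V.O.mkQ (V.superComm p q u v) := by
  rw [superCommutator, hA.mul_mkQ, hA.mul_mkQ, superComm_apply, map_sub, map_smul]

lemma mkQ_bracket_sub_superCommutator_mem_fil (hA : V.IsZhuStructure A) {p q : ℤ}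
    {S T U : Set (ℤ × ℤ)}
    (hS : ∀ i ∈ S, i.1 = p) (hT : ∀ j ∈ T, j.1 = q)
    (hU : ∀ i ∈ S, ∀ j ∈ T, ∀ t : ℕ,
      (i.1 + j.1 - 4 - 2 * (t : ℤ), i.2 + j.2 - 4 - 2 * (t : ℤ)) ∈ U)
    {u v : X} (hu : u ∈ Grading.supp V.bi S) (hv : v ∈ Grading.supp V.bi T) :
    V.O.mkQ (mode V.Y u 0 v) - V.superCommutator A p q u v ∈ V.fil U := by
  rw [hA.superCommutator_eq, ← neg_mem_iff, neg_sub, ← map_sub, mkQ_mem_fil_iff]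
  refine V.superComm_sub_mode_mem (fun i hi => ?_) (fun j hj => ?_) hU hu hv
  · rw [hS i hi, sub_self]
    exact Even.zero
  · rw [hT j hj, sub_self]
    exact Even.zero

lemma mkQ_bracket_sub_superCommutator_mem_zhuF (hA : V.IsZhuStructure A) {p q : ℤ} {u v : X}
    (hu : u ∈ V.deg p)
    (hv : v ∈ V.deg q) :
    V.O.mkQ (mode V.Y u 0 v) - V.superCommutator A p q u v ∈ V.zhuF (p + q - 2 - 1) := by
  rw [zhuF_eq]
  rw [deg_eq] at hu hv
  refine hA.mkQ_bracket_sub_superCommutator_mem_fil (fun _ h => h) (fun _ h => h) ?_ hu hv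
  rintro i rfl j rfl t
  show i.1 + j.1 - 4 - 2 * (t : ℤ) ≤ i.1 + j.1 - 2 - 1
  omega

/-- This only serves to place the super commutator in its weight step. The equality of classes in
the iterated graded space already follows from the bound on the degree. -/
lemma mkQ_bracket_sub_superCommutator_mem_zhuW (hA : V.IsZhuStructure A) {p q k l : ℤ} {u v : X}
    (hu : u ∈ V.bi (p, k)) (hv : v ∈ V.bi (q, l)) :
    V.O.mkQ (mode V.Y u 0 v) - V.superCommutator A p q u v ∈ V.zhuW (k + l - 2) := by
  rw [zhuW_eq]
  refine hA.mkQ_bracket_sub_superCommutator_mem_fil (by rintro _ rfl; rfl) (by rintro _ rfl; rfl) ?_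
    (V.mem_supp_singleton hu) (V.mem_supp_singleton hv)
  rintro _ rfl _ rfl t
  show k + l - 4 - 2 * (t : ℤ) ≤ k + l - 2
  omega

end IsZhuStructure

/-- Lets x and y be exchanged for homogeneous representatives a and b: m - xy = (m - ab) - a(y - b)
- (x - a)y. -/
lemma sub_mul_mem {P : Submodule ℂ V.Zhu} {x y a b m : V.Zhu} (h1 : A.mul (x - a) y ∈ P)
    (h2 : A.mul a (y - b) ∈ P) (h3 : m - A.mul a b ∈ P) : m - A.mul x y ∈ P := by
  have := sub_mem (sub_mem h3 h2) h1
  rwa [map_sub A.mul, LinearMap.sub_apply, map_sub (A.mul a),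
    show m - A.mul a b - (A.mul a y - A.mul a b) - (A.mul x y - A.mul a y) = m - A.mul x y by
      abel] at this

/-- Arbitrary classes are replaced by those of homogeneous vectors, where G is computed in V through
`sigmaF`. The result differs from the operation of A(V) only by something of lower degree. -/
theorem isGrFStructure (hA : V.IsZhuStructure A) {G : PoissonData (Gr V.zhuF)}
    (hG : IsAlgHom V.c2Ops.toAlgData G.toAlgData V.sigmaF)
    (hb : ∀ u v, V.sigmaF (mode V.Y u 0 v) = G.bracket (V.sigmaF u) (V.sigmaF v)) :
    V.IsGrFStructure A G where
  one := by
    -- Taking A apart makes its unit a variable, which can then be replaced inside the membership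
    -- proof on which the symbol depends.
    obtain ⟨one, mul, d⟩ := A
    obtain rfl : one = V.O.mkQ V.vac := hA.one
    exact ⟨V.mkQ_mem_zhuF V.vac_mem_bi.1,
      hG.map_one.symm.trans (V.sigmaF_of_mem V.vac_mem_bi.1)⟩
  d p x hx := by
    obtain ⟨u, hu, h⟩ := V.exists_deg_of_mem_zhuF hx
    refine ⟨hA.d_mem_zhuF le_rfl hx, ?_⟩
    rw [symbol_eq_symbol hx (V.mkQ_mem_zhuF hu) h, ← V.sigmaF_of_mem hu, ← hG.map_d]
    refine (V.sigmaF_of_mem (V.d_mem p u hu)).trans (symbol_eq_symbol _ _ ?_)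
    rw [← hA.d, ← map_sub, ← neg_mem_iff, ← map_neg, neg_sub]
    exact hA.d_mem_zhuF (by omega) h
  mul p q x hx y hy := by
    obtain ⟨u, hu, h⟩ := V.exists_deg_of_mem_zhuF hx
    obtain ⟨v, hv, h'⟩ := V.exists_deg_of_mem_zhuF hy
    refine ⟨hA.mul_mem_zhuF le_rfl hx hy, ?_⟩
    rw [symbol_eq_symbol hx (V.mkQ_mem_zhuF hu) h, symbol_eq_symbol hy (V.mkQ_mem_zhuF hv) h',
      ← V.sigmaF_of_mem hu, ← V.sigmaF_of_mem hv, ← hG.map_mul]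
    refine (V.sigmaF_of_mem (mode_mem_deg (-1) (by ring) hu hv)).trans (symbol_eq_symbol _ _ ?_)
    exact sub_mul_mem (hA.mul_mem_zhuF (by omega) h hy)
      (hA.mul_mem_zhuF (by omega) (V.mkQ_mem_zhuF hu) h') (hA.mkQ_mode_sub_mul_mem_zhuF hu hv)
  bracket p q u hu v hv := by
    have hm : mode V.Y u 0 v ∈ V.deg (p + q - 2) := mode_mem_deg 0 (by ring) hu hv
    have h := hA.mkQ_bracket_sub_superCommutator_mem_zhuF hu hv
    have hs := sub_mem (V.mkQ_mem_zhuF hm) (V.fil_mono_F (by omega) h)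
    rw [sub_sub_cancel] at hs
    refine ⟨V.mkQ_mem_zhuF hu, V.mkQ_mem_zhuF hv, hs, ?_⟩
    rw [← V.sigmaF_of_mem hu, ← V.sigmaF_of_mem hv, ← hb]
    exact (V.sigmaF_of_mem hm).trans (symbol_eq_symbol _ _ h)

theorem isGrWStructure (hA : V.IsZhuStructure A) {G : AlgData (Gr V.zhuW)}
    (hG : IsAlgHom V.c2Ops.toAlgData G V.sigmaW) : V.IsGrWStructure A G where
  one := by
    obtain ⟨one, mul, d⟩ := A
    obtain rfl : one = V.O.mkQ V.vac := hA.one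
    exact ⟨V.mkQ_mem_zhuW V.vac_mem_bi.2,
      hG.map_one.symm.trans (V.sigmaW_of_mem V.vac_mem_bi.2)⟩
  d k x hx := by
    obtain ⟨u, hu, h⟩ := V.exists_wt_of_mem_zhuW hx
    refine ⟨hA.d_mem_zhuW hx, ?_⟩
    rw [symbol_eq_symbol hx (V.mkQ_mem_zhuW hu) h, ← V.sigmaW_of_mem hu, ← hG.map_d]
    refine (V.sigmaW_of_mem (V.d_mem_wt hu)).trans (symbol_eq_symbol _ _ ?_)
    rw [← hA.d, ← map_sub, ← neg_mem_iff, ← map_neg, neg_sub]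
    exact hA.d_mem_zhuW h
  mul k l x hx y hy := by
    obtain ⟨u, hu, h⟩ := V.exists_wt_of_mem_zhuW hx
    obtain ⟨v, hv, h'⟩ := V.exists_wt_of_mem_zhuW hy
    refine ⟨hA.mul_mem_zhuW le_rfl hx hy, ?_⟩
    rw [symbol_eq_symbol hx (V.mkQ_mem_zhuW hu) h, symbol_eq_symbol hy (V.mkQ_mem_zhuW hv) h',
      ← V.sigmaW_of_mem hu, ← V.sigmaW_of_mem hv, ← hG.map_mul]
    refine (V.sigmaW_of_mem (mode_mem_wt (-1) (by ring) hu hv)).trans (symbol_eq_symbol _ _ ?_)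
    exact sub_mul_mem (hA.mul_mem_zhuW (by omega) h hy)
      (hA.mul_mem_zhuW (by omega) (V.mkQ_mem_zhuW hu) h') (hA.mkQ_mode_sub_mul_mem_zhuW hu hv)

lemma exists_bi_of_mem_inf_sup {p k : ℤ} {x : V.Zhu} (hx : x ∈ V.zhuF p ⊓ V.zhuW k) :
    ∃ u ∈ V.bi (p, k), x - V.O.mkQ u ∈ V.zhuF (p - 1) ⊔ V.zhuW (k - 1) := by
  obtain ⟨u, hu, h⟩ := V.exists_bi_of_mem_inf hx
  exact ⟨u, hu, (sup_le_sup inf_le_left inf_le_right :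
    V.zhuF (p - 1) ⊓ V.zhuW k ⊔ V.zhuF p ⊓ V.zhuW (k - 1) ≤ _) h⟩

theorem isGrFWStructure (hA : V.IsZhuStructure A) {G : PoissonData (BiGr V.zhuF V.zhuW)}
    (hG : IsAlgHom V.c2Ops.toAlgData G.toAlgData V.sigmaFW)
    (hb : ∀ u v, V.sigmaFW (mode V.Y u 0 v) = G.bracket (V.sigmaFW u) (V.sigmaFW v)) :
    V.IsGrFWStructure A G where
  one := by
    obtain ⟨one, mul, d⟩ := A
    obtain rfl : one = V.O.mkQ V.vac := hA.one
    exact ⟨⟨V.mkQ_mem_zhuF V.vac_mem_bi.1, V.mkQ_mem_zhuW V.vac_mem_bi.2⟩,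
      hG.map_one.symm.trans (V.sigmaFW_of_mem V.vac_mem_bi)⟩
  d p k x hx := by
    obtain ⟨u, hu, h⟩ := exists_bi_of_mem_inf_sup hx
    refine ⟨⟨hA.d_mem_zhuF le_rfl hx.1, hA.d_mem_zhuW hx.2⟩, ?_⟩
    rw [biSymbol_eq_biSymbol (V.fil_mono_F (by omega)) hx
        ⟨V.mkQ_mem_zhuF hu.1, V.mkQ_mem_zhuW hu.2⟩ h,
      ← V.sigmaFW_of_mem hu, ← hG.map_d]
    refine (V.sigmaFW_of_mem (V.d_mem_bi hu)).trans
      (biSymbol_eq_biSymbol (V.fil_mono_F (by omega)) _ _ ?_)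
    rw [← hA.d, ← map_sub, ← neg_mem_iff, ← map_neg, neg_sub]
    obtain ⟨a, ha, b, hb, hab⟩ := Submodule.mem_sup.1 h
    rw [← hab, map_add]
    exact Submodule.add_mem_sup (hA.d_mem_zhuF (by omega) ha) (hA.d_mem_zhuW hb)
  mul p k q l x hx y hy := by
    obtain ⟨u, hu, h⟩ := exists_bi_of_mem_inf_sup hx
    obtain ⟨v, hv, h'⟩ := exists_bi_of_mem_inf_sup hy
    refine ⟨⟨hA.mul_mem_zhuF le_rfl hx.1 hy.1, hA.mul_mem_zhuW le_rfl hx.2 hy.2⟩, ?_⟩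
    rw [biSymbol_eq_biSymbol (V.fil_mono_F (by omega)) hx
        ⟨V.mkQ_mem_zhuF hu.1, V.mkQ_mem_zhuW hu.2⟩ h,
      biSymbol_eq_biSymbol (V.fil_mono_F (by omega)) hy
        ⟨V.mkQ_mem_zhuF hv.1, V.mkQ_mem_zhuW hv.2⟩ h',
      ← V.sigmaFW_of_mem hu, ← V.sigmaFW_of_mem hv, ← hG.map_mul]
    refine (V.sigmaFW_of_mem ⟨mode_mem_deg (-1) (by ring) hu.1 hv.1,
      mode_mem_wt (-1) (by ring) hu.2 hv.2⟩).trans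
      (biSymbol_eq_biSymbol (V.fil_mono_F (by omega)) _ _ ?_)
    refine sub_mul_mem (a := V.O.mkQ u) (b := V.O.mkQ v) ?_ ?_
      (Submodule.mem_sup_left (hA.mkQ_mode_sub_mul_mem_zhuF hu.1 hv.1))
    · obtain ⟨a, ha, b, hb, hab⟩ := Submodule.mem_sup.1 h
      rw [← hab, map_add, LinearMap.add_apply]
      exact Submodule.add_mem_sup (hA.mul_mem_zhuF (by omega) ha hy.1)
        (hA.mul_mem_zhuW (by omega) hb hy.2)
    · obtain ⟨a, ha, b, hb, hab⟩ := Submodule.mem_sup.1 h'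
      rw [← hab, map_add]
      exact Submodule.add_mem_sup (hA.mul_mem_zhuF (by omega) (V.mkQ_mem_zhuF hu.1) ha)
        (hA.mul_mem_zhuW (by omega) (V.mkQ_mem_zhuW hu.2) hb)
  bracket p k q l u hu v hv := by
    have hm : mode V.Y u 0 v ∈ V.bi (p + q - 2, k + l - 2) :=
      ⟨mode_mem_deg 0 (by ring) hu.1 hv.1, mode_mem_wt 0 (by ring) hu.2 hv.2⟩
    have hF := hA.mkQ_bracket_sub_superCommutator_mem_zhuF hu.1 hv.1
    have hs := sub_mem (V.mkQ_mem_zhuF hm.1) (V.fil_mono_F (by omega) hF)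
    have hs' := sub_mem (V.mkQ_mem_zhuW hm.2)
      (hA.mkQ_bracket_sub_superCommutator_mem_zhuW (p := p) (q := q) hu hv)
    rw [sub_sub_cancel] at hs hs'
    refine ⟨⟨V.mkQ_mem_zhuF hu.1, V.mkQ_mem_zhuW hu.2⟩,
      ⟨V.mkQ_mem_zhuF hv.1, V.mkQ_mem_zhuW hv.2⟩, ⟨hs, hs'⟩, ?_⟩
    rw [← V.sigmaFW_of_mem hu, ← V.sigmaFW_of_mem hv, ← hb]
    exact (V.sigmaFW_of_mem hm).trans
      (biSymbol_eq_biSymbol (V.fil_mono_F (by omega)) _ _ (Submodule.mem_sup_left hF))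

end DGVertexOperatorAlgebra

lemma Preserves.filtOf {B C : Type*} [AddCommGroup B] [Module ℂ B] [AddCommGroup C] [Module ℂ C]
    {G : ℤ → Submodule ℂ B} {H : ℤ → Submodule ℂ C} {f : B →ₗ[ℂ] C} (h : Preserves G H f) :
    Preserves (filtOf G) (filtOf H) f := fun i _ ha =>
  filtOf_le (P := (_root_.filtOf H i).comap f) (fun q hq a ha => mem_filtOf hq (h q a ha)) ha

end

/-! ### Assembly of the three parts -/

theorem mainTheorem5 {X : Type*} [AddCommGroup X] [Module ℂ X] (V : DGVertexOperatorAlgebra X) :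
    ∃ (R : PoissonData V.C2Algebra) (A : AlgData V.Zhu) (GF : PoissonData (Gr V.zhuF))
      (GW : AlgData (Gr V.zhuW)) (GFW : PoissonData (BiGr V.zhuF V.zhuW)),
      (V.IsC2Structure R ∧ V.IsZhuStructure A ∧ V.IsGrFStructure A GF ∧
        V.IsGrWStructure A GW ∧ V.IsGrFWStructure A GFW) ∧
      (IsDGPoisson R V.c2Deg ∧ IsDGPoisson GF (grDeg V.zhuF) ∧
        ∃ etaF : V.C2Algebra →ₗ[ℂ] Gr V.zhuF,
          V.IsEtaF etaF ∧ IsDGPoissonHom R V.c2Deg GF (grDeg V.zhuF) etaF ∧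
          Function.Surjective etaF) ∧
      (IsWeightGradedDiffFilteredComm R.toAlgData V.c2Wt V.c2Filt ∧
        IsWeightGradedDiffFilteredComm GW (grDeg V.zhuW) (grFilt V.zhuF V.zhuW) ∧
        ∃ etaW : V.C2Algebra →ₗ[ℂ] Gr V.zhuW,
          V.IsEtaW etaW ∧ IsAlgHom R.toAlgData GW etaW ∧
          Preserves V.c2Wt (grDeg V.zhuW) etaW ∧
          Preserves V.c2Filt (grFilt V.zhuF V.zhuW) etaW ∧
          Function.Surjective etaW) ∧
      (IsWeightGradedDGPoisson R V.c2Deg V.c2Wt ∧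
        IsWeightGradedDGPoisson GFW (biGrDeg V.zhuF V.zhuW) (biGrWt V.zhuF V.zhuW) ∧
        ∃ etaFW : V.C2Algebra →ₗ[ℂ] BiGr V.zhuF V.zhuW,
          V.IsEtaFW etaFW ∧
          IsDGPoissonHom R V.c2Deg GFW (biGrDeg V.zhuF V.zhuW) etaFW ∧
          Preserves V.c2Wt (biGrWt V.zhuF V.zhuW) etaFW ∧
          Function.Surjective etaFW) := by
  obtain ⟨R, hR⟩ := V.exists_isC2Structure
  obtain ⟨A, hA⟩ := V.exists_isZhuStructure
  have hRP := V.isWeightGradedDGPoisson_c2 hR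
  obtain ⟨GF, etaF, hF, hFb, hFP, hFe, hFh, -, hFs⟩ :=
    -- No weight grading is prescribed on this space, so it is taken to be the image of the one on
    -- V. The next application does the same with the degree, and `grFilt_eq` later recognises the
    -- resulting filtration.
    V.exists_image_of_c2 V.sigmaF_surjective V.sigmaF_eq_zero_iff hR V.map_sigmaF (fun _ => rfl)
  obtain ⟨GW, etaW, hW, -, hWP, hWe, hWh, hWw, hWs⟩ :=
    V.exists_image_of_c2 V.sigmaW_surjective V.sigmaW_eq_zero_iff hR (fun _ => rfl) V.map_sigmaW
  obtain ⟨GFW, etaFW, hFW, hFWb, hFWP, hFWe, hFWh, hFWw, hFWs⟩ :=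
    V.exists_image_of_c2 V.sigmaFW_surjective V.sigmaFW_eq_zero_iff hR V.map_sigmaFW_deg
      V.map_sigmaFW_wt
  have hfilt := funext V.grFilt_eq
  refine ⟨R, A, GF, GW.toAlgData, GFW, ⟨hR, hA, DGVertexOperatorAlgebra.isGrFStructure hA hF hFb,
    DGVertexOperatorAlgebra.isGrWStructure hA hW,
    DGVertexOperatorAlgebra.isGrFWStructure hA hFW hFWb⟩,
    ⟨hRP.toIsDGPoisson, hFP.toIsDGPoisson, etaF, ?_, hFh, hFs⟩,
    ⟨hRP.filtered, ?_, etaW, ?_, hWh.toIsAlgHom, hWw, ?_, hWs⟩,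
    hRP, hFWP, etaFW, ?_, hFWh, hFWw, hFWs⟩
  · exact fun p u hu => ⟨V.mkQ_mem_zhuF hu, (hFe u).trans (V.sigmaF_of_mem hu)⟩
  · rw [hfilt]
    exact hWP.filtered
  · exact fun k u hu => ⟨V.mkQ_mem_zhuW hu, (hWe u).trans (V.sigmaW_of_mem hu)⟩
  · rw [hfilt]
    exact hWh.map_deg.filtOf
  · exact fun p k u hu => ⟨⟨V.mkQ_mem_zhuF hu.1, V.mkQ_mem_zhuW hu.2⟩,
      (hFWe u).trans (V.sigmaFW_of_mem hu)⟩

end
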